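/- Let $\mathbb T^2=\mathbb R^2/\mathbb Z^2$ with a constant symplectic form $\omega=c\,dx^1\wedge dx^2$, $c\in\mathbb R\setminus\{0\}$, and let $\hbar\in\mathbb R\setminus\{0\}$. Let $\mathcal O_C(\mathbb R^2)$ be the space of smooth functions $h:\mathbb R^2\to\mathbb C$ for which there is one $k\in\mathbb Z$ such that $(1+|y|^2)^k\,\partial^\alpha h(y)$ is bounded for every multi-index $\alpha$, with its inductive limit topology. Let $\Omega(\mathbb T^2,\mathcal W)=\Gamma^\infty(\wedge^*\mathbb T^2)\,\widehat\otimes\,\mathcal O_C(\mathbb R^2)$ (completed projective tensor product) be the space of smooth differential forms on $\mathbb T^2$ with values in $\mathcal O_C(\mathbb R^2)$, graded by the form degree. Explicitly, its elements are the sums $\sum_s a_s\,dx^s$, $s\subseteq\{1,2\}$, whose coefficients $a_s=F$ are smooth functions $F(x,y)$ on $\mathbb T^2\times\mathbb R^2$ such that for every multi-index $\beta$ there is a $k$ such that for every multi-index $\alpha$ the function $(1+|y|^2)^{-k}\,\partial_x^\beta\partial_y^\alpha F(x,y)$ is bounded. Let $$Q=\sum_{i=1}^2 dx^i\wedge\Big(\frac{\partial}{\partial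 x^i}-\frac{\partial}{\partial y^i}\Big),$$ and let $*_\hbar$ be the product on $\Omega(\mathbb T^2,\mathcal W)$ given by $(F\,dx^s)*_\hbar(G\,dx^t)=(F*_\hbar G)\,dx^s\wedge dx^t$, where, for coefficients, $$(F*_\hbar G)(x,y)=\frac1{(\pi\hbar)^2}\int_{\mathbb R^2}\int_{\mathbb R^2}F(x,y+u)\,G(x,y+v)\,e^{-\frac{2i}{\hbar}\omega(u,v)}\,du\,dv$$ is an oscillatory integral (the limit as $\varepsilon\downarrow0$ of the integrals with the integrand multiplied by $\chi(\varepsilon u,\varepsilon v)$, for any Schwartz function $\chi$ with $\chi(0)=1$), and $du$, $dv$ denote the Liouville measure of $\omega$, that is, $|c|$ times Lebesgue measure. Define $\mathcal Q(f)(x,y)=f(x+y)$ for $f\in C^\infty(\mathbb T^2)$, $\sigma(F)(x)=F(x,0)$, and $f\star_\hbar g=\sigma(\mathcal Q(f)*_\hbar\mathcal Q(g))$. Then these oscillatory integrals converge and define elements of $\Omega^0(\mathbb T^2,\mathcal W)$; $(\Omega(\mathbb T^2,\mathcal W),*_\hbar,Q)$ is a unital differential graded algebra; $(C^\infty(\mathbb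 T^2),\star_\hbar,0)$, concentrated in degree $0$ with zero differential, is a unital differential graded algebra; and $$\mathcal Q:(C^\infty(\mathbb T^2),\star_\hbar,0)\to(\Omega(\mathbb T^2,\mathcal W),*_\hbar,Q)$$ is a quasi-isomorphism of differential graded algebras: it is linear, preserves degrees, products and units, commutes with the differentials, and induces an isomorphism in cohomology in every degree. -/

import Mathlib

open scoped ContDiff SchwartzMap Topology
open Filter MeasureTheory

noncomputable section

/-! ## Differential graded algebras, their cohomology and quasi-isomorphisms -/

/-- A (unital, associative, `ℕ`-graded) differential graded algebra over `ℂ`: a grading, a product,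
a unit and a differential on the complex vector space `A`. -/
structure IsDGA {A : Type*} [AddCommGroup A] [Module ℂ A] (deg : ℕ → Submodule ℂ A)
    (mul : A → A → A) (one : A) (d : A →ₗ[ℂ] A) : Prop where
  internal : DirectSum.IsInternal deg
  add_mul : ∀ a b c, mul (a + b) c = mul a c + mul b c
  mul_add : ∀ a b c, mul a (b + c) = mul a b + mul a c
  smul_mul : ∀ (z : ℂ) a b, mul (z • a) b = z • mul a b
  mul_smul : ∀ (z : ℂ) a b, mul a (z • b) = z • mul a b
  mul_assoc : ∀ a b c, mul (mul a b) c = mul a (mul b c)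
  one_mul : ∀ a, mul one a = a
  mul_one : ∀ a, mul a one = a
  one_mem : one ∈ deg 0
  mul_mem : ∀ i j a b, a ∈ deg i → b ∈ deg j → mul a b ∈ deg (i + j)
  d_mem : ∀ i a, a ∈ deg i → d a ∈ deg (i + 1)
  d_d : ∀ a, d (d a) = 0
  leibniz : ∀ i a b, a ∈ deg i → d (mul a b) = mul (d a) b + (-1 : ℂ) ^ i • mul a (d b)

/-- The cocycles of degree `k`. -/
def cocycles {A : Type*} [AddCommGroup A] [Module ℂ A] (deg : ℕ → Submodule ℂ A)
    (d : A →ₗ[ℂ] A) (k : ℕ) : Submodule ℂ A :=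
  deg k ⊓ LinearMap.ker d

/-- The coboundaries of degree `k`. -/
def coboundaries {A : Type*} [AddCommGroup A] [Module ℂ A] (deg : ℕ → Submodule ℂ A)
    (d : A →ₗ[ℂ] A) : ℕ → Submodule ℂ A
  | 0 => ⊥
  | k + 1 => (deg k).map d

/-- The cohomology in degree `k`. -/
abbrev Cohomology {A : Type*} [AddCommGroup A] [Module ℂ A] (deg : ℕ → Submodule ℂ A)
    (d : A →ₗ[ℂ] A) (k : ℕ) : Type _ :=
  cocycles deg d k ⧸ (coboundaries deg d k).submoduleOf (cocycles deg d k)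

/-- A linear map of degree `0` that commutes with the differentials. -/
structure IsCochainMap {A B : Type*} [AddCommGroup A] [Module ℂ A] [AddCommGroup B] [Module ℂ B]
    (degA : ℕ → Submodule ℂ A) (dA : A →ₗ[ℂ] A) (degB : ℕ → Submodule ℂ B) (dB : B →ₗ[ℂ] B)
    (φ : A →ₗ[ℂ] B) : Prop where
  map_deg : ∀ k a, a ∈ degA k → φ a ∈ degB k
  map_d : ∀ a, φ (dA a) = dB (φ a)

theorem IsCochainMap.map_cocycles {A B : Type*} [AddCommGroup A] [Module ℂ A] [AddCommGroup B]
    [Module ℂ B] {degA : ℕ → Submodule ℂ A} {dA : A →ₗ[ℂ] A} {degB : ℕ → Submodule ℂ B}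
    {dB : B →ₗ[ℂ] B} {φ : A →ₗ[ℂ] B} (h : IsCochainMap degA dA degB dB φ) (k : ℕ) :
    ∀ a ∈ cocycles degA dA k, φ a ∈ cocycles degB dB k := by
  rintro a ⟨h1, h2⟩
  refine ⟨h.map_deg k a h1, ?_⟩
  have h3 : dA a = 0 := h2
  change dB (φ a) = 0
  rw [← h.map_d, h3, map_zero]

theorem IsCochainMap.map_coboundaries {A B : Type*} [AddCommGroup A] [Module ℂ A] [AddCommGroup B]
    [Module ℂ B] {degA : ℕ → Submodule ℂ A} {dA : A →ₗ[ℂ] A} {degB : ℕ → Submodule ℂ B}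
    {dB : B →ₗ[ℂ] B} {φ : A →ₗ[ℂ] B} (h : IsCochainMap degA dA degB dB φ) (k : ℕ) :
    ∀ a ∈ coboundaries degA dA k, φ a ∈ coboundaries degB dB k := by
  intro a ha
  cases k with
  | zero =>
    have h0 : a = 0 := by simpa [coboundaries] using ha
    simp [h0]
  | succ k =>
    obtain ⟨b, hb, rfl⟩ := ha
    exact ⟨φ b, h.map_deg k b hb, (h.map_d b).symm⟩

/-- The map induced in cohomology by a cochain map. -/
def cohomologyMap {A B : Type*} [AddCommGroup A] [Module ℂ A] [AddCommGroup B] [Module ℂ B]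
    {degA : ℕ → Submodule ℂ A} {dA : A →ₗ[ℂ] A} {degB : ℕ → Submodule ℂ B} {dB : B →ₗ[ℂ] B}
    {φ : A →ₗ[ℂ] B} (h : IsCochainMap degA dA degB dB φ) (k : ℕ) :
    Cohomology degA dA k →ₗ[ℂ] Cohomology degB dB k :=
  Submodule.mapQ _ _ (φ.restrict (h.map_cocycles k))
    (fun a ha => h.map_coboundaries k a.1 ha)

/-- A quasi-isomorphism of differential graded algebras: a linear map preserving degrees, products,
units and differentials, and inducing isomorphisms in cohomology in all degrees. -/
def IsDGAQuasiIso {A B : Type*} [AddCommGroup A] [Module ℂ A] [AddCommGroup B] [Module ℂ B]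
    (degA : ℕ → Submodule ℂ A) (mulA : A → A → A) (oneA : A) (dA : A →ₗ[ℂ] A)
    (degB : ℕ → Submodule ℂ B) (mulB : B → B → B) (oneB : B) (dB : B →ₗ[ℂ] B)
    (φ : A →ₗ[ℂ] B) : Prop :=
  (∀ a b, φ (mulA a b) = mulB (φ a) (φ b)) ∧ φ oneA = oneB ∧
    ∃ h : IsCochainMap degA dA degB dB φ, ∀ k, Function.Bijective (cohomologyMap h k)

/-! ## Functions on the torus `𝕋² = ℝ² / ℤ²` and sections of the Weyl bundle -/

/-- The Euclidean plane `ℝ²`. -/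
abbrev Plane : Type := EuclideanSpace ℝ (Fin 2)

/-- The `i`-th standard basis vector of `ℝ²`. -/
abbrev basisVec (i : Fin 2) : Plane := EuclideanSpace.single i (1 : ℝ)

/-- The partial derivative `∂/∂xⁱ` of a function of `(x, y)`. -/
def pdX (i : Fin 2) (F : Plane × Plane → ℂ) : Plane × Plane → ℂ :=
  fun p => fderiv ℝ F p (basisVec i, 0)

/-- The partial derivative `∂/∂yⁱ` of a function of `(x, y)`. -/
def pdY (i : Fin 2) (F : Plane × Plane → ℂ) : Plane × Plane → ℂ :=
  fun p => fderiv ℝ F p (0, basisVec i)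

/-- The partial derivative `∂ₓ^β` for a multi-index `β`. -/
def pdXs (β : Fin 2 → ℕ) (F : Plane × Plane → ℂ) : Plane × Plane → ℂ :=
  (pdX 0)^[β 0] ((pdX 1)^[β 1] F)

/-- The partial derivative `∂_y^α` for a multi-index `α`. -/
def pdYs (α : Fin 2 → ℕ) (F : Plane × Plane → ℂ) : Plane × Plane → ℂ :=
  (pdY 0)^[α 0] ((pdY 1)^[α 1] F)

/-- The functions `y ↦ F (x, y)`, for `x` in `ℝ²`, form a bounded subset of `𝒪_C(ℝ²)`. Recall that
a smooth function `h` lies in `𝒪_C(ℝ²)` when there is one `k` for which every `∂^α h` is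
`O((1 + |y|²)^k)`. So `𝒪_C(ℝ²)` is the increasing union over `k` of Fréchet spaces; it carries the
inductive limit topology, and its bounded subsets are the bounded subsets of one of these spaces. -/
def BoundedInOC (F : Plane × Plane → ℂ) : Prop :=
  ∃ k : ℕ, ∀ α : Fin 2 → ℕ, ∃ C : ℝ, ∀ x y : Plane, ‖pdYs α F (x, y)‖ ≤ C * (1 + ‖y‖ ^ 2) ^ k

/-- Smooth sections over `𝕋²` of the trivial bundle with fibre `𝒪_C(ℝ²)`, that is, the elements of
`C^∞(𝕋², 𝒪_C(ℝ²))`, which is the completed projective tensor product of `C^∞(𝕋²)` and `𝒪_C(ℝ²)`: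
smooth functions of `(x, y)` that are `ℤ²`-periodic in `x` and such that, for every `β`, the
functions `∂ₓ^β F (x, ·)` form a bounded subset of `𝒪_C(ℝ²)`. -/
structure IsWeylSection (F : Plane × Plane → ℂ) : Prop where
  smooth : ContDiff ℝ ∞ F
  periodic : ∀ (i : Fin 2) (x y : Plane), F (x + basisVec i, y) = F (x, y)
  bounded : ∀ β : Fin 2 → ℕ, BoundedInOC (pdXs β F)

/-- Smooth functions on `𝕋² = ℝ² / ℤ²`, as smooth `ℤ²`-periodic functions on `ℝ²`. -/
structure IsTorusFun (f : Plane → ℂ) : Prop where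
  smooth : ContDiff ℝ ∞ f
  periodic : ∀ (i : Fin 2) (x : Plane), f (x + basisVec i) = f x

/-- The complex vector space `C^∞(𝕋²)`. -/
def TorusFun : Submodule ℂ (Plane → ℂ) where
  carrier := {f | IsTorusFun f}
  add_mem' := fun {f g} hf hg =>
    ⟨hf.smooth.add hg.smooth, fun i x => by simp [hf.periodic i x, hg.periodic i x]⟩
  zero_mem' := ⟨contDiff_const, fun _ _ => rfl⟩
  smul_mem' := fun z f hf =>
    ⟨contDiff_const.smul hf.smooth, fun i x => by simp [hf.periodic i x]⟩

/-! ### Helper facts on partial derivatives -/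

/-- The derivative in a fixed direction. -/
def dirD (v : Plane × Plane) (F : Plane × Plane → ℂ) : Plane × Plane → ℂ :=
  fun p => fderiv ℝ F p v

theorem dirD_smooth (v : Plane × Plane) {F : Plane × Plane → ℂ} (hF : ContDiff ℝ ∞ F) :
    ContDiff ℝ ∞ (dirD v F) :=
  (hF.fderiv_right (m := ∞) (by simp)).clm_apply contDiff_const

theorem dirD_add (v : Plane × Plane) {F G : Plane × Plane → ℂ} (hF : ContDiff ℝ ∞ F)
    (hG : ContDiff ℝ ∞ G) : dirD v (F + G) = dirD v F + dirD v G := by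
  funext p
  simp only [dirD, Pi.add_apply]
  rw [fderiv_add (hF.differentiable (by simp) p) (hG.differentiable (by simp) p)]
  rfl

theorem dirD_smul (v : Plane × Plane) (z : ℂ) {F : Plane × Plane → ℂ} (hF : ContDiff ℝ ∞ F) :
    dirD v (z • F) = z • dirD v F := by
  funext p
  simp only [dirD, Pi.smul_apply]
  rw [fderiv_const_smul (hF.differentiable (by simp) p)]
  rfl

theorem dirD_comm (v w : Plane × Plane) {F : Plane × Plane → ℂ} (hF : ContDiff ℝ ∞ F) :
    dirD v (dirD w F) = dirD w (dirD v F) := by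
  funext p
  have hd : DifferentiableAt ℝ (fderiv ℝ F) p :=
    (hF.fderiv_right (m := ∞) (by simp)).differentiable (by simp) p
  have key : ∀ a b : Plane × Plane, dirD a (dirD b F) p = fderiv ℝ (fderiv ℝ F) p a b := by
    intro a b
    change fderiv ℝ (fun q => fderiv ℝ F q b) p a = _
    rw [fderiv_clm_apply hd (differentiableAt_const b)]
    simp
  rw [key, key]
  have h2 : minSmoothness ℝ 2 ≤ (∞ : WithTop ℕ∞) := by
    rw [minSmoothness_of_isRCLikeNormedField]
    exact WithTop.coe_le_coe.2 le_top
  exact (hF.contDiffAt.isSymmSndFDerivAt h2) v w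

theorem dirD_iter_smooth (v : Plane × Plane) (n : ℕ) {F : Plane × Plane → ℂ}
    (hF : ContDiff ℝ ∞ F) : ContDiff ℝ ∞ ((dirD v)^[n] F) := by
  induction n with
  | zero => exact hF
  | succ n ih => rw [Function.iterate_succ_apply']; exact dirD_smooth v ih

theorem dirD_iter_add (v : Plane × Plane) (n : ℕ) {F G : Plane × Plane → ℂ}
    (hF : ContDiff ℝ ∞ F) (hG : ContDiff ℝ ∞ G) :
    (dirD v)^[n] (F + G) = (dirD v)^[n] F + (dirD v)^[n] G := by
  induction n with
  | zero => rfl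
  | succ n ih =>
    simp only [Function.iterate_succ_apply', ih]
    exact dirD_add v (dirD_iter_smooth v n hF) (dirD_iter_smooth v n hG)

theorem dirD_iter_smul (v : Plane × Plane) (n : ℕ) (z : ℂ) {F : Plane × Plane → ℂ}
    (hF : ContDiff ℝ ∞ F) : (dirD v)^[n] (z • F) = z • (dirD v)^[n] F := by
  induction n with
  | zero => rfl
  | succ n ih =>
    simp only [Function.iterate_succ_apply', ih]
    exact dirD_smul v z (dirD_iter_smooth v n hF)

theorem dirD_iter_comm (v w : Plane × Plane) (n : ℕ) {F : Plane × Plane → ℂ}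
    (hF : ContDiff ℝ ∞ F) : (dirD v)^[n] (dirD w F) = dirD w ((dirD v)^[n] F) := by
  induction n with
  | zero => rfl
  | succ n ih =>
    simp only [Function.iterate_succ_apply', ih]
    exact dirD_comm v w (dirD_iter_smooth v n hF)

theorem pdX_eq (i : Fin 2) : pdX i = dirD (basisVec i, 0) := rfl

theorem pdY_eq (i : Fin 2) : pdY i = dirD (0, basisVec i) := rfl

theorem pdXs_smooth (β : Fin 2 → ℕ) {F : Plane × Plane → ℂ} (hF : ContDiff ℝ ∞ F) :
    ContDiff ℝ ∞ (pdXs β F) := by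
  unfold pdXs
  exact dirD_iter_smooth _ _ (dirD_iter_smooth _ _ hF)

theorem pdXs_add (β : Fin 2 → ℕ) {F G : Plane × Plane → ℂ} (hF : ContDiff ℝ ∞ F)
    (hG : ContDiff ℝ ∞ G) : pdXs β (F + G) = pdXs β F + pdXs β G := by
  simp only [pdXs, pdX_eq]
  rw [dirD_iter_add _ _ hF hG,
    dirD_iter_add _ _ (dirD_iter_smooth _ _ hF) (dirD_iter_smooth _ _ hG)]

theorem pdYs_add (α : Fin 2 → ℕ) {F G : Plane × Plane → ℂ} (hF : ContDiff ℝ ∞ F)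
    (hG : ContDiff ℝ ∞ G) : pdYs α (F + G) = pdYs α F + pdYs α G := by
  simp only [pdYs, pdY_eq]
  rw [dirD_iter_add _ _ hF hG,
    dirD_iter_add _ _ (dirD_iter_smooth _ _ hF) (dirD_iter_smooth _ _ hG)]

theorem pdXs_smul (β : Fin 2 → ℕ) (z : ℂ) {F : Plane × Plane → ℂ} (hF : ContDiff ℝ ∞ F) :
    pdXs β (z • F) = z • pdXs β F := by
  simp only [pdXs, pdX_eq]
  rw [dirD_iter_smul _ _ z hF, dirD_iter_smul _ _ z (dirD_iter_smooth _ _ hF)]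

theorem pdYs_smul (α : Fin 2 → ℕ) (z : ℂ) {F : Plane × Plane → ℂ} (hF : ContDiff ℝ ∞ F) :
    pdYs α (z • F) = z • pdYs α F := by
  simp only [pdYs, pdY_eq]
  rw [dirD_iter_smul _ _ z hF, dirD_iter_smul _ _ z (dirD_iter_smooth _ _ hF)]

theorem dirD_iter_zero (v : Plane × Plane) (n : ℕ) :
    (dirD v)^[n] (0 : Plane × Plane → ℂ) = 0 := by
  have h := dirD_iter_smul v n 0 (F := 0) contDiff_const
  simpa using h

theorem pdXs_pdX (β : Fin 2 → ℕ) (i : Fin 2) {F : Plane × Plane → ℂ} (hF : ContDiff ℝ ∞ F) :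
    pdXs β (pdX i F) = pdXs (β + Pi.single i 1) F := by
  simp only [pdXs, pdX_eq]
  fin_cases i
  · simp only [Fin.zero_eta, Pi.add_apply, Pi.single_eq_same]
    rw [dirD_iter_comm _ _ _ hF, ← Function.iterate_succ_apply]
    simp
  · simp only [Fin.mk_one, Pi.add_apply, Pi.single_eq_same]
    rw [← Function.iterate_succ_apply]
    simp

theorem pdYs_pdY (α : Fin 2 → ℕ) (i : Fin 2) {F : Plane × Plane → ℂ} (hF : ContDiff ℝ ∞ F) :
    pdYs α (pdY i F) = pdYs (α + Pi.single i 1) F := by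
  simp only [pdYs, pdY_eq]
  fin_cases i
  · simp only [Fin.zero_eta, Pi.add_apply, Pi.single_eq_same]
    rw [dirD_iter_comm _ _ _ hF, ← Function.iterate_succ_apply]
    simp
  · simp only [Fin.mk_one, Pi.add_apply, Pi.single_eq_same]
    rw [← Function.iterate_succ_apply]
    simp

theorem pdXs_pdY (β : Fin 2 → ℕ) (i : Fin 2) {F : Plane × Plane → ℂ} (hF : ContDiff ℝ ∞ F) :
    pdXs β (pdY i F) = pdY i (pdXs β F) := by
  simp only [pdXs, pdX_eq, pdY_eq]
  rw [dirD_iter_comm _ _ _ hF, dirD_iter_comm _ _ _ (dirD_iter_smooth _ _ hF)]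

theorem dirD_periodic (v : Plane × Plane) {F : Plane × Plane → ℂ}
    (h : ∀ (i : Fin 2) (x y : Plane), F (x + basisVec i, y) = F (x, y)) (i : Fin 2)
    (x y : Plane) : dirD v F (x + basisVec i, y) = dirD v F (x, y) := by
  have h1 : (fun p : Plane × Plane => F (p + (basisVec i, 0))) = F := by
    funext p
    have := h i p.1 p.2
    simpa [Prod.add_def] using this
  have h2 := fderiv_comp_add_right (𝕜 := ℝ) (f := F) (x := (x, y)) (basisVec i, (0 : Plane))
  rw [h1] at h2
  simp only [dirD]
  rw [h2]
  simp

theorem BoundedInOC.add {F G : Plane × Plane → ℂ} (hF : ContDiff ℝ ∞ F) (hG : ContDiff ℝ ∞ G)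
    (h1 : BoundedInOC F) (h2 : BoundedInOC G) : BoundedInOC (F + G) := by
  obtain ⟨k, hk⟩ := h1
  obtain ⟨l, hl⟩ := h2
  refine ⟨k + l, fun α => ?_⟩
  obtain ⟨C, hC⟩ := hk α
  obtain ⟨D, hD⟩ := hl α
  refine ⟨|C| + |D|, fun x y => ?_⟩
  rw [pdYs_add α hF hG]
  have hy : (1 : ℝ) ≤ 1 + ‖y‖ ^ 2 := by nlinarith [sq_nonneg ‖y‖]
  have e1 : C * (1 + ‖y‖ ^ 2) ^ k ≤ |C| * (1 + ‖y‖ ^ 2) ^ (k + l) :=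
    mul_le_mul (le_abs_self C) (pow_le_pow_right₀ hy (by omega)) (by positivity) (abs_nonneg C)
  have e2 : D * (1 + ‖y‖ ^ 2) ^ l ≤ |D| * (1 + ‖y‖ ^ 2) ^ (k + l) :=
    mul_le_mul (le_abs_self D) (pow_le_pow_right₀ hy (by omega)) (by positivity) (abs_nonneg D)
  calc ‖(pdYs α F + pdYs α G) (x, y)‖ ≤ ‖pdYs α F (x, y)‖ + ‖pdYs α G (x, y)‖ := norm_add_le _ _
    _ ≤ C * (1 + ‖y‖ ^ 2) ^ k + D * (1 + ‖y‖ ^ 2) ^ l := add_le_add (hC x y) (hD x y)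
    _ ≤ (|C| + |D|) * (1 + ‖y‖ ^ 2) ^ (k + l) := by rw [_root_.add_mul]; linarith

theorem BoundedInOC.smul (z : ℂ) {F : Plane × Plane → ℂ} (hF : ContDiff ℝ ∞ F)
    (h : BoundedInOC F) : BoundedInOC (z • F) := by
  obtain ⟨k, hk⟩ := h
  refine ⟨k, fun α => ?_⟩
  obtain ⟨C, hC⟩ := hk α
  refine ⟨‖z‖ * C, fun x y => ?_⟩
  rw [pdYs_smul α z hF, Pi.smul_apply, norm_smul, _root_.mul_assoc]
  exact mul_le_mul_of_nonneg_left (hC x y) (norm_nonneg z)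

theorem IsWeylSection.add {F G : Plane × Plane → ℂ} (hF : IsWeylSection F)
    (hG : IsWeylSection G) : IsWeylSection (F + G) where
  smooth := hF.smooth.add hG.smooth
  periodic i x y := by simp [hF.periodic i x y, hG.periodic i x y]
  bounded β := by
    rw [pdXs_add β hF.smooth hG.smooth]
    exact BoundedInOC.add (pdXs_smooth β hF.smooth) (pdXs_smooth β hG.smooth)
      (hF.bounded β) (hG.bounded β)

theorem IsWeylSection.smul (z : ℂ) {F : Plane × Plane → ℂ} (hF : IsWeylSection F) :
    IsWeylSection (z • F) where
  smooth := contDiff_const.smul hF.smooth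
  periodic i x y := by simp [hF.periodic i x y]
  bounded β := by
    rw [pdXs_smul β z hF.smooth]
    exact BoundedInOC.smul z (pdXs_smooth β hF.smooth) (hF.bounded β)

theorem isWeylSection_zero : IsWeylSection 0 where
  smooth := contDiff_const
  periodic _ _ _ := rfl
  bounded β := by
    refine ⟨0, fun α => ⟨0, fun x y => ?_⟩⟩
    simp [pdXs, pdYs, pdX_eq, pdY_eq, dirD_iter_zero]

theorem IsWeylSection.pdX (i : Fin 2) {F : Plane × Plane → ℂ} (hF : IsWeylSection F) :
    IsWeylSection (_root_.pdX i F) where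
  smooth := dirD_smooth _ hF.smooth
  periodic := dirD_periodic _ hF.periodic
  bounded β := by
    rw [pdXs_pdX β i hF.smooth]
    exact hF.bounded _

theorem IsWeylSection.pdY (i : Fin 2) {F : Plane × Plane → ℂ} (hF : IsWeylSection F) :
    IsWeylSection (_root_.pdY i F) where
  smooth := dirD_smooth _ hF.smooth
  periodic := dirD_periodic _ hF.periodic
  bounded β := by
    rw [pdXs_pdY β i hF.smooth]
    obtain ⟨k, hk⟩ := hF.bounded β
    refine ⟨k, fun α => ?_⟩
    rw [pdYs_pdY α i (pdXs_smooth β hF.smooth)]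
    exact hk _

/-! ### The spaces and maps -/

/-- The complex vector space `Ω⁰(𝕋², 𝒲)` of smooth sections of the Weyl bundle. -/
def WeylSection : Submodule ℂ (Plane × Plane → ℂ) where
  carrier := {F | IsWeylSection F}
  add_mem' := fun hF hG => hF.add hG
  zero_mem' := isWeylSection_zero
  smul_mem' := fun z _ hF => hF.smul z

/-- The operator `∂/∂xⁱ - ∂/∂yⁱ` on sections. -/
def weylD (i : Fin 2) : WeylSection →ₗ[ℂ] WeylSection where
  toFun F := ⟨pdX i F.1 + (-1 : ℂ) • pdY i F.1, (F.2.pdX i).add ((F.2.pdY i).smul (-1))⟩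
  map_add' F G := by
    apply Subtype.ext
    change pdX i (F.1 + G.1) + (-1 : ℂ) • pdY i (F.1 + G.1) =
      (pdX i F.1 + (-1 : ℂ) • pdY i F.1) + (pdX i G.1 + (-1 : ℂ) • pdY i G.1)
    rw [pdX_eq, pdY_eq, dirD_add _ F.2.smooth G.2.smooth, dirD_add _ F.2.smooth G.2.smooth,
      smul_add]
    abel
  map_smul' z F := by
    apply Subtype.ext
    change pdX i (z • F.1) + (-1 : ℂ) • pdY i (z • F.1) =
      z • (pdX i F.1 + (-1 : ℂ) • pdY i F.1)
    rw [pdX_eq, pdY_eq, dirD_smul _ z F.2.smooth, dirD_smul _ z F.2.smooth, smul_add,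
      smul_comm z (-1 : ℂ)]

theorem IsTorusFun.fderiv (v : Plane) {f : Plane → ℂ} (hf : IsTorusFun f) :
    IsTorusFun (fun x => fderiv ℝ f x v) where
  smooth := (hf.smooth.fderiv_right (m := ∞) (by simp)).clm_apply contDiff_const
  periodic i x := by
    have h1 : (fun p : Plane => f (p + basisVec i)) = f := funext (hf.periodic i)
    have h2 := fderiv_comp_add_right (𝕜 := ℝ) (f := f) (x := x) (basisVec i)
    rw [h1] at h2
    simp only [h2]

theorem IsTorusFun.bounded {f : Plane → ℂ} (hf : IsTorusFun f) : ∃ C : ℝ, ∀ x, ‖f x‖ ≤ C := by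
  obtain ⟨C, hC⟩ := (isCompact_closedBall (0 : Plane) 2).exists_bound_of_continuousOn
    hf.smooth.continuous.continuousOn
  refine ⟨C, fun x => ?_⟩
  have hnat : ∀ (i : Fin 2) (n : ℕ) (x : Plane), f (x + (n : ℝ) • basisVec i) = f x := by
    intro i n
    induction n with
    | zero => intro x; simp
    | succ n ih =>
      intro x
      have : x + ((n + 1 : ℕ) : ℝ) • basisVec i = (x + (n : ℝ) • basisVec i) + basisVec i := by
        push_cast; rw [_root_.add_smul, one_smul, _root_.add_assoc]
      rw [this, hf.periodic, ih]
  have hint : ∀ (i : Fin 2) (n : ℤ) (x : Plane), f (x + (n : ℝ) • basisVec i) = f x := by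
    intro i n x
    obtain ⟨m, rfl | rfl⟩ := n.eq_nat_or_neg
    · exact_mod_cast hnat i m x
    · have := hnat i m (x + ((-(m : ℤ) : ℤ) : ℝ) • basisVec i)
      rw [← this]
      congr 1
      push_cast
      rw [neg_smul]
      abel
  set z : Plane := (x + ((-⌊x 0⌋ : ℤ) : ℝ) • basisVec 0) + ((-⌊x 1⌋ : ℤ) : ℝ) • basisVec 1
    with hz
  have hfz : f z = f x := by rw [hz, hint, hint]
  rw [← hfz]
  apply hC
  have z0 : z 0 = Int.fract (x 0) := by
    simp [hz, basisVec, Int.fract, sub_eq_add_neg]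
  have z1 : z 1 = Int.fract (x 1) := by
    simp [hz, basisVec, Int.fract, sub_eq_add_neg]
  rw [mem_closedBall_zero_iff, EuclideanSpace.norm_eq, Real.sqrt_le_left (by norm_num)]
  simp only [Fin.sum_univ_two, z0, z1, Real.norm_eq_abs, sq_abs]
  nlinarith [Int.fract_nonneg (x 0), Int.fract_lt_one (x 0), Int.fract_nonneg (x 1),
    Int.fract_lt_one (x 1)]

theorem dirD_comp_add (v : Plane × Plane) {f : Plane → ℂ} (hf : IsTorusFun f) :
    dirD v (fun p => f (p.1 + p.2)) = fun p => fderiv ℝ f (p.1 + p.2) (v.1 + v.2) := by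
  funext p
  have hL : HasFDerivAt (fun p : Plane × Plane => p.1 + p.2)
      (ContinuousLinearMap.fst ℝ Plane Plane + ContinuousLinearMap.snd ℝ Plane Plane) p :=
    hasFDerivAt_fst.add hasFDerivAt_snd
  have hf' := (hf.smooth.differentiable (by simp) (p.1 + p.2)).hasFDerivAt
  have h := HasFDerivAt.comp p hf' hL
  simp only [dirD]
  change fderiv ℝ (f ∘ fun p : Plane × Plane => p.1 + p.2) p v = _
  rw [h.fderiv]
  simp

theorem dirD_iter_comp_add (v : Plane × Plane) (n : ℕ) {f : Plane → ℂ} (hf : IsTorusFun f) :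
    ∃ g : Plane → ℂ, IsTorusFun g ∧
      (dirD v)^[n] (fun p => f (p.1 + p.2)) = fun p => g (p.1 + p.2) := by
  induction n with
  | zero => exact ⟨f, hf, rfl⟩
  | succ n ih =>
    obtain ⟨g, hg, h⟩ := ih
    refine ⟨_, hg.fderiv (v.1 + v.2), ?_⟩
    rw [Function.iterate_succ_apply', h, dirD_comp_add v hg]

theorem IsTorusFun.comp_add {f : Plane → ℂ} (hf : IsTorusFun f) :
    IsWeylSection (fun p => f (p.1 + p.2)) where
  smooth := hf.smooth.comp (contDiff_fst.add contDiff_snd)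
  periodic i x y := by
    have : x + basisVec i + y = (x + y) + basisVec i := by abel
    simp only [this, hf.periodic]
  bounded β := by
    refine ⟨0, fun α => ?_⟩
    simp only [pdXs, pdYs, pdX_eq, pdY_eq]
    obtain ⟨g₁, h₁, e₁⟩ := dirD_iter_comp_add (basisVec 1, 0) (β 1) hf
    obtain ⟨g₂, h₂, e₂⟩ := dirD_iter_comp_add (basisVec 0, 0) (β 0) h₁
    obtain ⟨g₃, h₃, e₃⟩ := dirD_iter_comp_add (0, basisVec 1) (α 1) h₂
    obtain ⟨g₄, h₄, e₄⟩ := dirD_iter_comp_add (0, basisVec 0) (α 0) h₃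
    rw [e₁, e₂, e₃, e₄]
    obtain ⟨C, hC⟩ := h₄.bounded
    exact ⟨C, fun x y => by simpa using hC (x + y)⟩

/-- The quantization map `𝒬(f)(x, y) = f(x + y)`, with values in the sections. -/
def quant : TorusFun →ₗ[ℂ] WeylSection where
  toFun f := ⟨fun p => f.1 (p.1 + p.2), f.2.comp_add⟩
  map_add' _ _ := rfl
  map_smul' _ _ := rfl

/-- The restriction `σ(F)(x) = F(x, 0)` to the zero section. -/
def sigmaMap : WeylSection →ₗ[ℂ] TorusFun where
  toFun F := ⟨fun x => F.1 (x, 0),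
    ⟨F.2.smooth.comp (contDiff_id.prodMk contDiff_const), fun i x => F.2.periodic i x 0⟩⟩
  map_add' _ _ := rfl
  map_smul' _ _ := rfl

/-- The constant function `1` on the torus. -/
def torusOne : TorusFun := ⟨fun _ => 1, ⟨contDiff_const, fun _ _ => rfl⟩⟩

/-! ## The star product -/

/-- The oscillatory integral `∫ a(u, v) e^{iφ(u, v)} du dv` over `ℝ² × ℝ²` exists and equals `I`:
for every Schwartz function `χ` with `χ(0) = 1`, the integrals
`∫ χ(εu, εv) a(u, v) e^{iφ(u, v)} du dv` converge absolutely for every `ε > 0`, and they tend to `I`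
as `ε` decreases to `0`. -/
def HasOscIntegral (a : Plane × Plane → ℂ) (φ : Plane × Plane → ℝ) (I : ℂ) : Prop :=
  ∀ χ : 𝓢(Plane × Plane, ℂ), χ 0 = 1 →
    (∀ ε : ℝ, 0 < ε → Integrable fun p : Plane × Plane =>
      χ (ε • p) * a p * Complex.exp (Complex.I * φ p)) ∧
    Tendsto (fun ε : ℝ => ∫ p : Plane × Plane, χ (ε • p) * a p * Complex.exp (Complex.I * φ p))
      (𝓝[>] 0) (𝓝 I)

/-- The constant symplectic form `ω = c dx¹ ∧ dx²`. -/
def symp (c : ℝ) (u v : Plane) : ℝ := c * (u 0 * v 1 - u 1 * v 0)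

/-- `z` is the value at `y` of the star product of two functions on the symplectic plane
`(ℝ², c dx¹ ∧ dx²)`,
`(f ∗_ħ g)(y) = (πħ)⁻² ∬ f(y + u) g(y + v) e^{-(2i/ħ) ω(u, v)} du dv` (oscillatory integral), where
`du` and `dv` are the Liouville measure of `ω`, that is `|c|` times Lebesgue measure. -/
def HasStarValue (c ħ : ℝ) (f g : Plane → ℂ) (y : Plane) (z : ℂ) : Prop :=
  HasOscIntegral (fun p => (((|c| / (Real.pi * ħ)) ^ 2 : ℝ) : ℂ) * f (y + p.1) * g (y + p.2))
    (fun p => -(2 / ħ) * symp c p.1 p.2) z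

/-- The section `H` is the fibrewise star product of the sections `F` and `G`. -/
def IsStarProduct (c ħ : ℝ) (F G H : WeylSection) : Prop :=
  ∀ x y : Plane, HasStarValue c ħ (fun y' => F.1 (x, y')) (fun y' => G.1 (x, y')) y (H.1 (x, y))

open Classical in
/-- The star product `F ∗_ħ G` of sections (`0` if the integrals do not converge to a section). -/
def weylStar (c ħ : ℝ) (F G : WeylSection) : WeylSection :=
  if h : ∃ H, IsStarProduct c ħ F G H then h.choose else 0

/-- The product `f ⋆_ħ g = σ(𝒬(f) ∗_ħ 𝒬(g))` on `C^∞(𝕋²)`. -/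
def torusStar (c ħ : ℝ) (f g : TorusFun) : TorusFun :=
  sigmaMap (weylStar c ħ (quant f) (quant g))

/-- The grading of `C^∞(𝕋²)` that is concentrated in degree `0`. -/
def torusDeg (k : ℕ) : Submodule ℂ TorusFun := if k = 0 then ⊤ else ⊥

/-! ## Differential forms with values in the Weyl bundle -/

/-- `Ω(𝕋², 𝒲)`: the form `∑ₛ aₛ dxˢ` is given by its coefficients in the frame `dxˢ`, where `s` runs
over the subsets of the index set and `dxˢ` is the wedge product of the `dxⁱ`, `i ∈ s`, in
increasing order. -/
abbrev WeylForm : Type := Finset (Fin 2) → WeylSection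

/-- The forms of degree `k`. -/
def weylDeg (k : ℕ) : Submodule ℂ WeylForm where
  carrier := {a | ∀ s, s.card ≠ k → a s = 0}
  add_mem' := fun ha hb s hs => by simp [ha s hs, hb s hs]
  zero_mem' := fun _ _ => rfl
  smul_mem' := fun z a ha s hs => by simp [ha s hs]

/-- The sign in `dxˢ ∧ dxᵗ = ± dx^{s ∪ t}`, for disjoint `s` and `t`. -/
def wedgeSign (s t : Finset (Fin 2)) : ℂ :=
  (-1) ^ ((s ×ˢ t).filter (fun q => q.2 < q.1)).card

/-- The product `(a dxˢ) ∗_ħ (b dxᵗ) = (a ∗_ħ b) dxˢ ∧ dxᵗ` of forms. -/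
def weylMul (c ħ : ℝ) (a b : WeylForm) : WeylForm :=
  fun r => ∑ s ∈ r.powerset, wedgeSign s (r \ s) • weylStar c ħ (a s) (b (r \ s))

/-- The differential `Q = ∑ᵢ dxⁱ ∧ (∂/∂xⁱ - ∂/∂yⁱ)`. -/
def weylQ : WeylForm →ₗ[ℂ] WeylForm where
  toFun a := fun r => ∑ i ∈ r, wedgeSign {i} (r.erase i) • weylD i (a (r.erase i))
  map_add' a b := by
    funext r
    simp [Finset.sum_add_distrib]
  map_smul' z a := by
    funext r
    simp only [Pi.smul_apply, map_smul, RingHom.id_apply, Finset.smul_sum]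
    exact Finset.sum_congr rfl fun i _ => smul_comm _ _ _

/-- The map `𝒬 : C^∞(𝕋²) → Ω(𝕋², 𝒲)`. -/
def quantForm : TorusFun →ₗ[ℂ] WeylForm :=
  (LinearMap.single ℂ (fun _ : Finset (Fin 2) => WeylSection) ∅).comp quant

/-- The unit of `Ω(𝕋², 𝒲)`, the constant function `1`. -/
def weylOne : WeylForm := quantForm torusOne

end

/-!
The oscillatory integrals are handled by integration by parts. Differentiating the exponential
`oscExp` in one of the four coordinates of `(u, v)` multiplies it by a nonzero multiple of the
conjugate coordinate; integrating by parts once in each coordinate (`oscStep`) therefore improves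
the decay of an amplitude by the factor `(1 + |z|²)^{-1/2}`. After sufficiently many rounds an
amplitude of polynomial growth has become integrable, and the integral so obtained is the limit of
the regularized ones, for every cutoff (`hasOscIntegral_oscIter`). The same estimate is uniform on
families of symbols obeying common bounds (`UnifSymbol`): oscillatory integrals are bounded on such
families (`oscInt_bound`) and continuous along families whose derivatives all converge pointwise
(`oscInt_tendsto`). Everything about the star product that is obvious for integrable amplitudes is
extended to `𝒪_C(ℝ²)` by means of these two facts.

Applied to the remainders of first order Taylor expansions, they show that the fibrewise star
product is differentiable under the integral sign, so that all derivatives obey the Leibniz rule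
(`dirDeriv_fibStar`). Hence products of sections are sections, and `∂/∂xⁱ - ∂/∂yⁱ` is a derivation.
The constant `1` is a left unit by Fourier inversion (`planeStar_one_left`), and a right unit because
exchanging the factors amounts to changing the sign of `ħ`. For associativity, star multiplication
by a plane wave from the left is a translation followed by a multiplication with the wave; such
operators commute with star multiplication from the right. Superposing plane waves
(`planeStar_superposition`) gives associativity for a Schwartz function as first factor, and cutting
off a general first factor gives it in general (`planeStar_assoc`).

At a point `(x, y)` the product of `f(x + y)` and `g(x + y)` depends on `x + y` only
(`quant_torusStar`), so `𝒬` identifies the torus product with a restriction of the product of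
sections, and the algebra axioms on the torus are inherited through the injectivity of `𝒬`.

A section annihilated by both `∂/∂xⁱ - ∂/∂yⁱ` is constant along the lines `t ↦ (x + t y, y - t y)`,
hence is `𝒬` of its restriction to `y = 0`: this is the cohomology in degree `0`. In positive
degrees the cohomology vanishes, because each `∂/∂xⁱ - ∂/∂yⁱ` has a right inverse on sections that
commutes with the other derivation (`weylD_weylPrimitive`, `weylD_weylPrimitive_of_ne`). It is
given by integration along the direction of the derivation, starting from an average over the
hyperplanes `yⁱ = s`, `0 ≤ s ≤ 1`; the average is smoothing in `yⁱ`, and this keeps the growth in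
`y` uniform over all `y`-derivatives (`fibrePrimitive`).
-/

noncomputable section

/-! ### Iterated directional derivatives -/

section DirDeriv

variable {V V' : Type*} [NormedAddCommGroup V] [NormedSpace ℝ V] [NormedAddCommGroup V']
  [NormedSpace ℝ V']

/-- The derivative of `F` in the direction `v`, on any normed space. -/
def dirDeriv (v : V) (F : V → ℂ) : V → ℂ := fun p => fderiv ℝ F p v

/-- The iterated derivative of `F` in the directions of the list `L`. -/
def dirDerivs : List V → (V → ℂ) → V → ℂ
  | [], F => F
  | v :: L, F => dirDerivs L (dirDeriv v F)

theorem dirDeriv_smooth (v : V) {F : V → ℂ} (hF : ContDiff ℝ ∞ F) :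
    ContDiff ℝ ∞ (dirDeriv v F) :=
  (hF.fderiv_right (m := ∞) (by simp)).clm_apply contDiff_const

theorem dirDerivs_smooth (L : List V) {F : V → ℂ} (hF : ContDiff ℝ ∞ F) :
    ContDiff ℝ ∞ (dirDerivs L F) := by
  induction L generalizing F with
  | nil => exact hF
  | cons v L ih => exact ih (dirDeriv_smooth v hF)

theorem ContDiff.differentiableAt_infty {F : V → ℂ} (hF : ContDiff ℝ ∞ F) (p : V) :
    DifferentiableAt ℝ F p := hF.differentiable (by simp) p

theorem dirDeriv_add (v : V) {F G : V → ℂ} (hF : ContDiff ℝ ∞ F) (hG : ContDiff ℝ ∞ G) :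
    dirDeriv v (fun p => F p + G p) = fun p => dirDeriv v F p + dirDeriv v G p := by
  funext p
  simp only [dirDeriv]
  rw [fderiv_fun_add (hF.differentiableAt_infty p) (hG.differentiableAt_infty p)]
  rfl

theorem dirDeriv_const_mul (v : V) (z : ℂ) {F : V → ℂ} (hF : ContDiff ℝ ∞ F) :
    dirDeriv v (fun p => z * F p) = fun p => z * dirDeriv v F p := by
  funext p
  simp only [dirDeriv]
  rw [fderiv_const_mul (hF.differentiableAt_infty p)]
  rfl

theorem dirDeriv_mul (v : V) {F G : V → ℂ} (hF : ContDiff ℝ ∞ F) (hG : ContDiff ℝ ∞ G) :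
    dirDeriv v (fun p => F p * G p) = fun p => dirDeriv v F p * G p + F p * dirDeriv v G p := by
  funext p
  simp only [dirDeriv]
  rw [fderiv_fun_mul (hF.differentiableAt_infty p) (hG.differentiableAt_infty p)]
  simp only [add_apply, smul_apply, smul_eq_mul]
  ring

theorem dirDeriv_const (v : V) (z : ℂ) : dirDeriv v (fun _ => z) = fun _ => 0 := by
  funext p
  simp [dirDeriv]

theorem dirDeriv_smul_add (r s : ℝ) (v w : V) (F : V → ℂ) :
    dirDeriv (r • v + s • w) F = fun p => r * dirDeriv v F p + s * dirDeriv w F p := by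
  funext p
  simp [dirDeriv]

theorem dirDeriv_add_dir (v w : V) (F : V → ℂ) :
    dirDeriv (v + w) F = fun p => dirDeriv v F p + dirDeriv w F p := by
  funext p
  simp [dirDeriv]

theorem dirDeriv_smul_dir (r : ℝ) (v : V) (F : V → ℂ) :
    dirDeriv (r • v) F = fun p => r * dirDeriv v F p := by
  funext p
  simp [dirDeriv]

theorem dirDeriv_comm (v w : V) {F : V → ℂ} (hF : ContDiff ℝ ∞ F) :
    dirDeriv v (dirDeriv w F) = dirDeriv w (dirDeriv v F) := by
  funext p
  have hd : DifferentiableAt ℝ (fderiv ℝ F) p :=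
    (hF.fderiv_right (m := ∞) (by simp)).differentiable (by simp) p
  have key : ∀ a b : V, dirDeriv a (dirDeriv b F) p = fderiv ℝ (fderiv ℝ F) p a b := by
    intro a b
    change fderiv ℝ (fun q => fderiv ℝ F q b) p a = _
    rw [fderiv_clm_apply hd (differentiableAt_const b)]
    simp
  rw [key, key]
  have h2 : minSmoothness ℝ 2 ≤ (∞ : WithTop ℕ∞) := by
    rw [minSmoothness_of_isRCLikeNormedField]
    exact WithTop.coe_le_coe.2 le_top
  exact (hF.contDiffAt.isSymmSndFDerivAt h2) v w

theorem dirDeriv_comp_affine (v : V) (r : ℝ) (ℓ : V →L[ℝ] V') (a : V') {F : V' → ℂ}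
    (hF : ContDiff ℝ ∞ F) :
    dirDeriv v (fun z => F (r • ℓ z + a)) = fun z => r * dirDeriv (ℓ v) F (r • ℓ z + a) := by
  funext z
  have h1 : HasFDerivAt (fun z => r • ℓ z + a) (r • ℓ) z :=
    (ℓ.hasFDerivAt.const_smul r).add_const a
  have h2 := ((hF.differentiableAt_infty (r • ℓ z + a)).hasFDerivAt.comp z h1).fderiv
  simp only [dirDeriv]
  change fderiv ℝ (F ∘ fun z => r • ℓ z + a) z v = _
  rw [h2]
  simp

theorem dirDeriv_comp_add_const (v : V) (ℓ : V →L[ℝ] V') (a : V') {F : V' → ℂ}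
    (hF : ContDiff ℝ ∞ F) :
    dirDeriv v (fun z => F (ℓ z + a)) = fun z => dirDeriv (ℓ v) F (ℓ z + a) := by
  simpa using dirDeriv_comp_affine v 1 ℓ a hF

theorem dirDeriv_comp_clm (v : V) (ℓ : V →L[ℝ] V') {F : V' → ℂ} (hF : ContDiff ℝ ∞ F) :
    dirDeriv v (fun z => F (ℓ z)) = fun z => dirDeriv (ℓ v) F (ℓ z) := by
  simpa using dirDeriv_comp_affine v 1 ℓ 0 hF

theorem ContDiff.comp_affine (r : ℝ) (ℓ : V →L[ℝ] V') (a : V') {F : V' → ℂ}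
    (hF : ContDiff ℝ ∞ F) : ContDiff ℝ ∞ (fun z => F (r • ℓ z + a)) :=
  hF.comp ((ℓ.contDiff.const_smul r).add contDiff_const)

theorem dirDerivs_add (L : List V) {F G : V → ℂ} (hF : ContDiff ℝ ∞ F) (hG : ContDiff ℝ ∞ G) :
    dirDerivs L (fun p => F p + G p) = fun p => dirDerivs L F p + dirDerivs L G p := by
  induction L generalizing F G with
  | nil => rfl
  | cons v L ih =>
    simp only [dirDerivs]
    rw [dirDeriv_add v hF hG, ih (dirDeriv_smooth v hF) (dirDeriv_smooth v hG)]

theorem dirDerivs_const_mul (L : List V) (z : ℂ) {F : V → ℂ} (hF : ContDiff ℝ ∞ F) :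
    dirDerivs L (fun p => z * F p) = fun p => z * dirDerivs L F p := by
  induction L generalizing F with
  | nil => rfl
  | cons v L ih =>
    simp only [dirDerivs]
    rw [dirDeriv_const_mul v z hF, ih (dirDeriv_smooth v hF)]

theorem dirDerivs_append (L M : List V) (F : V → ℂ) :
    dirDerivs (L ++ M) F = dirDerivs M (dirDerivs L F) := by
  induction L generalizing F with
  | nil => rfl
  | cons w L ih => exact ih _

theorem dirDerivs_comp_affine (L : List V) (r : ℝ) (ℓ : V →L[ℝ] V') (a : V') {F : V' → ℂ}
    (hF : ContDiff ℝ ∞ F) :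
    dirDerivs L (fun z => F (r • ℓ z + a)) =
      fun z => (r : ℂ) ^ L.length * dirDerivs (L.map ℓ) F (r • ℓ z + a) := by
  induction L generalizing F with
  | nil => funext z; simp [dirDerivs]
  | cons v L ih =>
    simp only [dirDerivs, List.map_cons, List.length_cons]
    have h1 := (dirDeriv_smooth (ℓ v) hF)
    rw [dirDeriv_comp_affine v r ℓ a hF, dirDerivs_const_mul _ _ (h1.comp_affine r ℓ a), ih h1]
    funext z
    ring

theorem dirDerivs_comp_clm (L : List V) (ℓ : V →L[ℝ] V') {F : V' → ℂ} (hF : ContDiff ℝ ∞ F) :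
    dirDerivs L (fun z => F (ℓ z)) = fun z => dirDerivs (L.map ℓ) F (ℓ z) := by
  simpa using dirDerivs_comp_affine L 1 ℓ 0 hF

theorem dirDerivs_comp_add_const (L : List V) (ℓ : V →L[ℝ] V') (a : V') {F : V' → ℂ}
    (hF : ContDiff ℝ ∞ F) :
    dirDerivs L (fun z => F (ℓ z + a)) = fun z => dirDerivs (L.map ℓ) F (ℓ z + a) := by
  simpa using dirDerivs_comp_affine L 1 ℓ a hF

theorem dirDerivs_const (L : List V) (z : ℂ) :
    dirDerivs L (fun _ => z) = fun _ => if L = [] then z else 0 := by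
  cases L with
  | nil => simp [dirDerivs]
  | cons v L =>
    have : ∀ L : List V, dirDerivs L (fun _ => (0 : ℂ)) = fun _ => 0 := by
      intro L
      induction L with
      | nil => rfl
      | cons v L ih => rw [dirDerivs, dirDeriv_const, ih]
    simp [dirDerivs, dirDeriv_const, this]

end DirDeriv

/-! ### Families of symbols -/

section UnifSymbol

variable {V V' ι κ : Type*} [NormedAddCommGroup V] [NormedSpace ℝ V] [NormedAddCommGroup V']
  [NormedSpace ℝ V']

/-- A family of smooth functions all of whose derivatives are bounded by multiples of one weight
`W`, uniformly in the index. -/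
structure UnifSymbol (W : V → ℝ) (A : ι → V → ℂ) : Prop where
  smooth : ∀ i, ContDiff ℝ ∞ (A i)
  bound : ∀ L : List V, ∃ C : ℝ, ∀ i z, ‖dirDerivs L (A i) z‖ ≤ C * W z

/-- Pointwise convergence of all derivatives. -/
def SymTendsto (l : Filter ι) (A : ι → V → ℂ) (B : V → ℂ) : Prop :=
  ∀ (L : List V) (z : V), Tendsto (fun i => dirDerivs L (A i) z) l (𝓝 (dirDerivs L B z))

variable {W W' : V → ℝ} {A B : ι → V → ℂ} {l : Filter ι}

theorem UnifSymbol.dirDeriv (hA : UnifSymbol W A) (v : V) :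
    UnifSymbol W (fun i => dirDeriv v (A i)) :=
  ⟨fun i => dirDeriv_smooth v (hA.smooth i), fun L => hA.bound (v :: L)⟩

theorem UnifSymbol.dirDerivs (hA : UnifSymbol W A) (L : List V) :
    UnifSymbol W (fun i => dirDerivs L (A i)) := by
  induction L generalizing A with
  | nil => exact hA
  | cons v L ih => exact ih (hA.dirDeriv v)

theorem UnifSymbol.add (hA : UnifSymbol W A) (hB : UnifSymbol W B) :
    UnifSymbol W (fun i z => A i z + B i z) := by
  refine ⟨fun i => (hA.smooth i).add (hB.smooth i), fun L => ?_⟩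
  obtain ⟨C, hC⟩ := hA.bound L
  obtain ⟨D, hD⟩ := hB.bound L
  refine ⟨C + D, fun i z => ?_⟩
  rw [dirDerivs_add L (hA.smooth i) (hB.smooth i), _root_.add_mul]
  exact (norm_add_le _ _).trans (add_le_add (hC i z) (hD i z))

theorem UnifSymbol.const_mul (hA : UnifSymbol W A) (hW : ∀ z, 0 ≤ W z) {c : ι → ℂ} {M : ℝ}
    (hc : ∀ i, ‖c i‖ ≤ M) : UnifSymbol W (fun i z => c i * A i z) := by
  refine ⟨fun i => contDiff_const.mul (hA.smooth i), fun L => ?_⟩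
  obtain ⟨C, hC⟩ := hA.bound L
  refine ⟨M * |C|, fun i z => ?_⟩
  rw [dirDerivs_const_mul L _ (hA.smooth i), norm_mul, _root_.mul_assoc]
  refine mul_le_mul (hc i) ((hC i z).trans ?_) (norm_nonneg _) ((norm_nonneg _).trans (hc i))
  exact mul_le_mul_of_nonneg_right (le_abs_self C) (hW z)

theorem UnifSymbol.mul (hA : UnifSymbol W A) (hB : UnifSymbol W' B) :
    UnifSymbol (fun z => W z * W' z) (fun i z => A i z * B i z) := by
  refine ⟨fun i => (hA.smooth i).mul (hB.smooth i), fun L => ?_⟩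
  induction L generalizing A B with
  | nil =>
    obtain ⟨C, hC⟩ := hA.bound []
    obtain ⟨D, hD⟩ := hB.bound []
    refine ⟨C * D, fun i z => ?_⟩
    change ‖A i z * B i z‖ ≤ _
    rw [norm_mul, mul_mul_mul_comm]
    exact mul_le_mul (hC i z) (hD i z) (norm_nonneg _) ((norm_nonneg _).trans (hC i z))
  | cons v L ih =>
    obtain ⟨C, hC⟩ := ih (hA.dirDeriv v) hB
    obtain ⟨D, hD⟩ := ih hA (hB.dirDeriv v)
    refine ⟨C + D, fun i z => ?_⟩
    rw [_root_.dirDerivs, dirDeriv_mul v (hA.smooth i) (hB.smooth i),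
      dirDerivs_add L ((dirDeriv_smooth v (hA.smooth i)).mul (hB.smooth i))
        ((hA.smooth i).mul (dirDeriv_smooth v (hB.smooth i))), _root_.add_mul]
    exact (norm_add_le _ _).trans (add_le_add (hC i z) (hD i z))

theorem UnifSymbol.mono (hA : UnifSymbol W A) (hW : ∀ z, 0 ≤ W z) {c : ℝ}
    (h : ∀ z, W z ≤ c * W' z) : UnifSymbol W' A := by
  refine ⟨hA.smooth, fun L => ?_⟩
  obtain ⟨C, hC⟩ := hA.bound L
  refine ⟨|C| * c, fun i z => (hC i z).trans ?_⟩
  rw [_root_.mul_assoc]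
  exact mul_le_mul (le_abs_self C) (h z) (hW z) (abs_nonneg C)

theorem UnifSymbol.reindex (hA : UnifSymbol W A) (σ : κ → ι) : UnifSymbol W (fun j => A (σ j)) :=
  ⟨fun j => hA.smooth (σ j), fun L => (hA.bound L).imp fun _ hC j => hC (σ j)⟩

/-- Affine changes of variables whose linear parts are bounded multiples of one linear map. -/
theorem UnifSymbol.comp_affine {U : V' → ℝ} {A : ι → V' → ℂ} (hA : UnifSymbol U A)
    (hU : ∀ z, 0 ≤ U z) (σ : κ → ι) (c : κ → ℂ) (r : κ → ℝ) (ℓ : V →L[ℝ] V') (a : κ → V')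
    (hr : ∀ j, |r j| ≤ 1) (h : ∀ j z, ‖c j‖ * U (r j • ℓ z + a j) ≤ W z) :
    UnifSymbol W (fun j z => c j * A (σ j) (r j • ℓ z + a j)) := by
  refine ⟨fun j => contDiff_const.mul ((hA.smooth (σ j)).comp_affine _ _ _), fun L => ?_⟩
  obtain ⟨C, hC⟩ := hA.bound (L.map ℓ)
  refine ⟨|C|, fun j z => ?_⟩
  rw [dirDerivs_const_mul L _ ((hA.smooth (σ j)).comp_affine _ _ _),
    dirDerivs_comp_affine L _ ℓ _ (hA.smooth (σ j)), norm_mul, norm_mul, norm_pow,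
    Complex.norm_real, Real.norm_eq_abs]
  have h1 : |r j| ^ L.length ≤ 1 := pow_le_one₀ (abs_nonneg _) (hr j)
  have h2 := hC (σ j) (r j • ℓ z + a j)
  calc ‖c j‖ * (|r j| ^ L.length * ‖_root_.dirDerivs (L.map ℓ) (A (σ j)) (r j • ℓ z + a j)‖)
      ≤ ‖c j‖ * (1 * (|C| * U (r j • ℓ z + a j))) := by
        gcongr
        exact h2.trans (mul_le_mul_of_nonneg_right (le_abs_self C) (hU _))
    _ = |C| * (‖c j‖ * U (r j • ℓ z + a j)) := by ring
    _ ≤ |C| * W z := mul_le_mul_of_nonneg_left (h j z) (abs_nonneg C)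

theorem unifSymbol_const (c : ℂ) :
    UnifSymbol (fun _ : V => (1 : ℝ)) (fun (_ : ι) (_ : V) => c) := by
  refine ⟨fun _ => contDiff_const, fun L => ⟨‖c‖, fun i z => ?_⟩⟩
  rw [dirDerivs_const]
  split_ifs <;> simp

theorem SymTendsto.dirDeriv {B : V → ℂ} (h : SymTendsto l A B) (v : V) :
    SymTendsto l (fun i => dirDeriv v (A i)) (dirDeriv v B) := fun L z => h (v :: L) z

theorem SymTendsto.mul {A' : ι → V → ℂ} {B B' : V → ℂ} (h : SymTendsto l A B)
    (h' : SymTendsto l A' B') (hA : ∀ i, ContDiff ℝ ∞ (A i)) (hA' : ∀ i, ContDiff ℝ ∞ (A' i))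
    (hB : ContDiff ℝ ∞ B) (hB' : ContDiff ℝ ∞ B') :
    SymTendsto l (fun i z => A i z * A' i z) (fun z => B z * B' z) := by
  intro L
  induction L generalizing A A' B B' with
  | nil => exact fun z => (h [] z).mul (h' [] z)
  | cons v L ih =>
    intro z
    have e : ∀ {F G : V → ℂ}, ContDiff ℝ ∞ F → ContDiff ℝ ∞ G →
        dirDerivs (v :: L) (fun z => F z * G z) = fun z =>
          dirDerivs L (fun z => _root_.dirDeriv v F z * G z) z +
            dirDerivs L (fun z => F z * _root_.dirDeriv v G z) z := by
      intro F G hF hG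
      rw [dirDerivs, dirDeriv_mul v hF hG,
        dirDerivs_add L ((dirDeriv_smooth v hF).mul hG) (hF.mul (dirDeriv_smooth v hG))]
    simp only [e (hA _) (hA' _), e hB hB']
    exact (ih (h.dirDeriv v) h' (fun i => dirDeriv_smooth v (hA i)) hA'
      (dirDeriv_smooth v hB) hB' z).add
      (ih h (h'.dirDeriv v) hA (fun i => dirDeriv_smooth v (hA' i)) hB (dirDeriv_smooth v hB') z)

theorem SymTendsto.add {A' : ι → V → ℂ} {B B' : V → ℂ} (h : SymTendsto l A B)
    (h' : SymTendsto l A' B') (hA : ∀ i, ContDiff ℝ ∞ (A i)) (hA' : ∀ i, ContDiff ℝ ∞ (A' i))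
    (hB : ContDiff ℝ ∞ B) (hB' : ContDiff ℝ ∞ B') :
    SymTendsto l (fun i z => A i z + A' i z) (fun z => B z + B' z) := by
  intro L z
  simp only [dirDerivs_add L (hA _) (hA' _), dirDerivs_add L hB hB']
  exact (h L z).add (h' L z)

theorem symTendsto_const (l : Filter ι) (B : V → ℂ) : SymTendsto l (fun _ => B) B :=
  fun _ _ => tendsto_const_nhds

theorem SymTendsto.comp_affine {A : ι → V' → ℂ} {B : V' → ℂ} (h : SymTendsto l A B)
    (ℓ : V →L[ℝ] V') (a : V') (hA : ∀ i, ContDiff ℝ ∞ (A i)) (hB : ContDiff ℝ ∞ B) :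
    SymTendsto l (fun i z => A i (ℓ z + a)) (fun z => B (ℓ z + a)) := by
  intro L z
  simp only [dirDerivs_comp_add_const L ℓ a (hA _), dirDerivs_comp_add_const L ℓ a hB]
  exact h _ _

/-- Rescaling a smooth function flattens it to its value at the limit of the base points. -/
theorem symTendsto_rescale {χ : V → ℂ} (hχ : ContDiff ℝ ∞ χ) {r : ι → ℝ} {a : ι → V} {b : V}
    (hr : Tendsto r l (𝓝 0)) (ha : Tendsto a l (𝓝 b)) :
    SymTendsto l (fun i z => χ (r i • z + a i)) (fun _ => χ b) := by
  intro L z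
  have h0 : Tendsto (fun i => r i • z + a i) l (𝓝 b) := by
    simpa using (hr.smul_const z).add ha
  have h1 : ∀ i, dirDerivs L (fun z => χ (r i • z + a i)) z =
      (r i : ℂ) ^ L.length * dirDerivs L χ (r i • z + a i) := fun i => by
    simpa using congrFun (dirDerivs_comp_affine L (r i) (ContinuousLinearMap.id ℝ V) (a i) hχ) z
  simp only [h1, dirDerivs_const]
  have h2 := ((dirDerivs_smooth L hχ).continuous.tendsto b).comp h0
  have h3 : Tendsto (fun i => (r i : ℂ) ^ L.length) l (𝓝 ((0 : ℂ) ^ L.length)) := by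
    have := (Complex.continuous_ofReal.tendsto 0).comp hr
    simpa using this.pow L.length
  have h4 := h3.mul h2
  cases L with
  | nil => simpa [dirDerivs] using h4
  | cons v L => simpa using h4

end UnifSymbol

/-! ### Integration by parts against an oscillating exponential -/

section OscStep

variable {V ι : Type*} [NormedAddCommGroup V] [NormedSpace ℝ V]

/-- The function `1 / (1 + i ℓ)` for a real linear form `ℓ`. -/
def invLin (ℓ : V →L[ℝ] ℝ) (z : V) : ℂ := (1 + Complex.I * ℓ z)⁻¹

theorem one_add_I_mul_ne_zero (a : ℝ) : (1 + Complex.I * a : ℂ) ≠ 0 := by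
  intro h
  have := congrArg Complex.re h
  simp at this

theorem norm_invLin_sq (ℓ : V →L[ℝ] ℝ) (z : V) : ‖invLin ℓ z‖ ^ 2 = (1 + ℓ z ^ 2)⁻¹ := by
  rw [invLin, norm_inv, inv_pow, ← Complex.normSq_eq_norm_sq, Complex.normSq_apply]
  simp [sq]

theorem norm_invLin_le_one (ℓ : V →L[ℝ] ℝ) (z : V) : ‖invLin ℓ z‖ ≤ 1 := by
  have h := norm_invLin_sq ℓ z
  have h1 : (1 + ℓ z ^ 2)⁻¹ ≤ 1 := inv_le_one_of_one_le₀ (by nlinarith [sq_nonneg (ℓ z)])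
  nlinarith [norm_nonneg (invLin ℓ z)]

theorem invLin_smooth (ℓ : V →L[ℝ] ℝ) : ContDiff ℝ ∞ (invLin ℓ) := by
  have h : ContDiff ℝ ∞ (fun z => (1 + Complex.I * (ℓ z : ℂ))) :=
    contDiff_const.add (contDiff_const.mul (Complex.ofRealCLM.contDiff.comp ℓ.contDiff))
  exact h.inv fun z => one_add_I_mul_ne_zero (ℓ z)

theorem dirDeriv_invLin_pow (ℓ : V →L[ℝ] ℝ) (v : V) (m : ℕ) :
    dirDeriv v (fun z => invLin ℓ z ^ (m + 1)) =
      fun z => (-((m + 1 : ℕ) : ℂ) * (Complex.I * ℓ v)) * invLin ℓ z ^ (m + 2) := by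
  funext z
  have h0 : HasFDerivAt (fun z => (1 + Complex.I * (ℓ z : ℂ)))
      (Complex.I • (Complex.ofRealCLM.comp ℓ)) z :=
    ((Complex.ofRealCLM.comp ℓ).hasFDerivAt.const_mul Complex.I).const_add 1
  have h1 : HasFDerivAt (fun z => (1 + Complex.I * (ℓ z : ℂ))⁻¹)
      (-((1 + Complex.I * (ℓ z : ℂ))⁻¹ ^ 2) • (Complex.I • (Complex.ofRealCLM.comp ℓ))) z := by
    rw [inv_pow]
    exact (hasDerivAt_inv (one_add_I_mul_ne_zero (ℓ z))).comp_hasFDerivAt z h0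
  have h2 := (h1.pow (m + 1)).fderiv
  change fderiv ℝ (fun z => ((1 + Complex.I * (ℓ z : ℂ))⁻¹) ^ (m + 1)) z v = _
  rw [h2]
  simp [invLin, -inv_pow]
  ring

/-- Every derivative of `(1 + i ℓ)⁻¹` is a combination of higher powers of it, so no decay is lost
by differentiating. -/
theorem unifSymbol_invLin (ℓ : V →L[ℝ] ℝ) :
    UnifSymbol (fun z => ‖invLin ℓ z‖) (fun _ : ι => invLin ℓ) := by
  refine ⟨fun _ => invLin_smooth ℓ, fun L => ?_⟩
  suffices h : ∀ m : ℕ, ∃ C : ℝ, ∀ z, ‖dirDerivs L (fun z => invLin ℓ z ^ (m + 1)) z‖ ≤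
      C * ‖invLin ℓ z‖ by
    obtain ⟨C, hC⟩ := h 0
    exact ⟨C, fun _ z => by simpa using hC z⟩
  induction L with
  | nil =>
    refine fun m => ⟨1, fun z => ?_⟩
    change ‖invLin ℓ z ^ (m + 1)‖ ≤ _
    rw [norm_pow, pow_succ]
    exact mul_le_mul_of_nonneg_right
      (pow_le_one₀ (norm_nonneg _) (norm_invLin_le_one ℓ z)) (norm_nonneg _)
  | cons v L ih =>
    intro m
    obtain ⟨C, hC⟩ := ih (m + 1)
    refine ⟨‖-((m + 1 : ℕ) : ℂ) * (Complex.I * ℓ v)‖ * C, fun z => ?_⟩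
    rw [dirDerivs, dirDeriv_invLin_pow, dirDerivs_const_mul L _ ((invLin_smooth ℓ).pow _),
      norm_mul, mul_assoc]
    exact mul_le_mul_of_nonneg_left (hC z) (norm_nonneg _)

/-- One integration by parts: if the derivative of an exponential `e` in the direction `w` is `i κ ℓ
e`, then `e = (1 + i ℓ)⁻¹ (1 + κ⁻¹ ∂_w) e`, and `ibpOp κ ℓ w` is the transpose of the operator on
the right (when `ℓ w = 0`). -/
def ibpOp (κ : ℝ) (ℓ : V →L[ℝ] ℝ) (w : V) (A : V → ℂ) : V → ℂ :=
  fun z => invLin ℓ z * (A z + (-(κ : ℂ)⁻¹) * dirDeriv w A z)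

theorem UnifSymbol.ibpOp {W : V → ℝ} {A : ι → V → ℂ} (hA : UnifSymbol W A) (hW : ∀ z, 0 ≤ W z)
    (κ : ℝ) (ℓ : V →L[ℝ] ℝ) (w : V) :
    UnifSymbol (fun z => ‖invLin ℓ z‖ * W z) (fun i => ibpOp κ ℓ w (A i)) :=
  (unifSymbol_invLin ℓ).mul
    (hA.add ((hA.dirDeriv w).const_mul hW (c := fun _ => -(κ : ℂ)⁻¹) fun _ => le_rfl))

theorem ibpOp_smooth (κ : ℝ) (ℓ : V →L[ℝ] ℝ) (w : V) {A : V → ℂ} (hA : ContDiff ℝ ∞ A) :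
    ContDiff ℝ ∞ (ibpOp κ ℓ w A) :=
  (invLin_smooth ℓ).mul (hA.add (contDiff_const.mul (dirDeriv_smooth w hA)))

theorem SymTendsto.ibpOp {l : Filter ι} {A : ι → V → ℂ} {B : V → ℂ} (h : SymTendsto l A B)
    (hA : ∀ i, ContDiff ℝ ∞ (A i)) (hB : ContDiff ℝ ∞ B) (κ : ℝ) (ℓ : V →L[ℝ] ℝ) (w : V) :
    SymTendsto l (fun i => ibpOp κ ℓ w (A i)) (ibpOp κ ℓ w B) := by
  have s : ∀ {F : V → ℂ}, ContDiff ℝ ∞ F →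
      ContDiff ℝ ∞ (fun z => (-(κ : ℂ)⁻¹) * _root_.dirDeriv w F z) :=
    fun hF => contDiff_const.mul (dirDeriv_smooth w hF)
  have h1 : SymTendsto l (fun i z => (-(κ : ℂ)⁻¹) * _root_.dirDeriv w (A i) z)
      (fun z => (-(κ : ℂ)⁻¹) * _root_.dirDeriv w B z) :=
    (symTendsto_const l (fun _ : V => -(κ : ℂ)⁻¹)).mul (h.dirDeriv w) (fun _ => contDiff_const)
      (fun i => dirDeriv_smooth w (hA i)) contDiff_const (dirDeriv_smooth w hB)
  exact (symTendsto_const l (invLin ℓ)).mul (h.add h1 hA (fun i => s (hA i)) hB (s hB))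
    (fun _ => invLin_smooth ℓ) (fun i => (hA i).add (s (hA i))) (invLin_smooth ℓ) (hB.add (s hB))

/-- The weight `(1 + |z|²)⁻³`, integrable on spaces of dimension less than `6`. -/
def intWeight (z : V) : ℝ := ((1 + ‖z‖ ^ 2) ^ 3)⁻¹

theorem intWeight_nonneg {V : Type*} [NormedAddCommGroup V] (z : V) : 0 ≤ intWeight z := by
  unfold intWeight; positivity

variable [MeasurableSpace V] [BorelSpace V] [FiniteDimensional ℝ V]
  (μ : Measure V) [μ.IsAddHaarMeasure]

theorem integrable_intWeight (hd : Module.finrank ℝ V < 6) :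
    Integrable (intWeight : V → ℝ) μ := by
  have h := integrable_rpow_neg_one_add_norm_sq (E := V) (μ := μ) (r := 6) (by exact_mod_cast hd)
  refine h.congr (Eventually.of_forall fun x => ?_)
  have hx : (0 : ℝ) ≤ 1 + ‖x‖ ^ 2 := by positivity
  simp only [intWeight]
  rw [show (-6 / 2 : ℝ) = -((3 : ℕ) : ℝ) by norm_num, Real.rpow_neg hx, Real.rpow_natCast]

theorem UnifSymbol.integrable_mul {A : ι → V → ℂ} (hA : UnifSymbol intWeight A)
    (hd : Module.finrank ℝ V < 6) {e : V → ℂ} (he : Continuous e) (he1 : ∀ z, ‖e z‖ ≤ 1) (i : ι) :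
    Integrable (fun z => A i z * e z) μ := by
  obtain ⟨C, hC⟩ := hA.bound []
  refine ((integrable_intWeight μ hd).const_mul C).mono'
    ((hA.smooth i).continuous.mul he).aestronglyMeasurable (Eventually.of_forall fun z => ?_)
  rw [norm_mul]
  calc ‖A i z‖ * ‖e z‖ ≤ ‖A i z‖ * 1 := mul_le_mul_of_nonneg_left (he1 z) (norm_nonneg _)
    _ ≤ C * intWeight z := by rw [_root_.mul_one]; exact hC i z

/-- The boundary terms of the integration by parts vanish because the amplitude and its derivatives
are integrable; `ℓ w = 0` says that `(1 + i ℓ)⁻¹` is constant in the direction `w`. -/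
theorem integral_ibpOp {A : V → ℂ} (hA : UnifSymbol intWeight (fun _ : Unit => A))
    (hd : Module.finrank ℝ V < 6) {e : V → ℂ} (he : ContDiff ℝ ∞ e) (he1 : ∀ z, ‖e z‖ ≤ 1)
    {κ : ℝ} (hκ : κ ≠ 0) {ℓ : V →L[ℝ] ℝ} {w : V} (hℓ : ℓ w = 0)
    (hd_e : ∀ z, dirDeriv w e z = Complex.I * (κ * ℓ z) * e z) :
    ∫ z, ibpOp κ ℓ w A z * e z ∂μ = ∫ z, A z * e z ∂μ := by
  have hκ' : (κ : ℂ) ≠ 0 := by exact_mod_cast hκ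
  set B : V → ℂ := fun z => invLin ℓ z * A z with hB
  have hAs : ContDiff ℝ ∞ A := hA.smooth ()
  have hBs : ContDiff ℝ ∞ B := (invLin_smooth ℓ).mul hAs
  have hmono : ∀ {F : V → ℂ}, UnifSymbol intWeight (fun _ : Unit => F) →
      UnifSymbol intWeight (fun _ : Unit => fun z => invLin ℓ z * F z) := by
    intro F hF
    refine ((unifSymbol_invLin ℓ).mul hF).mono
      (fun z => mul_nonneg (norm_nonneg _) (intWeight_nonneg z)) (c := 1) fun z => ?_
    exact mul_le_mul_of_nonneg_right (norm_invLin_le_one ℓ z) (intWeight_nonneg z)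
  have hdB : dirDeriv w B = fun z => invLin ℓ z * dirDeriv w A z := by
    have h0 := dirDeriv_invLin_pow ℓ w 0
    simp only [hℓ] at h0
    simp only [zero_add, pow_one, Complex.ofReal_zero, mul_zero, zero_mul] at h0
    rw [hB, dirDeriv_mul w (invLin_smooth ℓ) hAs, h0]
    simp
  have i1 : Integrable (fun z => B z * e z) μ :=
    (hmono hA).integrable_mul μ hd he.continuous he1 ()
  have i2 : Integrable (fun z => dirDeriv w B z * e z) μ := by
    rw [hdB]
    exact (hmono (hA.dirDeriv w)).integrable_mul μ hd he.continuous he1 ()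
  have hBe : ∀ z, B z * dirDeriv w e z = κ * (A z * e z - B z * e z) := by
    intro z
    rw [hd_e, hB]
    simp only [invLin]
    have := one_add_I_mul_ne_zero (ℓ z)
    field_simp
    ring
  have i0 : Integrable (fun z => A z * e z) μ := hA.integrable_mul μ hd he.continuous he1 ()
  have i3 : Integrable (fun z => B z * dirDeriv w e z) μ := by
    simp only [hBe]
    exact (i0.sub i1).const_mul _
  have key := integral_mul_fderiv_eq_neg_fderiv_mul_of_integrable (μ := μ) (f := B) (g := e)
    (v := w) i2 i3 i1 (fun x _ => hBs.differentiableAt_infty x)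
    (fun x _ => he.differentiableAt_infty x)
  have e1 : ∫ z, B z * dirDeriv w e z ∂μ = κ * (∫ z, A z * e z ∂μ - ∫ z, B z * e z ∂μ) := by
    simp only [hBe]
    rw [integral_const_mul, integral_sub i0 i1]
  have e2 : ∫ z, ibpOp κ ℓ w A z * e z ∂μ =
      ∫ z, B z * e z ∂μ + (-(κ : ℂ)⁻¹) * ∫ z, dirDeriv w B z * e z ∂μ := by
    rw [← integral_const_mul, ← integral_add i1 (i2.const_mul _)]
    refine integral_congr_ae (Eventually.of_forall fun z => ?_)
    simp only [ibpOp, congrFun hdB z]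
    simp only [hB]
    ring
  change ∫ z, B z * dirDeriv w e z ∂μ = - ∫ z, dirDeriv w B z * e z ∂μ at key
  rw [e1] at key
  rw [e2, ← neg_eq_iff_eq_neg.2 key]
  field_simp
  ring

end OscStep

/-! ### Schwartz functions as symbols -/

section Schwartz

variable {V ι : Type*} [NormedAddCommGroup V] [NormedSpace ℝ V]

theorem SchwartzMap.smooth_infty (χ : 𝓢(V, ℂ)) : ContDiff ℝ ∞ χ := χ.smooth'

theorem SchwartzMap.exists_bound (χ : 𝓢(V, ℂ)) (m : ℕ) :
    ∃ C : ℝ, ∀ z, ‖χ z‖ ≤ C * ((1 + ‖z‖ ^ 2) ^ m)⁻¹ := by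
  refine ⟨2 ^ (2 * m) * (Finset.Iic (2 * m, 0)).sup
    (fun m => SchwartzMap.seminorm ℝ m.1 m.2) χ, fun z => ?_⟩
  have h := SchwartzMap.one_add_le_sup_seminorm_apply (𝕜 := ℝ) (m := (2 * m, 0)) (k := 2 * m)
    (n := 0) le_rfl le_rfl χ z
  rw [norm_iteratedFDeriv_zero] at h
  have h0 : (0 : ℝ) < (1 + ‖z‖ ^ 2) ^ m := by positivity
  rw [← div_eq_mul_inv, le_div_iff₀ h0, mul_comm]
  refine le_trans (mul_le_mul_of_nonneg_right ?_ (norm_nonneg _)) h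
  rw [pow_mul]
  refine pow_le_pow_left₀ (by positivity) ?_ m
  nlinarith [norm_nonneg z]

theorem SchwartzMap.unifSymbol (χ : 𝓢(V, ℂ)) (m : ℕ) :
    UnifSymbol (fun z : V => ((1 + ‖z‖ ^ 2) ^ m)⁻¹) (fun _ : ι => χ) := by
  refine ⟨fun _ => χ.smooth_infty, fun L => ?_⟩
  induction L generalizing χ with
  | nil => obtain ⟨C, hC⟩ := χ.exists_bound m; exact ⟨C, fun _ => hC⟩
  | cons v L ih => exact ih (LineDeriv.lineDerivOp v χ)

end Schwartz

/-! ### Oscillatory integrals on the symplectic plane -/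

section Osc

/-- The coordinate `uᵢ` of `(u, v)`. -/
def coordFst (i : Fin 2) : Plane × Plane →L[ℝ] ℝ :=
  (EuclideanSpace.proj i).comp (ContinuousLinearMap.fst ℝ Plane Plane)

/-- The coordinate `vᵢ` of `(u, v)`. -/
def coordSnd (i : Fin 2) : Plane × Plane →L[ℝ] ℝ :=
  (EuclideanSpace.proj i).comp (ContinuousLinearMap.snd ℝ Plane Plane)

@[simp] theorem coordFst_apply (i : Fin 2) (z : Plane × Plane) : coordFst i z = z.1 i := rfl

@[simp] theorem coordSnd_apply (i : Fin 2) (z : Plane × Plane) : coordSnd i z = z.2 i := rfl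

variable (c ħ : ℝ)

/-- The oscillating factor `e^{-(2i/ħ) ω(u, v)}`. -/
def oscExp (z : Plane × Plane) : ℂ :=
  Complex.exp (Complex.I * ((-(2 / ħ) * symp c z.1 z.2 : ℝ) : ℂ))

theorem norm_oscExp (z : Plane × Plane) : ‖oscExp c ħ z‖ = 1 := by
  rw [oscExp, mul_comm]
  exact Complex.norm_exp_ofReal_mul_I _

theorem hasFDerivAt_phase (z : Plane × Plane) :
    HasFDerivAt (fun z : Plane × Plane => -(2 / ħ) * symp c z.1 z.2)
      ((-(2 / ħ) * c) • (z.1 0 • coordSnd 1 + z.2 1 • coordFst 0 -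
        (z.1 1 • coordSnd 0 + z.2 0 • coordFst 1))) z := by
  have h := ((((coordFst 0).hasFDerivAt (x := z)).mul ((coordSnd 1).hasFDerivAt (x := z))).sub
    (((coordFst 1).hasFDerivAt (x := z)).mul ((coordSnd 0).hasFDerivAt (x := z)))).const_mul
    (-(2 / ħ) * c)
  refine h.congr_of_eventuallyEq (Eventually.of_forall fun z => ?_)
  simp [symp]
  ring

theorem oscExp_smooth : ContDiff ℝ ∞ (oscExp c ħ) := by
  have h : ContDiff ℝ ∞ (fun z : Plane × Plane => -(2 / ħ) * symp c z.1 z.2) := by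
    have h1 := (((coordFst 0).contDiff (n := ∞)).mul ((coordSnd 1).contDiff (n := ∞))).sub
      (((coordFst 1).contDiff (n := ∞)).mul ((coordSnd 0).contDiff (n := ∞)))
    exact contDiff_const.mul (contDiff_const.mul h1)
  exact Complex.contDiff_exp.comp (contDiff_const.mul (Complex.ofRealCLM.contDiff.comp h))

theorem dirDeriv_oscExp (w z : Plane × Plane) :
    dirDeriv w (oscExp c ħ) z = Complex.I * ((-(2 / ħ) * c * (z.1 0 * w.2 1 + z.2 1 * w.1 0 -
      (z.1 1 * w.2 0 + z.2 0 * w.1 1)) : ℝ) : ℂ) * oscExp c ħ z := by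
  have h1 := (Complex.ofRealCLM.hasFDerivAt.comp z (hasFDerivAt_phase c ħ z)).const_mul Complex.I
  have h2 := h1.cexp.fderiv
  change fderiv ℝ (fun z : Plane × Plane => Complex.exp (Complex.I *
    ((-(2 / ħ) * symp c z.1 z.2 : ℝ) : ℂ))) z w = _
  simp only [Function.comp_def, Complex.ofRealCLM_apply] at h2
  rw [h2, oscExp]
  simp
  ring

/-- The integration by parts with respect to all four coordinates, which gains a factor
`(1 + |z|²)^{-1/2}` of decay. -/
def oscStep (A : Plane × Plane → ℂ) : Plane × Plane → ℂ :=
  ibpOp (-(2 / ħ) * c) (coordFst 0) (0, basisVec 1)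
    (ibpOp (2 / ħ * c) (coordFst 1) (0, basisVec 0)
      (ibpOp (2 / ħ * c) (coordSnd 0) (basisVec 1, 0)
        (ibpOp (-(2 / ħ) * c) (coordSnd 1) (basisVec 0, 0) A)))

/-- The weight gained by `oscStep`. -/
def oscGain (z : Plane × Plane) : ℝ :=
  ‖invLin (coordFst 0) z‖ * (‖invLin (coordFst 1) z‖ *
    (‖invLin (coordSnd 0) z‖ * ‖invLin (coordSnd 1) z‖))

theorem oscGain_nonneg (z : Plane × Plane) : 0 ≤ oscGain z := by unfold oscGain; positivity

theorem oscGain_le_one (z : Plane × Plane) : oscGain z ≤ 1 := by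
  have h := fun ℓ => norm_invLin_le_one (V := Plane × Plane) ℓ z
  exact mul_le_one₀ (h _) (by positivity) (mul_le_one₀ (h _) (by positivity)
    (mul_le_one₀ (h _) (by positivity) (h _)))

theorem one_add_norm_sq_le (z : Plane × Plane) : 1 + ‖z‖ ^ 2 ≤
    (1 + z.1 0 ^ 2) * ((1 + z.1 1 ^ 2) * ((1 + z.2 0 ^ 2) * (1 + z.2 1 ^ 2))) := by
  have h1 : ‖z.1‖ ^ 2 = z.1 0 ^ 2 + z.1 1 ^ 2 := by
    rw [EuclideanSpace.real_norm_sq_eq, Fin.sum_univ_two]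
  have h2 : ‖z.2‖ ^ 2 = z.2 0 ^ 2 + z.2 1 ^ 2 := by
    rw [EuclideanSpace.real_norm_sq_eq, Fin.sum_univ_two]
  have h3 : ‖z‖ ^ 2 ≤ ‖z.1‖ ^ 2 + ‖z.2‖ ^ 2 := by
    rw [Prod.norm_def]
    rcases max_cases ‖z.1‖ ‖z.2‖ with h | h <;> rw [h.1] <;>
      nlinarith [sq_nonneg ‖z.1‖, sq_nonneg ‖z.2‖]
  have a := sq_nonneg (z.1 0)
  have b := sq_nonneg (z.1 1)
  have d := sq_nonneg (z.2 0)
  have e := sq_nonneg (z.2 1)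
  generalize z.1 0 ^ 2 = A at *
  generalize z.1 1 ^ 2 = B at *
  generalize z.2 0 ^ 2 = D at *
  generalize z.2 1 ^ 2 = E at *
  have p1 : 1 + (D + E) ≤ (1 + D) * (1 + E) := by nlinarith [mul_nonneg d e]
  have p2 : 1 + (A + B) ≤ (1 + A) * (1 + B) := by nlinarith [mul_nonneg a b]
  calc 1 + ‖z‖ ^ 2 ≤ (1 + (A + B)) * (1 + (D + E)) := by
        nlinarith [mul_nonneg (add_nonneg a b) (add_nonneg d e)]
    _ ≤ ((1 + A) * (1 + B)) * ((1 + D) * (1 + E)) :=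
        mul_le_mul p2 p1 (by positivity) (by positivity)
    _ = _ := by ring

theorem oscGain_sq_le (z : Plane × Plane) : oscGain z ^ 2 ≤ (1 + ‖z‖ ^ 2)⁻¹ := by
  simp only [oscGain, mul_pow, norm_invLin_sq, coordFst_apply, coordSnd_apply, ← mul_inv]
  exact inv_anti₀ (by positivity) (one_add_norm_sq_le z)

variable {ι : Type*} {A : ι → Plane × Plane → ℂ} {W : Plane × Plane → ℝ}

theorem oscStep_smooth {A : Plane × Plane → ℂ} (hA : ContDiff ℝ ∞ A) :
    ContDiff ℝ ∞ (oscStep c ħ A) :=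
  ibpOp_smooth _ _ _ (ibpOp_smooth _ _ _ (ibpOp_smooth _ _ _ (ibpOp_smooth _ _ _ hA)))

theorem oscStep_iter_smooth (n : ℕ) {A : Plane × Plane → ℂ} (hA : ContDiff ℝ ∞ A) :
    ContDiff ℝ ∞ ((oscStep c ħ)^[n] A) := by
  induction n with
  | zero => exact hA
  | succ n ih => rw [Function.iterate_succ_apply']; exact oscStep_smooth c ħ ih

theorem UnifSymbol.oscStep (hA : UnifSymbol W A) (hW : ∀ z, 0 ≤ W z) :
    UnifSymbol (fun z => oscGain z * W z) (fun i => oscStep c ħ (A i)) := by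
  have h1 := hA.ibpOp hW (-(2 / ħ) * c) (coordSnd 1) (basisVec 0, 0)
  have h2 := h1.ibpOp (fun z => by have := hW z; positivity) (2 / ħ * c)
    (coordSnd 0) (basisVec 1, 0)
  have h3 := h2.ibpOp (fun z => by have := hW z; positivity) (2 / ħ * c)
    (coordFst 1) (0, basisVec 0)
  have h4 := h3.ibpOp (fun z => by have := hW z; positivity) (-(2 / ħ) * c) (coordFst 0)
    (0, basisVec 1)
  refine h4.mono (fun z => by have := hW z; positivity) (c := 1) fun z => le_of_eq ?_
  simp only [oscGain]
  ring

theorem UnifSymbol.oscStep_iter (hA : UnifSymbol W A) (hW : ∀ z, 0 ≤ W z) (n : ℕ) :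
    UnifSymbol (fun z => oscGain z ^ n * W z) (fun i => (_root_.oscStep c ħ)^[n] (A i)) := by
  induction n with
  | zero => simpa using hA
  | succ n ih =>
    simp only [Function.iterate_succ_apply']
    refine (ih.oscStep c ħ (fun z => mul_nonneg (pow_nonneg (oscGain_nonneg z) n) (hW z))).mono
      (fun z => mul_nonneg (oscGain_nonneg z)
        (mul_nonneg (pow_nonneg (oscGain_nonneg z) n) (hW z))) (c := 1) fun z => le_of_eq ?_
    ring

/-- Enough integrations by parts make a symbol of polynomial growth integrable. -/
theorem UnifSymbol.oscStep_intWeight {k n : ℕ}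
    (hA : UnifSymbol (fun z : Plane × Plane => (1 + ‖z‖ ^ 2) ^ k) A) (hn : 2 * (k + 3) ≤ n) :
    UnifSymbol intWeight (fun i => (_root_.oscStep c ħ)^[n] (A i)) := by
  have hW : ∀ z : Plane × Plane, (0 : ℝ) ≤ (1 + ‖z‖ ^ 2) ^ k := fun z => by positivity
  refine (hA.oscStep_iter c ħ hW n).mono
    (fun z => mul_nonneg (pow_nonneg (oscGain_nonneg z) n) (hW z)) (c := 1) fun z => ?_
  have h0 : (0 : ℝ) < 1 + ‖z‖ ^ 2 := by positivity
  calc oscGain z ^ n * (1 + ‖z‖ ^ 2) ^ k ≤ oscGain z ^ (2 * (k + 3)) * (1 + ‖z‖ ^ 2) ^ k :=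
        mul_le_mul_of_nonneg_right
          (pow_le_pow_of_le_one (oscGain_nonneg z) (oscGain_le_one z) hn) (hW z)
    _ ≤ ((1 + ‖z‖ ^ 2)⁻¹) ^ (k + 3) * (1 + ‖z‖ ^ 2) ^ k := by
        rw [pow_mul]
        exact mul_le_mul_of_nonneg_right
          (pow_le_pow_left₀ (sq_nonneg _) (oscGain_sq_le z) _) (hW z)
    _ = 1 * intWeight z := by
        rw [intWeight, inv_pow, pow_add]
        field_simp

theorem SymTendsto.oscStep {l : Filter ι} {B : Plane × Plane → ℂ} (h : SymTendsto l A B)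
    (hA : ∀ i, ContDiff ℝ ∞ (A i)) (hB : ContDiff ℝ ∞ B) :
    SymTendsto l (fun i => oscStep c ħ (A i)) (oscStep c ħ B) := by
  have s : ∀ (κ : ℝ) ℓ w {F : Plane × Plane → ℂ}, ContDiff ℝ ∞ F →
      ContDiff ℝ ∞ (_root_.ibpOp κ ℓ w F) :=
    fun κ ℓ w F hF => ibpOp_smooth κ ℓ w hF
  exact (((h.ibpOp hA hB _ _ _).ibpOp (fun i => s _ _ _ (hA i)) (s _ _ _ hB) _ _ _).ibpOp
    (fun i => s _ _ _ (s _ _ _ (hA i))) (s _ _ _ (s _ _ _ hB)) _ _ _).ibpOp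
    (fun i => s _ _ _ (s _ _ _ (s _ _ _ (hA i)))) (s _ _ _ (s _ _ _ (s _ _ _ hB))) _ _ _

theorem SymTendsto.oscStep_iter {l : Filter ι} {B : Plane × Plane → ℂ} (h : SymTendsto l A B)
    (hA : ∀ i, ContDiff ℝ ∞ (A i)) (hB : ContDiff ℝ ∞ B) (n : ℕ) :
    SymTendsto l (fun i => (_root_.oscStep c ħ)^[n] (A i)) ((_root_.oscStep c ħ)^[n] B) := by
  induction n with
  | zero => exact h
  | succ n ih =>
    simp only [Function.iterate_succ_apply']
    exact ih.oscStep c ħ (fun i => oscStep_iter_smooth c ħ n (hA i)) (oscStep_iter_smooth c ħ n hB)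

instance isAddHaarMeasure_plane_prod :
    (volume : Measure (Plane × Plane)).IsAddHaarMeasure :=
  inferInstanceAs ((volume : Measure Plane).prod (volume : Measure Plane)).IsAddHaarMeasure

theorem finrank_plane_prod : Module.finrank ℝ (Plane × Plane) < 6 := by
  rw [Module.finrank_prod, finrank_euclideanSpace]
  decide

/-- The value of an oscillatory integral after `n` rounds of integration by parts. -/
def oscIter (n : ℕ) (A : Plane × Plane → ℂ) : ℂ := ∫ z, (oscStep c ħ)^[n] A z * oscExp c ħ z

variable {c ħ}

theorem integral_oscStep (hc : c ≠ 0) (hħ : ħ ≠ 0) {A : Plane × Plane → ℂ}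
    (hA : UnifSymbol intWeight (fun _ : Unit => A)) :
    ∫ z, oscStep c ħ A z * oscExp c ħ z = ∫ z, A z * oscExp c ħ z := by
  have h1 : (2 / ħ * c) ≠ 0 := by positivity
  have h2 : (-(2 / ħ) * c) ≠ 0 := by
    rw [neg_mul]; exact neg_ne_zero.2 h1
  have m : ∀ {F : Plane × Plane → ℂ} κ ℓ w, UnifSymbol intWeight (fun _ : Unit => F) →
      UnifSymbol intWeight (fun _ : Unit => ibpOp κ ℓ w F) := fun κ ℓ w hF =>
    (hF.ibpOp intWeight_nonneg κ ℓ w).mono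
      (fun z => mul_nonneg (norm_nonneg _) (intWeight_nonneg z)) (c := 1) fun z =>
      mul_le_mul_of_nonneg_right (norm_invLin_le_one ℓ z) (intWeight_nonneg z)
  have step : ∀ {F : Plane × Plane → ℂ} {κ : ℝ} {ℓ : Plane × Plane →L[ℝ] ℝ} {w : Plane × Plane},
      UnifSymbol intWeight (fun _ : Unit => F) → κ ≠ 0 → ℓ w = 0 →
      (∀ z, dirDeriv w (oscExp c ħ) z = Complex.I * (κ * ℓ z) * oscExp c ħ z) →
      ∫ z, ibpOp κ ℓ w F z * oscExp c ħ z = ∫ z, F z * oscExp c ħ z :=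
    fun hF hκ hℓ hd => integral_ibpOp volume hF finrank_plane_prod (oscExp_smooth c ħ)
      (fun z => (norm_oscExp c ħ z).le) hκ hℓ hd
  unfold oscStep
  rw [step (m _ _ _ (m _ _ _ (m _ _ _ hA))) h2 (by simp)
      (fun z => by rw [dirDeriv_oscExp]; simp),
    step (m _ _ _ (m _ _ _ hA)) h1 (by simp) (fun z => by rw [dirDeriv_oscExp]; simp),
    step (m _ _ _ hA) h1 (by simp) (fun z => by rw [dirDeriv_oscExp]; simp),
    step hA h2 (by simp) (fun z => by rw [dirDeriv_oscExp]; simp)]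

theorem UnifSymbol.oscStep_le (hA : UnifSymbol intWeight A) :
    UnifSymbol intWeight (fun i => _root_.oscStep c ħ (A i)) :=
  (hA.oscStep c ħ intWeight_nonneg).mono
    (fun z => mul_nonneg (oscGain_nonneg z) (intWeight_nonneg z)) (c := 1)
    fun z => mul_le_mul_of_nonneg_right (oscGain_le_one z) (intWeight_nonneg z)

/-- For integrable symbols the rounds of integration by parts do not change the integral. -/
theorem oscIter_eq_integral (hc : c ≠ 0) (hħ : ħ ≠ 0) {A : Plane × Plane → ℂ}
    (hA : UnifSymbol intWeight (fun _ : Unit => A)) (n : ℕ) :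
    oscIter c ħ n A = ∫ z, A z * oscExp c ħ z := by
  induction n generalizing A with
  | zero => rfl
  | succ n ih =>
    rw [oscIter, Function.iterate_succ_apply]
    exact (ih hA.oscStep_le).trans (integral_oscStep hc hħ hA)

theorem oscIter_bound {k n : ℕ}
    (hA : UnifSymbol (fun z : Plane × Plane => (1 + ‖z‖ ^ 2) ^ k) A) (hn : 2 * (k + 3) ≤ n) :
    ∃ C : ℝ, ∀ i, ‖oscIter c ħ n (A i)‖ ≤ C := by
  obtain ⟨C, hC⟩ := (hA.oscStep_intWeight c ħ hn).bound []
  refine ⟨∫ z : Plane × Plane, C * intWeight z, fun i => ?_⟩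
  refine norm_integral_le_of_norm_le
    ((integrable_intWeight volume finrank_plane_prod).const_mul C)
    (Eventually.of_forall fun z => ?_)
  rw [norm_mul, norm_oscExp, mul_one]
  exact hC i z

theorem oscIter_tendsto {l : Filter ι} [l.IsCountablyGenerated] {B : Plane × Plane → ℂ} {k n : ℕ}
    (hA : UnifSymbol (fun z : Plane × Plane => (1 + ‖z‖ ^ 2) ^ k) A) (hn : 2 * (k + 3) ≤ n)
    (hB : ContDiff ℝ ∞ B) (h : SymTendsto l A B) :
    Tendsto (fun i => oscIter c ħ n (A i)) l (𝓝 (oscIter c ħ n B)) := by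
  have hA' := hA.oscStep_intWeight c ħ hn
  obtain ⟨C, hC⟩ := hA'.bound []
  refine tendsto_integral_filter_of_dominated_convergence (fun z => C * intWeight z)
    (Eventually.of_forall fun i => ((hA'.smooth i).continuous.mul
      (oscExp_smooth c ħ).continuous).aestronglyMeasurable)
    (Eventually.of_forall fun i => Eventually.of_forall fun z => ?_)
    ((integrable_intWeight volume finrank_plane_prod).const_mul C)
    (Eventually.of_forall fun z => ?_)
  · rw [norm_mul, norm_oscExp, mul_one]
    exact hC i z
  · exact (h.oscStep_iter c ħ hA.smooth hB n [] z).mul_const _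

/-- The regularization of a symbol of polynomial growth by a Schwartz function. -/
theorem UnifSymbol.schwartz_mul {k : ℕ}
    (hA : UnifSymbol (fun z : Plane × Plane => (1 + ‖z‖ ^ 2) ^ k) A)
    (χ : 𝓢(Plane × Plane, ℂ)) : UnifSymbol intWeight (fun i z => χ z * A i z) := by
  refine ((χ.unifSymbol (k + 3)).mul hA).mono (fun z => by positivity) (c := 1) fun z =>
    le_of_eq ?_
  have h0 : (0 : ℝ) < 1 + ‖z‖ ^ 2 := by positivity
  rw [intWeight, pow_add]
  field_simp

/-- Rescaling and translation of a Schwartz function. -/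
theorem exists_schwartz_rescale (χ : 𝓢(Plane × Plane, ℂ)) {ε : ℝ} (hε : 0 < ε)
    (a : Plane × Plane) : ∃ χ' : 𝓢(Plane × Plane, ℂ), ∀ z, χ' z = χ (ε • z + a) := by
  let g : (Plane × Plane) ≃L[ℝ] (Plane × Plane) :=
    ContinuousLinearEquiv.smulLeft (Units.mk0 ε hε.ne')
  refine ⟨SchwartzMap.compCLMOfContinuousLinearEquiv ℝ g (SchwartzMap.compSubConstCLM ℝ (-a) χ),
    fun z => ?_⟩
  simp [g, SchwartzMap.compSubConstCLM_apply]

/-- The regularized integrals may be integrated by parts, and the results converge by dominated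
convergence. This proves the existence of the oscillatory integral and computes it. -/
theorem hasOscIntegral_oscIter (hc : c ≠ 0) (hħ : ħ ≠ 0) {A : Plane × Plane → ℂ} {k n : ℕ}
    (hA : UnifSymbol (fun z : Plane × Plane => (1 + ‖z‖ ^ 2) ^ k) (fun _ : Unit => A))
    (hn : 2 * (k + 3) ≤ n) :
    HasOscIntegral A (fun p => -(2 / ħ) * symp c p.1 p.2) (oscIter c ħ n A) := by
  intro χ hχ
  have hreg : ∀ ε : ℝ, 0 < ε → UnifSymbol intWeight (fun _ : Unit => fun z => χ (ε • z) * A z) := by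
    intro ε hε
    obtain ⟨χ', h'⟩ := exists_schwartz_rescale χ hε 0
    have := hA.schwartz_mul χ'
    simpa only [h', add_zero] using this
  refine ⟨fun ε hε => (hreg ε hε).integrable_mul volume finrank_plane_prod
    (oscExp_smooth c ħ).continuous (fun z => (norm_oscExp c ħ z).le) (), ?_⟩
  -- truncating `ε` to `[0, 1]` makes the rescaled cutoffs a bounded family of symbols
  set r : ℝ → ℝ := fun ε => max 0 (min ε 1) with hr
  have hr1 : ∀ ε, |r ε| ≤ 1 := fun ε => by
    rw [abs_of_nonneg (le_max_left _ _)]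
    exact max_le zero_le_one (min_le_right _ _)
  have hr0 : Tendsto r (𝓝[>] 0) (𝓝 0) := by
    have : Continuous r := by fun_prop
    have h := this.tendsto 0
    have h0 : r 0 = 0 := by simp [hr]
    rw [h0] at h
    exact h.mono_left nhdsWithin_le_nhds
  have hχ1 : UnifSymbol (fun _ : Plane × Plane => (1 : ℝ)) (fun (ε : ℝ) z => χ (r ε • z)) := by
    have := (χ.unifSymbol (ι := Unit) 0).comp_affine (W := fun _ : Plane × Plane => (1 : ℝ))
      (fun z => by positivity) (fun _ : ℝ => ()) (fun _ => 1) r (ContinuousLinearMap.id ℝ _)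
      (fun _ => 0) hr1 (fun _ _ => by simp)
    simpa using this
  have hU : UnifSymbol (fun z : Plane × Plane => (1 + ‖z‖ ^ 2) ^ k)
      (fun (ε : ℝ) z => χ (r ε • z) * A z) := by
    simpa using hχ1.mul (hA.reindex (fun _ : ℝ => ()))
  have hT : SymTendsto (𝓝[>] 0) (fun (ε : ℝ) z => χ (r ε • z) * A z) A := by
    have h1 := symTendsto_rescale χ.smooth_infty hr0
      (tendsto_const_nhds (x := (0 : Plane × Plane)))
    simp only [add_zero] at h1
    have h2 := h1.mul (symTendsto_const (𝓝[>] 0) A) hχ1.smooth (fun _ => hA.smooth ())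
      contDiff_const (hA.smooth ())
    simpa [hχ] using h2
  refine (oscIter_tendsto hU hn (hA.smooth ()) hT).congr' ?_
  have hev : ∀ᶠ ε : ℝ in 𝓝[>] 0, ε < 1 := nhdsWithin_le_nhds (gt_mem_nhds zero_lt_one)
  filter_upwards [self_mem_nhdsWithin, hev] with ε hε hε1
  have hre : r ε = ε := by
    simp only [hr, min_eq_left hε1.le]
    exact max_eq_right (le_of_lt hε)
  rw [hre, oscIter_eq_integral hc hħ (hreg ε hε)]
  rfl

end Osc

section OscValue

variable (c ħ : ℝ)

theorem exists_schwartz_one {V : Type*} [NormedAddCommGroup V] [NormedSpace ℝ V]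
    [FiniteDimensional ℝ V] [HasContDiffBump V] :
    ∃ χ : 𝓢(V, ℂ), χ 0 = 1 ∧ HasCompactSupport χ := by
  let b : ContDiffBump (0 : V) := ⟨1, 2, one_pos, one_lt_two⟩
  have h1 : HasCompactSupport (fun x => ((b x : ℝ) : ℂ)) :=
    HasCompactSupport.comp_left (g := Complex.ofReal) b.hasCompactSupport Complex.ofReal_zero
  refine ⟨h1.toSchwartzMap (Complex.ofRealCLM.contDiff.comp b.contDiff), ?_, h1⟩
  change ((b 0 : ℝ) : ℂ) = 1
  rw [b.one_of_mem_closedBall (by simp [b])]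
  simp

theorem HasOscIntegral.unique {a : Plane × Plane → ℂ} {φ : Plane × Plane → ℝ} {I J : ℂ}
    (hI : HasOscIntegral a φ I) (hJ : HasOscIntegral a φ J) : I = J := by
  obtain ⟨χ, hχ, -⟩ := exists_schwartz_one (V := Plane × Plane)
  exact tendsto_nhds_unique (hI χ hχ).2 (hJ χ hχ).2

/-- The oscillatory integral of `A e^{-(2i/ħ) ω}`; an unspecified number where it does not exist. -/
def oscInt (A : Plane × Plane → ℂ) : ℂ :=
  Classical.epsilon (HasOscIntegral A (fun p => -(2 / ħ) * symp c p.1 p.2))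

variable {c ħ}

theorem HasOscIntegral.oscInt_eq {A : Plane × Plane → ℂ} {I : ℂ}
    (h : HasOscIntegral A (fun p => -(2 / ħ) * symp c p.1 p.2) I) : oscInt c ħ A = I :=
  (Classical.epsilon_spec (p := HasOscIntegral A (fun p => -(2 / ħ) * symp c p.1 p.2))
    ⟨I, h⟩).unique h

variable (hc : c ≠ 0) (hħ : ħ ≠ 0)
variable {ι : Type*} {A : ι → Plane × Plane → ℂ} {k : ℕ}

include hc hħ

theorem oscInt_eq_oscIter
    (hA : UnifSymbol (fun z : Plane × Plane => (1 + ‖z‖ ^ 2) ^ k) A) (i : ι) :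
    oscInt c ħ (A i) = oscIter c ħ (2 * (k + 3)) (A i) :=
  (hasOscIntegral_oscIter hc hħ (hA.reindex fun _ : Unit => i) le_rfl).oscInt_eq

theorem hasOscIntegral_oscInt
    (hA : UnifSymbol (fun z : Plane × Plane => (1 + ‖z‖ ^ 2) ^ k) A) (i : ι) :
    HasOscIntegral (A i) (fun p => -(2 / ħ) * symp c p.1 p.2) (oscInt c ħ (A i)) := by
  rw [oscInt_eq_oscIter hc hħ hA]
  exact hasOscIntegral_oscIter hc hħ (hA.reindex fun _ : Unit => i) le_rfl

/-- Oscillatory integrals are bounded on families of symbols with common bounds. -/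
theorem oscInt_bound (hA : UnifSymbol (fun z : Plane × Plane => (1 + ‖z‖ ^ 2) ^ k) A) :
    ∃ C : ℝ, ∀ i, ‖oscInt c ħ (A i)‖ ≤ C := by
  simp only [oscInt_eq_oscIter hc hħ hA]
  exact oscIter_bound hA le_rfl

/-- Oscillatory integrals are continuous along families of symbols with common bounds all of whose
derivatives converge pointwise. -/
theorem oscInt_tendsto {l : Filter ι} [l.IsCountablyGenerated] {B : Plane × Plane → ℂ}
    (hA : UnifSymbol (fun z : Plane × Plane => (1 + ‖z‖ ^ 2) ^ k) A)
    (hB : UnifSymbol (fun z : Plane × Plane => (1 + ‖z‖ ^ 2) ^ k) (fun _ : Unit => B))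
    (h : SymTendsto l A B) :
    Tendsto (fun i => oscInt c ħ (A i)) l (𝓝 (oscInt c ħ B)) := by
  simp only [oscInt_eq_oscIter hc hħ hA, oscInt_eq_oscIter hc hħ hB ()]
  exact oscIter_tendsto hA le_rfl (hB.smooth ()) h

theorem oscInt_eq_integral {A : Plane × Plane → ℂ}
    (hA : UnifSymbol intWeight (fun _ : Unit => A)) :
    oscInt c ħ A = ∫ z, A z * oscExp c ħ z := by
  have h : UnifSymbol (fun z : Plane × Plane => (1 + ‖z‖ ^ 2) ^ 0) (fun _ : Unit => A) := by
    refine hA.mono intWeight_nonneg (c := 1) fun z => ?_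
    rw [pow_zero, mul_one]
    exact inv_le_one_of_one_le₀ (one_le_pow₀ (by nlinarith [sq_nonneg ‖z‖]))
  rw [oscInt_eq_oscIter hc hħ h (), oscIter_eq_integral hc hħ hA]

end OscValue

theorem HasOscIntegral.const_mul {A : Plane × Plane → ℂ} {φ : Plane × Plane → ℝ} {I : ℂ}
    (h : HasOscIntegral A φ I) (z : ℂ) : HasOscIntegral (fun p => z * A p) φ (z * I) := by
  intro χ hχ
  obtain ⟨h1, h2⟩ := h χ hχ
  have e : ∀ (ε : ℝ) p, χ (ε • p) * (z * A p) * Complex.exp (Complex.I * φ p) =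
      z * (χ (ε • p) * A p * Complex.exp (Complex.I * φ p)) := fun ε p => by ring
  simp only [e, integral_const_mul]
  exact ⟨fun ε hε => (h1 ε hε).const_mul z, h2.const_mul z⟩

theorem HasOscIntegral.add {A B : Plane × Plane → ℂ} {φ : Plane × Plane → ℝ} {I J : ℂ}
    (h : HasOscIntegral A φ I) (h' : HasOscIntegral B φ J) :
    HasOscIntegral (fun p => A p + B p) φ (I + J) := by
  intro χ hχ
  obtain ⟨h1, h2⟩ := h χ hχ
  obtain ⟨h3, h4⟩ := h' χ hχ
  have e : ∀ (ε : ℝ) p, χ (ε • p) * (A p + B p) * Complex.exp (Complex.I * φ p) =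
      χ (ε • p) * A p * Complex.exp (Complex.I * φ p) +
        χ (ε • p) * B p * Complex.exp (Complex.I * φ p) := fun ε p => by ring
  simp only [e]
  refine ⟨fun ε hε => (h1 ε hε).add (h3 ε hε), (h2.add h4).congr' ?_⟩
  filter_upwards [self_mem_nhdsWithin] with ε hε
  rw [integral_add (h1 ε hε) (h3 ε hε)]

/-! ### The star product of functions on the symplectic plane -/

section Peetre

variable {V : Type*} [NormedAddCommGroup V]

/-- Peetre's inequality, which compares the weights at `a + b`, `a` and `b`. -/
theorem peetre (a b : V) : 1 + ‖a + b‖ ^ 2 ≤ 2 * ((1 + ‖a‖ ^ 2) * (1 + ‖b‖ ^ 2)) := by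
  have h := norm_add_le a b
  have h1 : ‖a + b‖ ^ 2 ≤ (‖a‖ + ‖b‖) ^ 2 := pow_le_pow_left₀ (norm_nonneg _) h 2
  nlinarith [sq_nonneg (‖a‖ - ‖b‖), sq_nonneg (‖a‖ * ‖b‖)]

theorem peetre_pow (a b : V) (k : ℕ) :
    (1 + ‖a + b‖ ^ 2) ^ k ≤ 2 ^ k * ((1 + ‖a‖ ^ 2) ^ k * (1 + ‖b‖ ^ 2) ^ k) := by
  rw [← mul_pow, ← mul_pow]
  exact pow_le_pow_left₀ (by positivity) (peetre a b) k

theorem one_le_one_add_norm_sq (a : V) : 1 ≤ 1 + ‖a‖ ^ 2 := by nlinarith [sq_nonneg ‖a‖]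

end Peetre

theorem UnifSymbol.mono_pow {V ι : Type*} [NormedAddCommGroup V] [NormedSpace ℝ V] {k k' : ℕ}
    {A : ι → V → ℂ} (hA : UnifSymbol (fun z : V => (1 + ‖z‖ ^ 2) ^ k) A) (h : k ≤ k') :
    UnifSymbol (fun z : V => (1 + ‖z‖ ^ 2) ^ k') A :=
  hA.mono (fun z => by positivity) (c := 1) fun z => by
    rw [_root_.one_mul]
    exact pow_le_pow_right₀ (one_le_one_add_norm_sq z) h

/-- Membership in `𝒪_C(ℝ²)`: all derivatives are bounded by multiples of one power of
`1 + |y|²`. -/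
def IsOC (f : Plane → ℂ) : Prop :=
  ∃ k : ℕ, UnifSymbol (fun y : Plane => (1 + ‖y‖ ^ 2) ^ k) (fun _ : Unit => f)

section PlaneStar

variable (c ħ : ℝ)

/-- The amplitude of the oscillatory integral that defines `(f ∗_ħ g)(y)`. -/
def starIntegrand (f g : Plane → ℂ) (y : Plane) (p : Plane × Plane) : ℂ :=
  (((|c| / (Real.pi * ħ)) ^ 2 : ℝ) : ℂ) * f (y + p.1) * g (y + p.2)

/-- The star product of two functions on the symplectic plane. -/
def planeStar (f g : Plane → ℂ) (y : Plane) : ℂ := oscInt c ħ (starIntegrand c ħ f g y)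

variable {ι : Type*} {f g : ι → Plane → ℂ} {k m : ℕ}

/-- Divided by the weight at `y`, the amplitudes are bounded symbols uniformly in `y`. This turns
the bound `oscInt_bound` on values into a growth estimate for star products. -/
theorem starIntegrand_unifSymbol (hf : UnifSymbol (fun y : Plane => (1 + ‖y‖ ^ 2) ^ k) f)
    (hg : UnifSymbol (fun y : Plane => (1 + ‖y‖ ^ 2) ^ m) g) :
    UnifSymbol (fun z : Plane × Plane => (1 + ‖z‖ ^ 2) ^ (k + m))
      (fun (q : ι × Plane) z => (((1 + ‖q.2‖ ^ 2) ^ (k + m))⁻¹ : ℝ) *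
        starIntegrand c ħ (f q.1) (g q.1) q.2 z) := by
  have half : ∀ (ℓ : Plane × Plane →L[ℝ] Plane), (∀ z, ‖ℓ z‖ ≤ ‖z‖) → ∀ {k : ℕ}
      {f : ι → Plane → ℂ}, UnifSymbol (fun y : Plane => (1 + ‖y‖ ^ 2) ^ k) f →
      UnifSymbol (fun z : Plane × Plane => (1 + ‖z‖ ^ 2) ^ k)
        (fun (q : ι × Plane) z => (((1 + ‖q.2‖ ^ 2) ^ k)⁻¹ : ℝ) * f q.1 (q.2 + ℓ z)) := by
    intro ℓ hℓ k f hf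
    have h1 := hf.comp_affine (W := fun z : Plane × Plane => 2 ^ k * (1 + ‖z‖ ^ 2) ^ k)
      (fun z => by positivity) (fun q : ι × Plane => q.1)
      (fun q => ((((1 + ‖q.2‖ ^ 2) ^ k)⁻¹ : ℝ) : ℂ)) (fun _ => 1) ℓ (fun q => q.2)
      (fun _ => by simp) (fun q z => by
        have h0 : (0 : ℝ) < (1 + ‖q.2‖ ^ 2) ^ k := by positivity
        rw [Complex.norm_real, Real.norm_of_nonneg (inv_nonneg.2 h0.le), inv_mul_le_iff₀ h0,
          one_smul, add_comm (ℓ z)]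
        refine (peetre_pow q.2 (ℓ z) k).trans ?_
        have h2 : (1 + ‖ℓ z‖ ^ 2) ^ k ≤ (1 + ‖z‖ ^ 2) ^ k := by gcongr; exact hℓ z
        calc 2 ^ k * ((1 + ‖q.2‖ ^ 2) ^ k * (1 + ‖ℓ z‖ ^ 2) ^ k)
            ≤ 2 ^ k * ((1 + ‖q.2‖ ^ 2) ^ k * (1 + ‖z‖ ^ 2) ^ k) := by gcongr
          _ = _ := by ring)
    have h3 := h1.mono (W' := fun z : Plane × Plane => (1 + ‖z‖ ^ 2) ^ k)
      (fun z => by positivity) (c := 2 ^ k) (fun z => le_rfl)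
    simpa only [one_smul, add_comm (ℓ _)] using h3
  have hF := half (ContinuousLinearMap.fst ℝ Plane Plane) norm_fst_le hf
  have hG := half (ContinuousLinearMap.snd ℝ Plane Plane) norm_snd_le hg
  have h := (hF.mul hG).const_mul (fun z => by positivity)
    (c := fun _ => (((|c| / (Real.pi * ħ)) ^ 2 : ℝ) : ℂ)) fun _ => le_rfl
  simp only [← pow_add] at h
  convert h using 3
  simp only [starIntegrand, pow_add, mul_inv]
  push_cast
  ring

theorem starIntegrand_unifSymbol_at (hf : UnifSymbol (fun y : Plane => (1 + ‖y‖ ^ 2) ^ k) f)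
    (hg : UnifSymbol (fun y : Plane => (1 + ‖y‖ ^ 2) ^ m) g) (y : Plane) :
    UnifSymbol (fun z : Plane × Plane => (1 + ‖z‖ ^ 2) ^ (k + m))
      (fun i => starIntegrand c ħ (f i) (g i) y) := by
  have h := ((starIntegrand_unifSymbol c ħ hf hg).reindex (fun i : ι => (i, y))).const_mul
    (fun z => by positivity) (c := fun _ => (((1 + ‖y‖ ^ 2) ^ (k + m) : ℝ) : ℂ)) fun _ => le_rfl
  have h0 : ((((1 + ‖y‖ ^ 2) ^ (k + m) : ℝ) : ℂ)) ≠ 0 := by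
    have : (0 : ℝ) < (1 + ‖y‖ ^ 2) ^ (k + m) := by positivity
    exact_mod_cast this.ne'
  simpa only [Complex.ofReal_inv, mul_inv_cancel_left₀ h0] using h

theorem starIntegrand_symTendsto {l : Filter ι} {f' g' : Plane → ℂ}
    (hf : ∀ i, ContDiff ℝ ∞ (f i)) (hg : ∀ i, ContDiff ℝ ∞ (g i))
    (hf' : ContDiff ℝ ∞ f') (hg' : ContDiff ℝ ∞ g')
    (hT : SymTendsto l f f') (hT' : SymTendsto l g g') (y : Plane) :
    SymTendsto l (fun i => starIntegrand c ħ (f i) (g i) y) (starIntegrand c ħ f' g' y) := by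
  have sm : ∀ (ℓ : Plane × Plane →L[ℝ] Plane) {F : Plane → ℂ}, ContDiff ℝ ∞ F →
      ContDiff ℝ ∞ (fun z => F (ℓ z + y)) := fun ℓ F hF =>
    hF.comp (ℓ.contDiff.add contDiff_const)
  have h1 := hT.comp_affine (ContinuousLinearMap.fst ℝ Plane Plane) y hf hf'
  have h2 := hT'.comp_affine (ContinuousLinearMap.snd ℝ Plane Plane) y hg hg'
  have h3 := ((symTendsto_const l
    (fun _ : Plane × Plane => (((|c| / (Real.pi * ħ)) ^ 2 : ℝ) : ℂ))).mul h1
      (fun _ => contDiff_const) (fun i => sm _ (hf i)) contDiff_const (sm _ hf')).mul h2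
      (fun i => contDiff_const.mul (sm _ (hf i))) (fun i => sm _ (hg i))
      (contDiff_const.mul (sm _ hf')) (sm _ hg')
  simp only [add_comm _ y] at h3
  exact h3

variable {c ħ} (hc : c ≠ 0) (hħ : ħ ≠ 0)

include hc hħ

theorem hasStarValue_planeStar {f g : Plane → ℂ} (hf : IsOC f) (hg : IsOC g) (y : Plane) :
    HasStarValue c ħ f g y (planeStar c ħ f g y) := by
  obtain ⟨k, hf⟩ := hf
  obtain ⟨m, hg⟩ := hg
  exact hasOscIntegral_oscInt hc hħ (starIntegrand_unifSymbol_at c ħ hf hg y) ()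

omit hc hħ in
theorem HasStarValue.planeStar_eq {f g : Plane → ℂ} {y : Plane} {z : ℂ}
    (h : HasStarValue c ħ f g y z) : planeStar c ħ f g y = z :=
  HasOscIntegral.oscInt_eq h

theorem planeStar_bound (hf : UnifSymbol (fun y : Plane => (1 + ‖y‖ ^ 2) ^ k) f)
    (hg : UnifSymbol (fun y : Plane => (1 + ‖y‖ ^ 2) ^ m) g) :
    ∃ C : ℝ, ∀ i y, ‖planeStar c ħ (f i) (g i) y‖ ≤ C * (1 + ‖y‖ ^ 2) ^ (k + m) := by
  obtain ⟨C, hC⟩ := oscInt_bound hc hħ (starIntegrand_unifSymbol c ħ hf hg)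
  refine ⟨C, fun i y => ?_⟩
  have h0 : (0 : ℝ) < (1 + ‖y‖ ^ 2) ^ (k + m) := by positivity
  have h := hC (i, y)
  rw [((hasOscIntegral_oscInt hc hħ (starIntegrand_unifSymbol_at c ħ hf hg y) i).const_mul
    _).oscInt_eq, norm_mul, Complex.norm_real, Real.norm_of_nonneg (inv_nonneg.2 h0.le),
    inv_mul_le_iff₀ h0] at h
  rw [mul_comm]
  exact h

theorem planeStar_tendsto {l : Filter ι} [l.IsCountablyGenerated] {f' g' : Plane → ℂ}
    (hf : UnifSymbol (fun y : Plane => (1 + ‖y‖ ^ 2) ^ k) f)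
    (hg : UnifSymbol (fun y : Plane => (1 + ‖y‖ ^ 2) ^ m) g)
    (hf' : UnifSymbol (fun y : Plane => (1 + ‖y‖ ^ 2) ^ k) (fun _ : Unit => f'))
    (hg' : UnifSymbol (fun y : Plane => (1 + ‖y‖ ^ 2) ^ m) (fun _ : Unit => g'))
    (hT : SymTendsto l f f') (hT' : SymTendsto l g g') (y : Plane) :
    Tendsto (fun i => planeStar c ħ (f i) (g i) y) l (𝓝 (planeStar c ħ f' g' y)) :=
  oscInt_tendsto hc hħ (starIntegrand_unifSymbol_at c ħ hf hg y)
    (starIntegrand_unifSymbol_at c ħ hf' hg' y)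
    (starIntegrand_symTendsto c ħ hf.smooth hg.smooth (hf'.smooth ()) (hg'.smooth ()) hT hT' y)

theorem planeStar_add_left {f f' g : Plane → ℂ} (hf : IsOC f) (hf' : IsOC f') (hg : IsOC g)
    (y : Plane) : planeStar c ħ (fun y => f y + f' y) g y =
      planeStar c ħ f g y + planeStar c ħ f' g y := by
  apply HasStarValue.planeStar_eq
  have h := (hasStarValue_planeStar hc hħ hf hg y).add (hasStarValue_planeStar hc hħ hf' hg y)
  unfold HasStarValue
  convert h using 2
  ring

theorem planeStar_add_right {f g g' : Plane → ℂ} (hf : IsOC f) (hg : IsOC g) (hg' : IsOC g')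
    (y : Plane) : planeStar c ħ f (fun y => g y + g' y) y =
      planeStar c ħ f g y + planeStar c ħ f g' y := by
  apply HasStarValue.planeStar_eq
  have h := (hasStarValue_planeStar hc hħ hf hg y).add (hasStarValue_planeStar hc hħ hf hg' y)
  unfold HasStarValue
  convert h using 2
  ring

theorem planeStar_mul_left {f g : Plane → ℂ} (z : ℂ) (hf : IsOC f) (hg : IsOC g)
    (y : Plane) : planeStar c ħ (fun y => z * f y) g y = z * planeStar c ħ f g y := by
  apply HasStarValue.planeStar_eq
  have h := (hasStarValue_planeStar hc hħ hf hg y).const_mul z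
  unfold HasStarValue
  convert h using 2
  ring

theorem planeStar_mul_right {f g : Plane → ℂ} (z : ℂ) (hf : IsOC f) (hg : IsOC g)
    (y : Plane) : planeStar c ħ f (fun y => z * g y) y = z * planeStar c ħ f g y := by
  apply HasStarValue.planeStar_eq
  have h := (hasStarValue_planeStar hc hħ hf hg y).const_mul z
  unfold HasStarValue
  convert h using 2
  ring

omit hc hħ in
/-- Exchanging the two factors amounts to changing the sign of `ħ`. -/
theorem HasStarValue.swap {f g : Plane → ℂ} {y : Plane} {z : ℂ}
    (h : HasStarValue c (-ħ) g f y z) : HasStarValue c ħ f g y z := by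
  intro χ hχ
  let σ : (Plane × Plane) ≃L[ℝ] (Plane × Plane) := ContinuousLinearEquiv.prodComm ℝ Plane Plane
  let χ' : 𝓢(Plane × Plane, ℂ) := SchwartzMap.compCLMOfContinuousLinearEquiv ℝ σ χ
  have hχ' : ∀ p : Plane × Plane, χ' p = χ p.swap := fun p => rfl
  obtain ⟨h1, h2⟩ := h χ' (by rw [hχ']; simpa using hχ)
  have e : ∀ (ε : ℝ) (p : Plane × Plane), χ (ε • p) * ((((|c| / (Real.pi * ħ)) ^ 2 : ℝ) : ℂ) *
      f (y + p.1) * g (y + p.2)) *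
        Complex.exp (Complex.I * ((-(2 / ħ) * symp c p.1 p.2 : ℝ) : ℂ)) =
      χ' (ε • p.swap) * ((((|c| / (Real.pi * (-ħ))) ^ 2 : ℝ) : ℂ) *
      g (y + p.swap.1) * f (y + p.swap.2)) *
        Complex.exp (Complex.I * ((-(2 / (-ħ)) * symp c p.swap.1 p.swap.2 : ℝ) : ℂ)) := by
    intro ε p
    have e1 : (|c| / (Real.pi * (-ħ))) ^ 2 = (|c| / (Real.pi * ħ)) ^ 2 := by
      rw [mul_neg, div_neg, neg_sq]
    have e2 : -(2 / (-ħ)) * symp c p.swap.1 p.swap.2 = -(2 / ħ) * symp c p.1 p.2 := by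
      simp only [symp, Prod.fst_swap, Prod.snd_swap, div_neg]
      ring
    rw [hχ', e1, e2]
    simp only [Prod.smul_swap, Prod.swap_swap, Prod.fst_swap, Prod.snd_swap]
    ring
  simp only [e]
  refine ⟨fun ε hε => (h1 ε hε).swap, ?_⟩
  refine h2.congr fun ε => ?_
  exact (integral_prod_swap _).symm

end PlaneStar

/-! ### The unit of the star product -/

section Unit

open FourierTransform

/-- The rotation `(v₀, v₁) ↦ (v₁, -v₀)`, which turns the inner product into `dx⁰ ∧ dx¹`. -/
def rotJ : Plane ≃ₗᵢ[ℝ] Plane where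
  toFun v := !₂[v 1, -v 0]
  invFun v := !₂[-v 1, v 0]
  map_add' u v := by ext i; fin_cases i <;> simp; ring
  map_smul' r v := by ext i; fin_cases i <;> simp
  left_inv v := by ext i; fin_cases i <;> simp
  right_inv v := by ext i; fin_cases i <;> simp
  norm_map' v := by
    simp [EuclideanSpace.norm_eq, Fin.sum_univ_two, add_comm]

theorem rotJ_zero (v : Plane) : rotJ v 0 = v 1 := rfl

theorem rotJ_one (v : Plane) : rotJ v 1 = -v 0 := rfl

theorem inner_plane (u v : Plane) : inner ℝ u v = u 0 * v 0 + u 1 * v 1 := by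
  simp [PiLp.inner_apply, Fin.sum_univ_two, mul_comm]

theorem oscExp_eq (c ħ : ℝ) (u v : Plane) : oscExp c ħ (u, v) =
    Complex.exp (((-2 * Real.pi * inner ℝ u ((c / (Real.pi * ħ)) • rotJ v) : ℝ) : ℂ) *
      Complex.I) := by
  rw [oscExp, mul_comm]
  congr 3
  rw [inner_smul_right, inner_plane, rotJ_zero, rotJ_one]
  simp only [symp]
  have : Real.pi ≠ 0 := Real.pi_ne_zero
  by_cases h : ħ = 0
  · simp [h]
  · field_simp
    ring

theorem oscExp_smul_smul (c ħ : ℝ) {ε : ℝ} (hε : ε ≠ 0) (u v : Plane) :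
    oscExp c ħ (ε • u, ε⁻¹ • v) = oscExp c ħ (u, v) := by
  simp only [oscExp, symp]
  congr 4
  simp only [PiLp.smul_apply, smul_eq_mul]
  field_simp

theorem integral_schwartz_mul_oscExp (c ħ : ℝ) (ρ : 𝓢(Plane, ℂ)) (v : Plane) :
    ∫ u, ρ u * oscExp c ħ (u, v) = 𝓕 ρ ((c / (Real.pi * ħ)) • rotJ v) := by
  rw [SchwartzMap.fourier_coe, Real.fourier_eq']
  refine integral_congr_ae (Eventually.of_forall fun u => ?_)
  simp only [oscExp_eq, smul_eq_mul]
  ring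

theorem finrank_plane_eq : Module.finrank ℝ Plane = 2 := by simp

/-- Fourier inversion at the origin. -/
theorem integral_fourier_eq (ρ : 𝓢(Plane, ℂ)) : ∫ ξ, 𝓕 ρ ξ = ρ 0 := by
  have h : 𝓕⁻ (𝓕 ρ) = ρ := by simp
  have h0 := congrArg (fun f : 𝓢(Plane, ℂ) => f 0) h
  simp only [SchwartzMap.fourierInv_coe] at h0
  rw [Real.fourierInv_eq'] at h0
  simpa using h0

theorem integral_fourier_smul_rotJ (ρ : 𝓢(Plane, ℂ)) (τ : ℝ) :
    ∫ s : Plane, 𝓕 ρ (τ • rotJ s) = ((τ ^ 2)⁻¹ : ℝ) * ρ 0 := by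
  have h1 : ∫ s : Plane, 𝓕 ρ (τ • rotJ s) = ∫ s : Plane, 𝓕 ρ (τ • s) :=
    rotJ.measurePreserving.integral_comp' (f := rotJ.toHomeomorph.toMeasurableEquiv)
      (fun s : Plane => 𝓕 ρ (τ • s))
  rw [h1, Measure.integral_comp_smul volume (fun s => 𝓕 ρ s), integral_fourier_eq,
    finrank_plane_eq, abs_of_nonneg (by positivity)]
  simp

/-- A tensor square of Schwartz functions of compact support. -/
theorem exists_schwartz_tensor {ρ : 𝓢(Plane, ℂ)} (h : HasCompactSupport ρ) :
    ∃ χ : 𝓢(Plane × Plane, ℂ), ∀ p, χ p = ρ p.1 * ρ p.2 := by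
  have h1 : HasCompactSupport (fun p : Plane × Plane => ρ p.1 * ρ p.2) := by
    refine HasCompactSupport.of_support_subset_isCompact (IsCompact.prod h h) fun p hp => ?_
    have hp' := mul_ne_zero_iff.1 (Function.mem_support.1 hp)
    exact ⟨subset_tsupport _ hp'.1, subset_tsupport _ hp'.2⟩
  exact ⟨h1.toSchwartzMap ((ρ.smooth_infty.comp contDiff_fst).mul
    (ρ.smooth_infty.comp contDiff_snd)), fun p => rfl⟩

theorem isOC_const (z : ℂ) : IsOC (fun _ => z) :=
  ⟨0, by simpa using unifSymbol_const (V := Plane) (ι := Unit) z⟩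

variable {c ħ : ℝ}

/-- With a cutoff `ρ ⊗ ρ`, the integral over `u` is a rescaled Fourier transform of `ρ`, which
concentrates at `v = 0` as the cutoff is removed; Fourier inversion gives its total mass. -/
theorem planeStar_one_left (hc : c ≠ 0) (hħ : ħ ≠ 0) {g : Plane → ℂ} (hg : IsOC g) (y : Plane) :
    planeStar c ħ (fun _ => 1) g y = g y := by
  obtain ⟨ρ, hρ, hρc⟩ := exists_schwartz_one (V := Plane)
  obtain ⟨χ, hχ⟩ := exists_schwartz_tensor hρc
  have hs := hasStarValue_planeStar hc hħ (isOC_const 1) hg y χ (by rw [hχ]; simp [hρ])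
  obtain ⟨hI, hlim⟩ := hs
  obtain ⟨k, hg⟩ := hg
  set τ : ℝ := c / (Real.pi * ħ) with hτ
  have hτ0 : τ ≠ 0 := div_ne_zero hc (mul_ne_zero Real.pi_ne_zero hħ)
  have hK : (|c| / (Real.pi * ħ)) ^ 2 = τ ^ 2 := by rw [hτ, div_pow, div_pow, sq_abs]
  -- the substitution `(u, v) = (u' / ε, ε s)` preserves the phase
  have key : ∀ ε : ℝ, 0 < ε → ∫ p : Plane × Plane, χ (ε • p) *
      ((((|c| / (Real.pi * ħ)) ^ 2 : ℝ) : ℂ) * 1 * g (y + p.2)) *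
      Complex.exp (Complex.I * ((-(2 / ħ) * symp c p.1 p.2 : ℝ) : ℂ)) =
      ∫ s : Plane, ρ ((ε ^ 2) • s) * ((τ ^ 2 : ℝ) * g (y + ε • s)) * 𝓕 ρ (τ • rotJ s) := by
    intro ε hε
    have hε2 : ((ε ^ 2 : ℝ) : ℂ) ≠ 0 := by exact_mod_cast (pow_pos hε 2).ne'
    refine (integral_prod_symm _ (hI ε hε)).trans ?_
    have inner : ∀ v : Plane, ∫ u : Plane, χ (ε • (u, v)) *
        ((((|c| / (Real.pi * ħ)) ^ 2 : ℝ) : ℂ) * 1 * g (y + v)) *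
        Complex.exp (Complex.I * ((-(2 / ħ) * symp c u v : ℝ) : ℂ)) =
        ρ (ε • v) * ((τ ^ 2 : ℝ) * g (y + v)) *
          (((ε ^ 2)⁻¹ : ℝ) * 𝓕 ρ (τ • rotJ (ε⁻¹ • v))) := by
      intro v
      have h1 : ∫ u : Plane, ρ (ε • u) * oscExp c ħ (u, v) =
          ((ε ^ 2)⁻¹ : ℝ) * 𝓕 ρ (τ • rotJ (ε⁻¹ • v)) := by
        have h2 := Measure.integral_comp_smul (volume : Measure Plane)
          (fun u => ρ u * oscExp c ħ (u, ε⁻¹ • v)) ε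
        simp only [oscExp_smul_smul c ħ hε.ne'] at h2
        rw [h2, integral_schwartz_mul_oscExp, finrank_plane_eq, abs_of_nonneg (by positivity)]
        simp [hτ]
      rw [← h1, ← integral_const_mul]
      refine integral_congr_ae (Eventually.of_forall fun u => ?_)
      simp only [hχ, hK, oscExp, Prod.smul_mk]
      ring
    simp only [inner]
    have h3 := Measure.integral_comp_smul (volume : Measure Plane)
      (fun s : Plane => ρ ((ε ^ 2) • s) * ((τ ^ 2 : ℝ) * g (y + ε • s)) *
        (((ε ^ 2)⁻¹ : ℝ) * 𝓕 ρ (τ • rotJ s))) ε⁻¹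
    have e1 : ∀ v : Plane, (ε ^ 2) • ε⁻¹ • v = ε • v := fun v => by
      rw [smul_smul]; congr 1; field_simp
    have e2 : ∀ v : Plane, ε • ε⁻¹ • v = v := fun v => smul_inv_smul₀ hε.ne' v
    simp only [e1, e2] at h3
    rw [h3, finrank_plane_eq, inv_pow, inv_inv, abs_of_nonneg (by positivity),
      Complex.real_smul, ← integral_const_mul]
    refine integral_congr_ae (Eventually.of_forall fun s => ?_)
    simp only [Complex.ofReal_inv]
    field_simp
  have hlim2 : Tendsto (fun ε : ℝ => ∫ s : Plane, ρ ((ε ^ 2) • s) *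
      ((τ ^ 2 : ℝ) * g (y + ε • s)) * 𝓕 ρ (τ • rotJ s)) (𝓝[>] 0)
      (𝓝 (∫ s : Plane, ρ ((0 : ℝ) • s) * ((τ ^ 2 : ℝ) * g (y + (0 : ℝ) • s)) *
        𝓕 ρ (τ • rotJ s))) := by
    obtain ⟨Cρ, hCρ⟩ := ρ.exists_bound 0
    obtain ⟨Cg, hCg⟩ := hg.bound []
    let T : Plane ≃L[ℝ] Plane := rotJ.toContinuousLinearEquiv.trans
      (ContinuousLinearEquiv.smulLeft (Units.mk0 τ hτ0))
    obtain ⟨CG, hCG⟩ := (SchwartzMap.compCLMOfContinuousLinearEquiv ℝ T (𝓕 ρ)).exists_bound (k + 3)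
    have hCG' : ∀ s : Plane, ‖𝓕 ρ (τ • rotJ s)‖ ≤ CG * ((1 + ‖s‖ ^ 2) ^ (k + 3))⁻¹ := hCG
    have cg : Continuous g := (hg.smooth ()).continuous
    have cF : Continuous (fun s : Plane => 𝓕 ρ (τ • rotJ s)) :=
      (𝓕 ρ).continuous.comp (rotJ.continuous.const_smul τ)
    refine tendsto_integral_filter_of_dominated_convergence
      (fun s => (Cρ * (‖((τ ^ 2 : ℝ) : ℂ)‖ * (|Cg| * (2 ^ k * (1 + ‖y‖ ^ 2) ^ k))) * CG) *
        intWeight s) ?_ ?_ ?_ ?_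
    · refine Eventually.of_forall fun ε => Continuous.aestronglyMeasurable ?_
      have := ρ.continuous
      fun_prop
    · have hev : ∀ᶠ ε : ℝ in 𝓝[>] 0, ε < 1 := nhdsWithin_le_nhds (gt_mem_nhds zero_lt_one)
      filter_upwards [self_mem_nhdsWithin, hev] with ε hε hε1
      have hε : 0 < ε := hε
      refine Eventually.of_forall fun s => ?_
      have b1 : ‖ρ ((ε ^ 2) • s)‖ ≤ Cρ := by simpa using hCρ ((ε ^ 2) • s)
      have b2 : ‖g (y + ε • s)‖ ≤ |Cg| * (2 ^ k * (1 + ‖y‖ ^ 2) ^ k) * (1 + ‖s‖ ^ 2) ^ k := by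
        have hes : ‖ε • s‖ ≤ ‖s‖ := by
          rw [norm_smul, Real.norm_of_nonneg hε.le]
          exact mul_le_of_le_one_left (norm_nonneg _) hε1.le
        calc ‖g (y + ε • s)‖ ≤ Cg * (1 + ‖y + ε • s‖ ^ 2) ^ k := hCg () _
          _ ≤ |Cg| * (2 ^ k * ((1 + ‖y‖ ^ 2) ^ k * (1 + ‖s‖ ^ 2) ^ k)) := by
            refine mul_le_mul (le_abs_self _) ?_ (by positivity) (abs_nonneg _)
            refine (peetre_pow y (ε • s) k).trans ?_
            gcongr
          _ = _ := by ring
      have hw : (1 + ‖s‖ ^ 2) ^ k * ((1 + ‖s‖ ^ 2) ^ (k + 3))⁻¹ = intWeight s := by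
        have h0 : (0 : ℝ) < 1 + ‖s‖ ^ 2 := by positivity
        rw [intWeight, pow_add]
        field_simp
      have hCρ0 : 0 ≤ Cρ := (norm_nonneg _).trans b1
      rw [norm_mul, norm_mul, norm_mul]
      calc ‖ρ ((ε ^ 2) • s)‖ * (‖((τ ^ 2 : ℝ) : ℂ)‖ * ‖g (y + ε • s)‖) * ‖𝓕 ρ (τ • rotJ s)‖
          ≤ Cρ * (‖((τ ^ 2 : ℝ) : ℂ)‖ * (|Cg| * (2 ^ k * (1 + ‖y‖ ^ 2) ^ k) *
            (1 + ‖s‖ ^ 2) ^ k)) * (CG * ((1 + ‖s‖ ^ 2) ^ (k + 3))⁻¹) := by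
            refine mul_le_mul ?_ (hCG' s) (norm_nonneg _) (by positivity)
            gcongr
        _ = _ := by rw [← hw]; ring
    · exact (integrable_intWeight volume (by rw [finrank_plane_eq]; norm_num)).const_mul _
    · refine Eventually.of_forall fun s => ?_
      have hcont : Continuous (fun ε : ℝ => ρ ((ε ^ 2) • s) * ((τ ^ 2 : ℝ) * g (y + ε • s)) *
          𝓕 ρ (τ • rotJ s)) := by
        have := ρ.continuous
        fun_prop
      have := hcont.tendsto 0
      simp only [ne_eq, OfNat.ofNat_ne_zero, not_false_eq_true, zero_pow] at this
      exact this.mono_left nhdsWithin_le_nhds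
  have hval : ∫ s : Plane, ρ ((0 : ℝ) • s) * ((τ ^ 2 : ℝ) * g (y + (0 : ℝ) • s)) *
      𝓕 ρ (τ • rotJ s) = g y := by
    simp only [zero_smul, add_zero, hρ, one_mul]
    rw [integral_const_mul, integral_fourier_smul_rotJ, hρ]
    have : ((τ : ℝ) : ℂ) ≠ 0 := by exact_mod_cast hτ0
    push_cast
    field_simp
  rw [hval] at hlim2
  refine tendsto_nhds_unique (hlim.congr' ?_) hlim2
  filter_upwards [self_mem_nhdsWithin] with ε hε
  exact key ε hε

theorem planeStar_one_right (hc : c ≠ 0) (hħ : ħ ≠ 0) {f : Plane → ℂ} (hf : IsOC f)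
    (y : Plane) : planeStar c ħ f (fun _ => 1) y = f y := by
  apply HasStarValue.planeStar_eq
  apply HasStarValue.swap
  have h := hasStarValue_planeStar hc (neg_ne_zero.2 hħ) (isOC_const 1) hf y
  rwa [planeStar_one_left hc (neg_ne_zero.2 hħ) hf] at h

end Unit

/-! ### Derivatives of the fibrewise star product -/

section FibStar

/-- Functions of `(x, y)` each of whose derivatives is, fibrewise in `x`, a bounded family in
`𝒪_C(ℝ²)`. -/
structure IsFibreOC (F : Plane × Plane → ℂ) : Prop where
  smooth : ContDiff ℝ ∞ F
  bound : ∀ L : List (Plane × Plane), ∃ k : ℕ, UnifSymbol (fun y : Plane => (1 + ‖y‖ ^ 2) ^ k)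
    (fun x y => dirDerivs L F (x, y))

/-- The function and its first derivatives are bounded in the same step of the inductive limit
`𝒪_C(ℝ²)`. -/
structure IsFibreC1 (k : ℕ) (F : Plane × Plane → ℂ) : Prop where
  smooth : ContDiff ℝ ∞ F
  bound : UnifSymbol (fun y : Plane => (1 + ‖y‖ ^ 2) ^ k) (fun x y => F (x, y))
  bound_deriv : ∀ v, UnifSymbol (fun y : Plane => (1 + ‖y‖ ^ 2) ^ k)
    (fun x y => dirDeriv v F (x, y))

theorem dirDeriv_fibre (w : Plane) {F : Plane × Plane → ℂ} (hF : ContDiff ℝ ∞ F) (x : Plane) :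
    dirDeriv w (fun y => F (x, y)) = fun y => dirDeriv (0, w) F (x, y) := by
  have h := dirDeriv_comp_add_const w (ContinuousLinearMap.inr ℝ Plane Plane) (x, 0) hF
  simpa using h

theorem dirDerivs_fibre (L : List Plane) {F : Plane × Plane → ℂ} (hF : ContDiff ℝ ∞ F)
    (x : Plane) : dirDerivs L (fun y => F (x, y)) =
      fun y => dirDerivs (L.map fun w => ((0, w) : Plane × Plane)) F (x, y) := by
  have h := dirDerivs_comp_add_const L (ContinuousLinearMap.inr ℝ Plane Plane) (x, 0) hF
  simp only [ContinuousLinearMap.inr_apply, Prod.mk_add_mk, add_zero, zero_add] at h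
  exact h

theorem prod_expand (v : Plane × Plane) : v = v.1 0 • ((basisVec 0, 0) : Plane × Plane) +
    v.1 1 • ((basisVec 1, 0) : Plane × Plane) + (v.2 0 • ((0, basisVec 0) : Plane × Plane) +
      v.2 1 • ((0, basisVec 1) : Plane × Plane)) := by
  refine Prod.ext ?_ ?_ <;> ext i <;> fin_cases i <;> simp

theorem dirDeriv_expand (v : Plane × Plane) (F : Plane × Plane → ℂ) :
    dirDeriv v F = fun q => (v.1 0 : ℂ) * dirDeriv (basisVec 0, 0) F q +
      (v.1 1 : ℂ) * dirDeriv (basisVec 1, 0) F q + ((v.2 0 : ℂ) * dirDeriv (0, basisVec 0) F q +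
        (v.2 1 : ℂ) * dirDeriv (0, basisVec 1) F q) := by
  funext q
  conv_lhs => rw [prod_expand v]
  simp only [dirDeriv, map_add, map_smul, Complex.real_smul]

theorem abs_coord_le (v : Plane) (i : Fin 2) : |v i| ≤ ‖v‖ := by
  simpa using PiLp.norm_apply_le v i

variable {F G : Plane × Plane → ℂ} {k m : ℕ}

theorem IsFibreOC.dirDeriv (hF : IsFibreOC F) (v : Plane × Plane) : IsFibreOC (dirDeriv v F) :=
  ⟨dirDeriv_smooth v hF.smooth, fun L => hF.bound (v :: L)⟩

theorem IsFibreOC.isOC (hF : IsFibreOC F) (x : Plane) : IsOC (fun y => F (x, y)) := by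
  obtain ⟨k, hk⟩ := hF.bound []
  exact ⟨k, hk.reindex fun _ => x⟩

theorem IsFibreOC.exists_isFibreC1 (hF : IsFibreOC F) : ∃ k, IsFibreC1 k F := by
  obtain ⟨k, hk⟩ := hF.bound []
  obtain ⟨k₁, h₁⟩ := hF.bound [(basisVec 0, 0)]
  obtain ⟨k₂, h₂⟩ := hF.bound [(basisVec 1, 0)]
  obtain ⟨k₃, h₃⟩ := hF.bound [(0, basisVec 0)]
  obtain ⟨k₄, h₄⟩ := hF.bound [(0, basisVec 1)]
  refine ⟨k + k₁ + k₂ + k₃ + k₄, hF.smooth, hk.mono_pow (by omega), fun v => ?_⟩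
  have hW : ∀ y : Plane, (0 : ℝ) ≤ (1 + ‖y‖ ^ 2) ^ (k + k₁ + k₂ + k₃ + k₄) :=
    fun y => by positivity
  have a₁ := (h₁.mono_pow (k' := k + k₁ + k₂ + k₃ + k₄) (by omega)).const_mul hW
    (c := fun _ => (v.1 0 : ℂ)) fun _ => le_rfl
  have a₂ := (h₂.mono_pow (k' := k + k₁ + k₂ + k₃ + k₄) (by omega)).const_mul hW
    (c := fun _ => (v.1 1 : ℂ)) fun _ => le_rfl
  have a₃ := (h₃.mono_pow (k' := k + k₁ + k₂ + k₃ + k₄) (by omega)).const_mul hW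
    (c := fun _ => (v.2 0 : ℂ)) fun _ => le_rfl
  have a₄ := (h₄.mono_pow (k' := k + k₁ + k₂ + k₃ + k₄) (by omega)).const_mul hW
    (c := fun _ => (v.2 1 : ℂ)) fun _ => le_rfl
  have h := (a₁.add a₂).add (a₃.add a₄)
  simp only [dirDeriv_expand v]
  exact h

theorem IsFibreC1.dirDeriv_fibre (hF : IsFibreC1 k F) (w : Plane) :
    IsFibreC1 k (dirDeriv (0, w) F) := by
  refine ⟨dirDeriv_smooth _ hF.smooth, hF.bound_deriv _, fun v => ?_⟩
  have h := (hF.bound_deriv v).dirDeriv w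
  simp only [_root_.dirDeriv_fibre w (dirDeriv_smooth v hF.smooth)] at h
  rwa [dirDeriv_comm v _ hF.smooth]

theorem IsFibreC1.exists_deriv_bound (hF : IsFibreC1 k F) :
    ∃ C : ℝ, 0 ≤ C ∧ (∀ q, ‖F q‖ ≤ C * (1 + ‖q.2‖ ^ 2) ^ k) ∧
      ∀ v q, ‖dirDeriv v F q‖ ≤ ‖v‖ * (C * (1 + ‖q.2‖ ^ 2) ^ k) := by
  obtain ⟨C₀, h₀⟩ := hF.bound.bound []
  obtain ⟨C₁, h₁⟩ := (hF.bound_deriv (basisVec 0, 0)).bound []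
  obtain ⟨C₂, h₂⟩ := (hF.bound_deriv (basisVec 1, 0)).bound []
  obtain ⟨C₃, h₃⟩ := (hF.bound_deriv (0, basisVec 0)).bound []
  obtain ⟨C₄, h₄⟩ := (hF.bound_deriv (0, basisVec 1)).bound []
  refine ⟨|C₀| + (|C₁| + |C₂| + (|C₃| + |C₄|)), by positivity, fun q => ?_, fun v q => ?_⟩
  · refine (h₀ q.1 q.2).trans (mul_le_mul_of_nonneg_right ?_ (by positivity))
    exact (le_abs_self C₀).trans (le_add_of_nonneg_right (by positivity))
  · have key : ∀ {t : ℝ} {u : ℂ} {C : ℝ}, |t| ≤ ‖v‖ → ‖u‖ ≤ C * (1 + ‖q.2‖ ^ 2) ^ k →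
        ‖(t : ℂ) * u‖ ≤ ‖v‖ * (|C| * (1 + ‖q.2‖ ^ 2) ^ k) := by
      intro t u C ht hu
      rw [norm_mul, Complex.norm_real]
      refine mul_le_mul ht (hu.trans ?_) (norm_nonneg _) (norm_nonneg _)
      exact mul_le_mul_of_nonneg_right (le_abs_self C) (by positivity)
    have n1 : ‖v.1‖ ≤ ‖v‖ := norm_fst_le v
    have n2 : ‖v.2‖ ≤ ‖v‖ := norm_snd_le v
    rw [dirDeriv_expand]
    calc _ ≤ (‖v‖ * (|C₁| * (1 + ‖q.2‖ ^ 2) ^ k) + ‖v‖ * (|C₂| * (1 + ‖q.2‖ ^ 2) ^ k)) +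
          (‖v‖ * (|C₃| * (1 + ‖q.2‖ ^ 2) ^ k) + ‖v‖ * (|C₄| * (1 + ‖q.2‖ ^ 2) ^ k)) := by
          refine norm_add_le_of_le (norm_add_le_of_le ?_ ?_) (norm_add_le_of_le ?_ ?_)
          · exact key ((abs_coord_le _ _).trans n1) (h₁ q.1 q.2)
          · exact key ((abs_coord_le _ _).trans n1) (h₂ q.1 q.2)
          · exact key ((abs_coord_le _ _).trans n2) (h₃ q.1 q.2)
          · exact key ((abs_coord_le _ _).trans n2) (h₄ q.1 q.2)
      _ ≤ _ := by
          have : 0 ≤ ‖v‖ * (|C₀| * (1 + ‖q.2‖ ^ 2) ^ k) := by positivity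
          linarith

/-- Growth and Lipschitz bounds for increments of length at most one. -/
theorem IsFibreC1.exists_increment_bound (hF : IsFibreC1 k F) :
    ∃ C : ℝ, 0 ≤ C ∧ (∀ q h, ‖h‖ ≤ 1 → ‖F (q + h)‖ ≤ C * (1 + ‖q.2‖ ^ 2) ^ k) ∧
      (∀ q h, ‖h‖ ≤ 1 → ‖F (q + h) - F q‖ ≤ ‖h‖ * (C * (1 + ‖q.2‖ ^ 2) ^ k)) ∧
      ∀ v q, ‖dirDeriv v F q‖ ≤ ‖v‖ * (C * (1 + ‖q.2‖ ^ 2) ^ k) := by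
  obtain ⟨C, hC, h0, h1⟩ := hF.exists_deriv_bound
  have hw : ∀ q h : Plane × Plane, ‖h‖ ≤ 1 →
      (1 + ‖(q + h).2‖ ^ 2) ^ k ≤ 4 ^ k * (1 + ‖q.2‖ ^ 2) ^ k := by
    intro q h hh
    rw [← mul_pow]
    refine pow_le_pow_left₀ (by positivity) ((peetre q.2 h.2).trans ?_) k
    have : ‖h.2‖ ^ 2 ≤ 1 := pow_le_one₀ (norm_nonneg _) ((norm_snd_le h).trans hh)
    nlinarith [sq_nonneg ‖q.2‖]
  have hCC : ∀ q h : Plane × Plane, ‖h‖ ≤ 1 →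
      C * (1 + ‖(q + h).2‖ ^ 2) ^ k ≤ C * 4 ^ k * (1 + ‖q.2‖ ^ 2) ^ k := fun q h hh => by
    rw [mul_assoc]; exact mul_le_mul_of_nonneg_left (hw q h hh) hC
  refine ⟨C * 4 ^ k, by positivity, fun q h hh => (h0 _).trans (hCC q h hh),
    fun q h hh => ?_, fun v q => (h1 v q).trans ?_⟩
  · have hseg := (convex_segment (𝕜 := ℝ) q (q + h)).norm_image_sub_le_of_norm_fderiv_le
      (f := F) (C := C * 4 ^ k * (1 + ‖q.2‖ ^ 2) ^ k)
      (fun x _ => hF.smooth.differentiableAt_infty x) (fun x hx => by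
        obtain ⟨t, ht, rfl⟩ := (segment_eq_image' ℝ q (q + h)).subset hx
        refine ContinuousLinearMap.opNorm_le_bound _ (by positivity) fun v => ?_
        rw [mul_comm]
        refine (h1 v _).trans (mul_le_mul_of_nonneg_left (hCC q _ ?_) (norm_nonneg _))
        rw [add_sub_cancel_left, norm_smul, Real.norm_of_nonneg ht.1]
        exact mul_le_one₀ ht.2 (norm_nonneg _) hh)
      (left_mem_segment ℝ q (q + h)) (right_mem_segment ℝ q (q + h))
    rw [add_sub_cancel_left, mul_comm] at hseg
    exact hseg
  · have h4 : (1 : ℝ) ≤ 4 ^ k := one_le_pow₀ (by norm_num)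
    refine mul_le_mul_of_nonneg_left (mul_le_mul_of_nonneg_right ?_ (by positivity))
      (norm_nonneg _)
    exact le_mul_of_one_le_right hC h4

variable (c ħ : ℝ)

/-- The fibrewise star product. -/
def fibStar (F G : Plane × Plane → ℂ) (p : Plane × Plane) : ℂ :=
  planeStar c ħ (fun y => F (p.1, y)) (fun y => G (p.1, y)) p.2

/-- The amplitude of the oscillatory integral that defines the fibrewise star product at `p`. -/
def fibIntegrand (F G : Plane × Plane → ℂ) (p z : Plane × Plane) : ℂ :=
  (((|c| / (Real.pi * ħ)) ^ 2 : ℝ) : ℂ) * F (p + (0, z.1)) * G (p + (0, z.2))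

theorem starIntegrand_fibre (F G : Plane × Plane → ℂ) (p : Plane × Plane) :
    starIntegrand c ħ (fun y => F (p.1, y)) (fun y => G (p.1, y)) p.2 = fibIntegrand c ħ F G p := by
  funext z
  simp [starIntegrand, fibIntegrand, Prod.add_def]

theorem fibIntegrand_smooth (hF : ContDiff ℝ ∞ F) (hG : ContDiff ℝ ∞ G) (p : Plane × Plane) :
    ContDiff ℝ ∞ (fibIntegrand c ħ F G p) :=
  (contDiff_const.mul (hF.comp (contDiff_const.add (contDiff_const.prodMk contDiff_fst)))).mul
    (hG.comp (contDiff_const.add (contDiff_const.prodMk contDiff_snd)))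

theorem dirDeriv_fibIntegrand (hF : ContDiff ℝ ∞ F) (hG : ContDiff ℝ ∞ G)
    (p w : Plane × Plane) : dirDeriv w (fibIntegrand c ħ F G p) = fun z =>
      fibIntegrand c ħ (dirDeriv (0, w.1) F) G p z +
        fibIntegrand c ħ F (dirDeriv (0, w.2) G) p z := by
  have s : ∀ (ℓ : Plane × Plane →L[ℝ] Plane) {F : Plane × Plane → ℂ}, ContDiff ℝ ∞ F →
      ContDiff ℝ ∞ (fun z => F (p + (0, ℓ z))) := fun ℓ F hF =>
    hF.comp (contDiff_const.add (contDiff_const.prodMk ℓ.contDiff))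
  have d : ∀ (ℓ : Plane × Plane →L[ℝ] Plane) {F : Plane × Plane → ℂ}, ContDiff ℝ ∞ F →
      dirDeriv w (fun z => F (p + (0, ℓ z))) =
        fun z => dirDeriv (0, ℓ w) F (p + (0, ℓ z)) := fun ℓ F hF => by
    have := dirDeriv_comp_add_const w ((ContinuousLinearMap.inr ℝ Plane Plane).comp ℓ) p hF
    simpa [add_comm p] using this
  have h1 := dirDeriv_mul w (contDiff_const (c := (((|c| / (Real.pi * ħ)) ^ 2 : ℝ) : ℂ)).mul
    (s (ContinuousLinearMap.fst ℝ Plane Plane) hF)) (s (ContinuousLinearMap.snd ℝ Plane Plane) hG)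
  rw [dirDeriv_const_mul w _ (s _ hF), d _ hF, d _ hG] at h1
  exact h1

/-- The remainder of the first order Taylor expansion at `p` of the amplitude, divided by the length
of the increment `h` (and cut off at length one). -/
def fibRemainder (F G : Plane × Plane → ℂ) (p h z : Plane × Plane) : ℂ :=
  ((if ‖h‖ ≤ 1 then ‖h‖⁻¹ else 0 : ℝ) : ℂ) *
    (fibIntegrand c ħ F G (p + h) z + (-1) * (fibIntegrand c ħ F G p z +
      (fibIntegrand c ħ (dirDeriv h F) G p z + fibIntegrand c ħ F (dirDeriv h G) p z)))

theorem fibRemainder_smooth (hF : ContDiff ℝ ∞ F) (hG : ContDiff ℝ ∞ G) (p h : Plane × Plane) :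
    ContDiff ℝ ∞ (fibRemainder c ħ F G p h) :=
  contDiff_const.mul ((fibIntegrand_smooth c ħ hF hG _).add (contDiff_const.mul
    ((fibIntegrand_smooth c ħ hF hG _).add
      ((fibIntegrand_smooth c ħ (dirDeriv_smooth h hF) hG _).add
      (fibIntegrand_smooth c ħ hF (dirDeriv_smooth h hG) _)))))

theorem dirDeriv_fibRemainder (hF : ContDiff ℝ ∞ F) (hG : ContDiff ℝ ∞ G)
    (p h w : Plane × Plane) : dirDeriv w (fibRemainder c ħ F G p h) = fun z =>
      fibRemainder c ħ (dirDeriv (0, w.1) F) G p h z +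
        fibRemainder c ħ F (dirDeriv (0, w.2) G) p h z := by
  have s := fun {F G : Plane × Plane → ℂ} (hF : ContDiff ℝ ∞ F) (hG : ContDiff ℝ ∞ G) p =>
    fibIntegrand_smooth c ħ hF hG p
  have hF' := dirDeriv_smooth h hF
  have hG' := dirDeriv_smooth h hG
  unfold fibRemainder
  rw [dirDeriv_const_mul w _ ((s hF hG _).add (contDiff_const.mul
      ((s hF hG _).add ((s hF' hG _).add (s hF hG' _))))),
    dirDeriv_add w (s hF hG _)
      (contDiff_const.mul ((s hF hG _).add ((s hF' hG _).add (s hF hG' _)))),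
    dirDeriv_const_mul w _ ((s hF hG _).add ((s hF' hG _).add (s hF hG' _))),
    dirDeriv_add w (s hF hG _) ((s hF' hG _).add (s hF hG' _)),
    dirDeriv_add w (s hF' hG _) (s hF hG' _), dirDeriv_fibIntegrand c ħ hF hG,
    dirDeriv_fibIntegrand c ħ hF hG, dirDeriv_fibIntegrand c ħ hF' hG,
    dirDeriv_fibIntegrand c ħ hF hG', dirDeriv_comm (0, w.1) h hF, dirDeriv_comm (0, w.2) h hG]
  funext z
  ring

/-- The remainders are bounded symbols uniformly in the increment, because the numerator is at most
linear in it. -/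
theorem fibRemainder_unifSymbol (hF : IsFibreC1 k F) (hG : IsFibreC1 m G) (p : Plane × Plane) :
    UnifSymbol (fun z : Plane × Plane => (1 + ‖z‖ ^ 2) ^ (k + m))
      (fun h => fibRemainder c ħ F G p h) := by
  refine ⟨fun h => fibRemainder_smooth c ħ hF.smooth hG.smooth p h, fun L => ?_⟩
  induction L generalizing F G with
  | cons w L ih =>
    obtain ⟨C, hC⟩ := ih (hF.dirDeriv_fibre w.1) hG
    obtain ⟨D, hD⟩ := ih hF (hG.dirDeriv_fibre w.2)
    refine ⟨C + D, fun h z => ?_⟩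
    rw [dirDerivs, dirDeriv_fibRemainder c ħ hF.smooth hG.smooth, dirDerivs_add L
      (fibRemainder_smooth c ħ (dirDeriv_smooth _ hF.smooth) hG.smooth p h)
      (fibRemainder_smooth c ħ hF.smooth (dirDeriv_smooth _ hG.smooth) p h), add_mul]
    exact norm_add_le_of_le (hC h z) (hD h z)
  | nil =>
    obtain ⟨C, hC, f0, f1, f2⟩ := hF.exists_increment_bound
    obtain ⟨D, hD, g0, g1, g2⟩ := hG.exists_increment_bound
    set K : ℂ := (((|c| / (Real.pi * ħ)) ^ 2 : ℝ) : ℂ) with hK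
    refine ⟨‖K‖ * (4 * (C * D)) * (2 ^ k * 2 ^ m * ((1 + ‖p.2‖ ^ 2) ^ k * (1 + ‖p.2‖ ^ 2) ^ m)),
      fun h z => ?_⟩
    set q₁ : Plane × Plane := p + (0, z.1) with hq₁
    set q₂ : Plane × Plane := p + (0, z.2) with hq₂
    have e : fibRemainder c ħ F G p h z = ((if ‖h‖ ≤ 1 then ‖h‖⁻¹ else 0 : ℝ) : ℂ) * (K *
        ((F (q₁ + h) - F q₁) * G (q₂ + h) + F q₁ * (G (q₂ + h) - G q₂) +
          (-(dirDeriv h F q₁ * G q₂) - F q₁ * dirDeriv h G q₂))) := by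
      simp only [fibRemainder, fibIntegrand, add_right_comm p h, ← hq₁, ← hq₂, ← hK]
      ring
    change ‖fibRemainder c ħ F G p h z‖ ≤ _
    rw [e]
    have hw : ∀ (u : Plane) (k : ℕ), ‖u‖ ≤ ‖z‖ → (1 + ‖(p + ((0 : Plane), u)).2‖ ^ 2) ^ k ≤
        2 ^ k * ((1 + ‖p.2‖ ^ 2) ^ k * (1 + ‖z‖ ^ 2) ^ k) := by
      intro u k hu
      refine (peetre_pow p.2 u k).trans ?_
      gcongr
    have w1 := hw z.1 k (norm_fst_le z)
    have w2 := hw z.2 m (norm_snd_le z)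
    rw [← hq₁] at w1
    rw [← hq₂] at w2
    set A : ℝ := (1 + ‖q₁.2‖ ^ 2) ^ k with hA
    set B : ℝ := (1 + ‖q₂.2‖ ^ 2) ^ m with hB
    have hA0 : 0 ≤ A := by positivity
    have hB0 : 0 ≤ B := by positivity
    have F0 : ‖F q₁‖ ≤ C * A := by simpa using f0 q₁ 0 (by simp)
    have G0 : ‖G q₂‖ ≤ D * B := by simpa using g0 q₂ 0 (by simp)
    have hmain : ‖h‖ ≤ 1 → ‖(F (q₁ + h) - F q₁) * G (q₂ + h) + F q₁ * (G (q₂ + h) - G q₂) +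
          (-(dirDeriv h F q₁ * G q₂) - F q₁ * dirDeriv h G q₂)‖ ≤
        ‖h‖ * (4 * (C * D) * (A * B)) := by
      intro hh
      have t1 : ‖(F (q₁ + h) - F q₁) * G (q₂ + h)‖ ≤ (‖h‖ * (C * A)) * (D * B) := by
        rw [norm_mul]
        exact mul_le_mul (f1 q₁ h hh) (g0 q₂ h hh) (norm_nonneg _) (by positivity)
      have t2 : ‖F q₁ * (G (q₂ + h) - G q₂)‖ ≤ (C * A) * (‖h‖ * (D * B)) := by
        rw [norm_mul]
        exact mul_le_mul F0 (g1 q₂ h hh) (norm_nonneg _) (by positivity)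
      have t3 : ‖-(dirDeriv h F q₁ * G q₂)‖ ≤ (‖h‖ * (C * A)) * (D * B) := by
        rw [norm_neg, norm_mul]
        exact mul_le_mul (f2 h q₁) G0 (norm_nonneg _) (by positivity)
      have t4 : ‖F q₁ * dirDeriv h G q₂‖ ≤ (C * A) * (‖h‖ * (D * B)) := by
        rw [norm_mul]
        exact mul_le_mul F0 (g2 h q₂) (norm_nonneg _) (by positivity)
      calc _ ≤ ((‖h‖ * (C * A)) * (D * B) + (C * A) * (‖h‖ * (D * B))) +
            ((‖h‖ * (C * A)) * (D * B) + (C * A) * (‖h‖ * (D * B))) :=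
            norm_add_le_of_le (norm_add_le_of_le t1 t2) (norm_sub_le_of_le t3 t4)
        _ = _ := by ring
    have hAB : A * B ≤ 2 ^ k * 2 ^ m * ((1 + ‖p.2‖ ^ 2) ^ k * (1 + ‖p.2‖ ^ 2) ^ m) *
        (1 + ‖z‖ ^ 2) ^ (k + m) := by
      calc A * B ≤ (2 ^ k * ((1 + ‖p.2‖ ^ 2) ^ k * (1 + ‖z‖ ^ 2) ^ k)) *
            (2 ^ m * ((1 + ‖p.2‖ ^ 2) ^ m * (1 + ‖z‖ ^ 2) ^ m)) :=
            mul_le_mul w1 w2 hB0 (by positivity)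
        _ = _ := by ring
    have final : ‖K‖ * (4 * (C * D) * (A * B)) ≤ ‖K‖ * (4 * (C * D)) *
        (2 ^ k * 2 ^ m * ((1 + ‖p.2‖ ^ 2) ^ k * (1 + ‖p.2‖ ^ 2) ^ m)) *
        (1 + ‖z‖ ^ 2) ^ (k + m) := by
      calc ‖K‖ * (4 * (C * D) * (A * B)) = ‖K‖ * (4 * (C * D)) * (A * B) := by ring
        _ ≤ ‖K‖ * (4 * (C * D)) * (2 ^ k * 2 ^ m * ((1 + ‖p.2‖ ^ 2) ^ k * (1 + ‖p.2‖ ^ 2) ^ m) *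
            (1 + ‖z‖ ^ 2) ^ (k + m)) := mul_le_mul_of_nonneg_left hAB (by positivity)
        _ = _ := by ring
    refine le_trans ?_ final
    rw [norm_mul, norm_mul, Complex.norm_real]
    split_ifs with hh
    · have hinv : ‖h‖⁻¹ * ‖h‖ ≤ 1 := by
        rcases eq_or_ne ‖h‖ 0 with h0 | h0
        · simp [h0]
        · rw [inv_mul_cancel₀ h0]
      rw [norm_inv, norm_norm]
      calc ‖h‖⁻¹ * (‖K‖ * _) ≤ ‖h‖⁻¹ * (‖K‖ * (‖h‖ * (4 * (C * D) * (A * B)))) := by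
            gcongr; exact hmain hh
        _ = (‖h‖⁻¹ * ‖h‖) * (‖K‖ * (4 * (C * D) * (A * B))) := by ring
        _ ≤ 1 * (‖K‖ * (4 * (C * D) * (A * B))) :=
            mul_le_mul_of_nonneg_right hinv (by positivity)
        _ = _ := one_mul _
    · rw [norm_zero, zero_mul]
      positivity

theorem hasFDerivAt_fibIntegrand (hF : ContDiff ℝ ∞ F) (hG : ContDiff ℝ ∞ G)
    (p z : Plane × Plane) : ∃ f' : Plane × Plane →L[ℝ] ℂ,
      HasFDerivAt (fun p => fibIntegrand c ħ F G p z) f' p ∧ ∀ h, f' h =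
        fibIntegrand c ħ (dirDeriv h F) G p z + fibIntegrand c ħ F (dirDeriv h G) p z := by
  have d : ∀ (a : Plane × Plane) {F : Plane × Plane → ℂ}, ContDiff ℝ ∞ F →
      HasFDerivAt (fun p => F (p + a)) (fderiv ℝ F (p + a)) p := fun a F hF =>
    (hasFDerivAt_comp_add_right a).2
      (hF.differentiableAt_infty (p + a)).hasFDerivAt
  refine ⟨_, ((d (0, z.1) hF).const_mul (((|c| / (Real.pi * ħ)) ^ 2 : ℝ) : ℂ)).mul
    (d (0, z.2) hG), fun h => ?_⟩
  simp only [add_apply, smul_apply, smul_eq_mul, fibIntegrand, dirDeriv]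
  ring

/-- Differentiating a remainder produces remainders for the differentiated factors, so that
convergence of all derivatives follows from pointwise differentiability. -/
theorem fibRemainder_symTendsto (hF : ContDiff ℝ ∞ F) (hG : ContDiff ℝ ∞ G)
    (p : Plane × Plane) :
    SymTendsto (𝓝 0) (fun h => fibRemainder c ħ F G p h) (fun _ => 0) := by
  intro L
  induction L generalizing F G with
  | cons w L ih =>
    intro z
    have h1 := (ih (dirDeriv_smooth (0, w.1) hF) hG z).add
      (ih hF (dirDeriv_smooth (0, w.2) hG) z)
    simp only [dirDerivs_const, ite_self, add_zero, reduceCtorEq] at h1 ⊢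
    refine h1.congr fun h => ?_
    rw [dirDerivs, dirDeriv_fibRemainder c ħ hF hG, dirDerivs_add L
      (fibRemainder_smooth c ħ (dirDeriv_smooth _ hF) hG p h)
      (fibRemainder_smooth c ħ hF (dirDeriv_smooth _ hG) p h)]
  | nil =>
    intro z
    change Tendsto (fun h => fibRemainder c ħ F G p h z) (𝓝 0) (𝓝 0)
    obtain ⟨f', h1, h2⟩ := hasFDerivAt_fibIntegrand c ħ hF hG p z
    have h3 := hasFDerivAt_iff_tendsto.1 h1
    have h4 : Tendsto (fun h : Plane × Plane => p + h) (𝓝 0) (𝓝 p) := by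
      have : Continuous (fun h : Plane × Plane => p + h) := by fun_prop
      simpa using this.tendsto 0
    have h5 := h3.comp h4
    refine squeeze_zero_norm (fun h => ?_) h5
    simp only [Function.comp_apply, add_sub_cancel_left, h2]
    rw [fibRemainder, norm_mul, Complex.norm_real]
    refine mul_le_mul ?_ (le_of_eq ?_) (norm_nonneg _) (by positivity)
    · split_ifs <;> simp
    · congr 1; ring

end FibStar

section FibStarDeriv

variable {c ħ : ℝ} (hc : c ≠ 0) (hħ : ħ ≠ 0) {F F' G G' : Plane × Plane → ℂ}

include hc hħ

theorem hasOscIntegral_fibIntegrand (hF : IsFibreOC F) (hG : IsFibreOC G) (p : Plane × Plane) :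
    HasOscIntegral (fibIntegrand c ħ F G p) (fun p => -(2 / ħ) * symp c p.1 p.2)
      (fibStar c ħ F G p) := by
  rw [← starIntegrand_fibre]
  exact hasStarValue_planeStar hc hħ (hF.isOC p.1) (hG.isOC p.1) p.2

theorem fibStar_add_left (hF : IsFibreOC F) (hF' : IsFibreOC F') (hG : IsFibreOC G)
    (p : Plane × Plane) :
    fibStar c ħ (fun p => F p + F' p) G p = fibStar c ħ F G p + fibStar c ħ F' G p :=
  planeStar_add_left hc hħ (hF.isOC _) (hF'.isOC _) (hG.isOC _) _

theorem fibStar_add_right (hF : IsFibreOC F) (hG : IsFibreOC G) (hG' : IsFibreOC G')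
    (p : Plane × Plane) :
    fibStar c ħ F (fun p => G p + G' p) p = fibStar c ħ F G p + fibStar c ħ F G' p :=
  planeStar_add_right hc hħ (hF.isOC _) (hG.isOC _) (hG'.isOC _) _

theorem fibStar_mul_left (z : ℂ) (hF : IsFibreOC F) (hG : IsFibreOC G) (p : Plane × Plane) :
    fibStar c ħ (fun p => z * F p) G p = z * fibStar c ħ F G p :=
  planeStar_mul_left hc hħ z (hF.isOC _) (hG.isOC _) _

theorem fibStar_mul_right (z : ℂ) (hF : IsFibreOC F) (hG : IsFibreOC G) (p : Plane × Plane) :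
    fibStar c ħ F (fun p => z * G p) p = z * fibStar c ħ F G p :=
  planeStar_mul_right hc hħ z (hF.isOC _) (hG.isOC _) _

/-- Differentiation under the oscillatory integral: by continuity, the oscillatory integrals of the
remainders tend to zero with the increment. -/
theorem hasFDerivAt_fibStar (hF : IsFibreOC F) (hG : IsFibreOC G) (p : Plane × Plane) :
    ∃ f' : Plane × Plane →L[ℝ] ℂ, HasFDerivAt (fibStar c ħ F G) f' p ∧
      ∀ h, f' h = fibStar c ħ (dirDeriv h F) G p + fibStar c ħ F (dirDeriv h G) p := by
  let f' : Plane × Plane →ₗ[ℝ] ℂ :=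
    { toFun := fun h => fibStar c ħ (dirDeriv h F) G p + fibStar c ħ F (dirDeriv h G) p
      map_add' := fun v w => by
        rw [dirDeriv_add_dir, dirDeriv_add_dir,
          fibStar_add_left hc hħ (hF.dirDeriv v) (hF.dirDeriv w) hG,
          fibStar_add_right hc hħ hF (hG.dirDeriv v) (hG.dirDeriv w)]
        ring
      map_smul' := fun r v => by
        rw [dirDeriv_smul_dir, dirDeriv_smul_dir, fibStar_mul_left hc hħ _ (hF.dirDeriv v) hG,
          fibStar_mul_right hc hħ _ hF (hG.dirDeriv v)]
        simp only [RingHom.id_apply, Complex.real_smul]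
        ring }
  refine ⟨LinearMap.toContinuousLinearMap f', ?_, fun h => rfl⟩
  obtain ⟨k, hk⟩ := hF.exists_isFibreC1
  obtain ⟨m, hm⟩ := hG.exists_isFibreC1
  have h0 : UnifSymbol (fun z : Plane × Plane => (1 + ‖z‖ ^ 2) ^ (k + m))
      (fun _ : Unit => fun _ => (0 : ℂ)) :=
    (unifSymbol_const (V := Plane × Plane) (ι := Unit) (0 : ℂ)).mono (fun _ => zero_le_one) (c := 1)
      fun z => by
        rw [one_mul]
        exact one_le_pow₀ (one_le_one_add_norm_sq z)
  have hlim := oscInt_tendsto hc hħ (fibRemainder_unifSymbol c ħ hk hm p) h0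
    (fibRemainder_symTendsto c ħ hF.smooth hG.smooth p)
  have hzero : oscInt c ħ (fun _ => 0) = 0 := by
    have := ((hasOscIntegral_oscInt hc hħ h0 ()).const_mul 0).oscInt_eq
    simpa using this
  have hval : ∀ h, oscInt c ħ (fibRemainder c ħ F G p h) =
      ((if ‖h‖ ≤ 1 then ‖h‖⁻¹ else 0 : ℝ) : ℂ) *
        (fibStar c ħ F G (p + h) + (-1) * (fibStar c ħ F G p + f' h)) := by
    intro h
    have i := fun {F G : Plane × Plane → ℂ} (hF : IsFibreOC F) (hG : IsFibreOC G) p =>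
      hasOscIntegral_fibIntegrand hc hħ hF hG p
    exact (((i hF hG (p + h)).add (((i hF hG p).add
      ((i (hF.dirDeriv h) hG p).add (i hF (hG.dirDeriv h) p))).const_mul (-1))).const_mul
      _).oscInt_eq
  rw [hzero] at hlim
  simp only [hval] at hlim
  rw [hasFDerivAt_iff_tendsto]
  have h4 : Tendsto (fun x : Plane × Plane => x - p) (𝓝 p) (𝓝 0) := by
    have : Continuous (fun x : Plane × Plane => x - p) := by fun_prop
    simpa using this.tendsto p
  have h5 := (hlim.comp h4).norm
  rw [norm_zero] at h5
  refine h5.congr' ?_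
  have hev : ∀ᶠ h : Plane × Plane in 𝓝 0, ‖h‖ ≤ 1 := by
    have := Metric.closedBall_mem_nhds (0 : Plane × Plane) one_pos
    filter_upwards [this] with h hh
    simpa using hh
  filter_upwards [h4.eventually hev] with x hx
  simp only [Function.comp_apply, add_sub_cancel]
  rw [if_pos hx, norm_mul, Complex.norm_real, norm_inv, norm_norm]
  congr 2
  change _ = fibStar c ħ F G x - fibStar c ħ F G p - f' (x - p)
  ring

theorem dirDeriv_fibStar (hF : IsFibreOC F) (hG : IsFibreOC G) (v : Plane × Plane) :
    dirDeriv v (fibStar c ħ F G) = fun p =>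
      fibStar c ħ (dirDeriv v F) G p + fibStar c ħ F (dirDeriv v G) p := by
  funext p
  obtain ⟨f', h1, h2⟩ := hasFDerivAt_fibStar hc hħ hF hG p
  rw [dirDeriv, h1.fderiv, h2]

theorem fibStar_smooth (hF : IsFibreOC F) (hG : IsFibreOC G) :
    ContDiff ℝ ∞ (fibStar c ħ F G) := by
  rw [contDiff_infty]
  intro n
  have hdiff : ∀ {F G : Plane × Plane → ℂ}, IsFibreOC F → IsFibreOC G →
      Differentiable ℝ (fibStar c ħ F G) := fun hF hG p => by
    obtain ⟨f', h1, -⟩ := hasFDerivAt_fibStar hc hħ hF hG p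
    exact h1.differentiableAt
  induction n generalizing F G with
  | zero => exact contDiff_zero.2 (hdiff hF hG).continuous
  | succ n ih =>
    push_cast
    rw [contDiff_succ_iff_fderiv]
    refine ⟨hdiff hF hG, by simp, contDiff_clm_apply_iff.2 fun v => ?_⟩
    have h := dirDeriv_fibStar hc hħ hF hG v
    unfold dirDeriv at h
    rw [h]
    exact (ih (hF.dirDeriv v) hG).add (ih hF (hG.dirDeriv v))

/-! ### Bounded families of functions on the plane and their star products -/

omit hc hħ in
theorem IsOC.isFibreOC {f : Plane → ℂ} (hf : IsOC f) : IsFibreOC (fun p => f p.2) := by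
  obtain ⟨k, hk⟩ := hf
  refine ⟨(hk.smooth ()).comp contDiff_snd, fun L => ⟨k, ?_⟩⟩
  have h := dirDerivs_comp_clm L (ContinuousLinearMap.snd ℝ Plane Plane) (hk.smooth ())
  change dirDerivs L (fun p : Plane × Plane => f p.2) = _ at h
  rw [h]
  exact (hk.dirDerivs _).reindex fun _ => ()

omit hc hħ in
theorem IsOC.dirDeriv {f : Plane → ℂ} (hf : IsOC f) (v : Plane) : IsOC (dirDeriv v f) :=
  hf.imp fun _ h => h.dirDeriv v

theorem planeStar_smooth {f g : Plane → ℂ} (hf : IsOC f) (hg : IsOC g) :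
    ContDiff ℝ ∞ (planeStar c ħ f g) := by
  have e : planeStar c ħ f g =
      fibStar c ħ (fun p => f p.2) (fun p => g p.2) ∘ fun y : Plane => ((0 : Plane), y) := by
    funext y
    simp only [Function.comp_apply, fibStar]
  rw [e]
  exact ContDiff.comp (fibStar_smooth hc hħ hf.isFibreOC hg.isFibreOC)
    (contDiff_const.prodMk contDiff_id)

theorem dirDeriv_planeStar {f g : Plane → ℂ} (hf : IsOC f) (hg : IsOC g) (v : Plane) :
    dirDeriv v (planeStar c ħ f g) = fun y =>
      planeStar c ħ (dirDeriv v f) g y + planeStar c ħ f (dirDeriv v g) y := by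
  have h1 := dirDeriv_fibre v (fibStar_smooth hc hħ hf.isFibreOC hg.isFibreOC) 0
  rw [dirDeriv_fibStar hc hħ hf.isFibreOC hg.isFibreOC] at h1
  have e : ∀ {f : Plane → ℂ}, IsOC f → dirDeriv ((0, v) : Plane × Plane) (fun p => f p.2) =
      fun p => dirDeriv v f p.2 := fun {f} hf => by
    obtain ⟨k, hk⟩ := hf
    exact dirDeriv_comp_clm ((0, v) : Plane × Plane) (ContinuousLinearMap.snd ℝ Plane Plane)
      (hk.smooth ())
  rw [e hf, e hg] at h1
  exact h1

variable {ι : Type*} {f g : ι → Plane → ℂ} {k m : ℕ}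

omit hc hħ in
theorem UnifSymbol.isOC (hf : UnifSymbol (fun y : Plane => (1 + ‖y‖ ^ 2) ^ k) f) (i : ι) :
    IsOC (f i) := ⟨k, hf.reindex fun _ => i⟩

theorem planeStar_unifSymbol (hf : UnifSymbol (fun y : Plane => (1 + ‖y‖ ^ 2) ^ k) f)
    (hg : UnifSymbol (fun y : Plane => (1 + ‖y‖ ^ 2) ^ m) g) :
    UnifSymbol (fun y : Plane => (1 + ‖y‖ ^ 2) ^ (k + m))
      (fun i => planeStar c ħ (f i) (g i)) := by
  refine ⟨fun i => planeStar_smooth hc hħ (hf.isOC i) (hg.isOC i), fun L => ?_⟩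
  induction L generalizing f g with
  | nil => exact planeStar_bound hc hħ hf hg
  | cons v L ih =>
    obtain ⟨C, hC⟩ := ih (hf.dirDeriv v) hg
    obtain ⟨D, hD⟩ := ih hf (hg.dirDeriv v)
    refine ⟨C + D, fun i z => ?_⟩
    rw [dirDerivs, dirDeriv_planeStar hc hħ (hf.isOC i) (hg.isOC i), dirDerivs_add L
      (planeStar_smooth hc hħ ((hf.isOC i).dirDeriv v) (hg.isOC i))
      (planeStar_smooth hc hħ (hf.isOC i) ((hg.isOC i).dirDeriv v)), add_mul]
    exact norm_add_le_of_le (hC i z) (hD i z)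

theorem planeStar_symTendsto {l : Filter ι} [l.IsCountablyGenerated] {f' g' : Plane → ℂ}
    (hf : UnifSymbol (fun y : Plane => (1 + ‖y‖ ^ 2) ^ k) f)
    (hg : UnifSymbol (fun y : Plane => (1 + ‖y‖ ^ 2) ^ m) g)
    (hf' : UnifSymbol (fun y : Plane => (1 + ‖y‖ ^ 2) ^ k) (fun _ : Unit => f'))
    (hg' : UnifSymbol (fun y : Plane => (1 + ‖y‖ ^ 2) ^ m) (fun _ : Unit => g'))
    (hT : SymTendsto l f f') (hT' : SymTendsto l g g') :
    SymTendsto l (fun i => planeStar c ħ (f i) (g i)) (planeStar c ħ f' g') := by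
  intro L
  induction L generalizing f g f' g' with
  | nil => exact planeStar_tendsto hc hħ hf hg hf' hg' hT hT'
  | cons v L ih =>
    intro z
    have e : ∀ {f g : Plane → ℂ}, IsOC f → IsOC g → dirDerivs (v :: L) (planeStar c ħ f g) z =
        dirDerivs L (planeStar c ħ (dirDeriv v f) g) z +
          dirDerivs L (planeStar c ħ f (dirDeriv v g)) z := fun hf hg => by
      rw [dirDerivs, dirDeriv_planeStar hc hħ hf hg, dirDerivs_add L
        (planeStar_smooth hc hħ (hf.dirDeriv v) hg) (planeStar_smooth hc hħ hf (hg.dirDeriv v))]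
    simp only [e (hf.isOC _) (hg.isOC _), e (hf'.isOC ()) (hg'.isOC ())]
    exact (ih (hf.dirDeriv v) hg (hf'.dirDeriv v) hg' (hT.dirDeriv v) hT' z).add
      (ih hf (hg.dirDeriv v) hf' (hg'.dirDeriv v) hT (hT'.dirDeriv v) z)

theorem IsOC.planeStar {f g : Plane → ℂ} (hf : IsOC f) (hg : IsOC g) :
    IsOC (planeStar c ħ f g) := by
  obtain ⟨k, hf⟩ := hf
  obtain ⟨m, hg⟩ := hg
  exact ⟨k + m, planeStar_unifSymbol hc hħ hf hg⟩

theorem IsFibreOC.fibStar (hF : IsFibreOC F) (hG : IsFibreOC G) :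
    IsFibreOC (fibStar c ħ F G) := by
  refine ⟨fibStar_smooth hc hħ hF hG, fun L => ?_⟩
  induction L generalizing F G with
  | nil =>
    obtain ⟨k, hk⟩ := hF.bound []
    obtain ⟨m, hm⟩ := hG.bound []
    refine ⟨k + m, ?_⟩
    have h := planeStar_unifSymbol hc hħ hk hm
    simpa only [dirDerivs, _root_.fibStar] using h
  | cons v L ih =>
    obtain ⟨k, hk⟩ := ih (hF.dirDeriv v) hG
    obtain ⟨m, hm⟩ := ih hF (hG.dirDeriv v)
    refine ⟨max k m, ?_⟩
    rw [dirDerivs, dirDeriv_fibStar hc hħ hF hG, dirDerivs_add L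
      (fibStar_smooth hc hħ (hF.dirDeriv v) hG) (fibStar_smooth hc hħ hF (hG.dirDeriv v))]
    exact (hk.mono_pow (le_max_left k m)).add (hm.mono_pow (le_max_right k m))

end FibStarDeriv

/-! ### Associativity of the star product -/

section Assoc

open FourierTransform

/-- The plane wave `y ↦ e^{2πi ⟨ξ, y⟩}`. -/
def planeWave (ξ y : Plane) : ℂ := Complex.exp (((2 * Real.pi * inner ℝ ξ y : ℝ) : ℂ) * Complex.I)

theorem norm_planeWave (ξ y : Plane) : ‖planeWave ξ y‖ = 1 := Complex.norm_exp_ofReal_mul_I _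

theorem planeWave_add (ξ y u : Plane) : planeWave ξ (y + u) = planeWave ξ y * planeWave ξ u := by
  rw [planeWave, planeWave, planeWave, ← Complex.exp_add, inner_add_right]
  congr 1
  push_cast
  ring

theorem Continuous.planeWave {X : Type*} [TopologicalSpace X] {a b : X → Plane}
    (ha : Continuous a) (hb : Continuous b) : Continuous fun x => planeWave (a x) (b x) := by
  unfold _root_.planeWave
  fun_prop

/-- The translation by which star multiplication from the left acts for the plane wave `e_ξ`: the
product `e_ξ ∗ g` is `y ↦ e_ξ(y) g(y - waveShift ξ)`. -/
def waveShift (c ħ : ℝ) (ξ : Plane) : Plane := (c / (Real.pi * ħ))⁻¹ • rotJ ξ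

theorem continuous_waveShift (c ħ : ℝ) : Continuous (waveShift c ħ) := by
  unfold waveShift
  exact rotJ.continuous.const_smul (c / (Real.pi * ħ))⁻¹

theorem rotJ_rotJ (ξ : Plane) : rotJ (rotJ ξ) = -ξ := by
  ext i; fin_cases i <;> simp [rotJ_zero, rotJ_one]

/-- A modulation in `u` can be absorbed by a translation in `v`. -/
theorem planeWave_mul_oscExp {c ħ : ℝ} (hc : c ≠ 0) (hħ : ħ ≠ 0) (ξ u v : Plane) :
    planeWave ξ u * oscExp c ħ (u, v - waveShift c ħ ξ) = oscExp c ħ (u, v) := by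
  have hτ : c / (Real.pi * ħ) ≠ 0 := div_ne_zero hc (mul_ne_zero Real.pi_ne_zero hħ)
  rw [planeWave, oscExp_eq, oscExp_eq, ← Complex.exp_add, ← add_mul, ← Complex.ofReal_add]
  congr 3
  rw [waveShift, map_sub, map_smul, rotJ_rotJ, smul_sub, smul_inv_smul₀ hτ, inner_sub_right,
    inner_neg_right, real_inner_comm u ξ]
  ring

/-- A Schwartz function beats polynomial growth along the shifts. -/
theorem exists_bound_mul_waveShift (c ħ : ℝ) (κ : 𝓢(Plane, ℂ)) (y : Plane) (n : ℕ) :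
    ∃ C : ℝ, ∀ ξ, ‖κ ξ‖ * (1 + ‖y - waveShift c ħ ξ‖ ^ 2) ^ n ≤ C * intWeight ξ := by
  obtain ⟨C, hC⟩ := κ.exists_bound (n + 3)
  set σ : ℝ := (c / (Real.pi * ħ))⁻¹ with hσ
  refine ⟨|C| * (2 ^ n * ((1 + ‖y‖ ^ 2) ^ n * (1 + σ ^ 2) ^ n)), fun ξ => ?_⟩
  have hs : 1 + ‖-waveShift c ħ ξ‖ ^ 2 ≤ (1 + σ ^ 2) * (1 + ‖ξ‖ ^ 2) := by
    rw [norm_neg, waveShift, norm_smul, LinearIsometryEquiv.norm_map, mul_pow, Real.norm_eq_abs,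
      sq_abs]
    nlinarith [sq_nonneg σ, sq_nonneg ‖ξ‖]
  have h1 : (1 + ‖y - waveShift c ħ ξ‖ ^ 2) ^ n ≤
      2 ^ n * ((1 + ‖y‖ ^ 2) ^ n * ((1 + σ ^ 2) ^ n * (1 + ‖ξ‖ ^ 2) ^ n)) := by
    rw [sub_eq_add_neg]
    refine (peetre_pow y _ n).trans ?_
    rw [← mul_pow (1 + σ ^ 2)]
    gcongr
  have h2 : ‖κ ξ‖ ≤ |C| * ((1 + ‖ξ‖ ^ 2) ^ (n + 3))⁻¹ :=
    (hC ξ).trans (mul_le_mul_of_nonneg_right (le_abs_self C) (by positivity))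
  refine (mul_le_mul h2 h1 (by positivity) (by positivity)).trans (le_of_eq ?_)
  have h0 : (0 : ℝ) < 1 + ‖ξ‖ ^ 2 := by positivity
  rw [intWeight, pow_add _ n 3]
  field_simp

/-- The regularized amplitude of the star product of a superposition with `h`. -/
def superposAmplitude (c ħ : ℝ) (χ : 𝓢(Plane × Plane, ℂ)) (K : ℂ) (κ : 𝓢(Plane, ℂ))
    (g h : Plane → ℂ) (y : Plane) (ε : ℝ) (z : Plane × Plane) (ξ : Plane) : ℂ :=
  χ (ε • z) * (K * (κ ξ * planeWave ξ (y + z.1) * g (y + z.1 - waveShift c ħ ξ)) * h (y + z.2)) *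
    oscExp c ħ z

theorem continuous_superposAmplitude (c ħ : ℝ) (χ : 𝓢(Plane × Plane, ℂ)) (K : ℂ)
    (κ : 𝓢(Plane, ℂ)) {g h : Plane → ℂ} (hg : Continuous g) (hh : Continuous h) (y : Plane)
    (ε : ℝ) : Continuous (fun q : (Plane × Plane) × Plane =>
      superposAmplitude c ħ χ K κ g h y ε q.1 q.2) := by
  have c1 : Continuous fun q : (Plane × Plane) × Plane => χ (ε • q.1) :=
    χ.continuous.comp (continuous_fst.const_smul ε)
  have c2 : Continuous fun q : (Plane × Plane) × Plane => y + q.1.1 :=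
    continuous_const.add continuous_fst.fst
  have c3 : Continuous fun q : (Plane × Plane) × Plane => planeWave q.2 (y + q.1.1) :=
    Continuous.planeWave continuous_snd c2
  have c6 : Continuous fun q : (Plane × Plane) × Plane => waveShift c ħ q.2 :=
    (continuous_waveShift c ħ).comp continuous_snd
  have c4 : Continuous fun q : (Plane × Plane) × Plane => g (y + q.1.1 - waveShift c ħ q.2) :=
    hg.comp (c2.sub c6)
  have c5 : Continuous fun q : (Plane × Plane) × Plane => h (y + q.1.2) :=
    hh.comp (continuous_const.add continuous_fst.snd)
  have c7 : Continuous fun q : (Plane × Plane) × Plane => oscExp c ħ q.1 :=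
    (oscExp_smooth c ħ).continuous.comp continuous_fst
  have c8 : Continuous fun q : (Plane × Plane) × Plane => κ q.2 :=
    κ.continuous.comp continuous_snd
  exact (c1.mul ((continuous_const.mul ((c8.mul c3).mul c4)).mul c5)).mul c7

theorem integrable_superposAmplitude (c ħ : ℝ) (χ : 𝓢(Plane × Plane, ℂ)) (K : ℂ)
    (κ : 𝓢(Plane, ℂ)) {g h : Plane → ℂ} {k m : ℕ}
    (hg : UnifSymbol (fun y : Plane => (1 + ‖y‖ ^ 2) ^ k) (fun _ : Unit => g))
    (hh : UnifSymbol (fun y : Plane => (1 + ‖y‖ ^ 2) ^ m) (fun _ : Unit => h))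
    (y : Plane) {ε : ℝ} (hε : 0 < ε) :
    Integrable (fun q : (Plane × Plane) × Plane => superposAmplitude c ħ χ K κ g h y ε q.1 q.2)
      ((volume : Measure (Plane × Plane)).prod (volume : Measure Plane)) := by
  have hmeas := continuous_superposAmplitude c ħ χ K κ (hg.smooth ()).continuous
    (hh.smooth ()).continuous y ε
  obtain ⟨χ', hχ'⟩ := exists_schwartz_rescale χ hε 0
  obtain ⟨Cχ, hCχ⟩ := χ'.exists_bound (k + m + 3)
  obtain ⟨Cκ, hCκ⟩ := exists_bound_mul_waveShift c ħ κ y k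
  obtain ⟨Cg, hCg⟩ := hg.bound []
  obtain ⟨Ch, hCh⟩ := hh.bound []
  have hint := ((integrable_intWeight (volume : Measure (Plane × Plane))
    finrank_plane_prod).mul_prod (integrable_intWeight (volume : Measure Plane)
      (by rw [finrank_plane_eq]; norm_num))).const_mul
      (|Cχ| * ‖K‖ * (|Cg| * 2 ^ k) * (|Ch| * (2 ^ m * (1 + ‖y‖ ^ 2) ^ m)) * Cκ)
  refine Integrable.mono' hint hmeas.aestronglyMeasurable (Eventually.of_forall fun q => ?_)
  obtain ⟨z, ξ⟩ := q
  simp only [superposAmplitude, norm_mul, norm_planeWave, norm_oscExp, mul_one]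
  have b1 : ‖χ (ε • z)‖ ≤ |Cχ| * ((1 + ‖z‖ ^ 2) ^ (k + m + 3))⁻¹ := by
    have := hCχ z
    rw [hχ', add_zero] at this
    exact this.trans (mul_le_mul_of_nonneg_right (le_abs_self _) (by positivity))
  have b2 : ‖g (y + z.1 - waveShift c ħ ξ)‖ ≤
      |Cg| * 2 ^ k * (1 + ‖z‖ ^ 2) ^ k * (1 + ‖y - waveShift c ħ ξ‖ ^ 2) ^ k := by
    rw [add_sub_right_comm]
    calc _ ≤ Cg * (1 + ‖y - waveShift c ħ ξ + z.1‖ ^ 2) ^ k := hCg () _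
      _ ≤ |Cg| * (2 ^ k * ((1 + ‖y - waveShift c ħ ξ‖ ^ 2) ^ k * (1 + ‖z‖ ^ 2) ^ k)) := by
        refine mul_le_mul (le_abs_self _) ((peetre_pow _ _ k).trans ?_) (by positivity)
          (abs_nonneg _)
        have := norm_fst_le z
        gcongr
      _ = _ := by ring
  have b3 : ‖h (y + z.2)‖ ≤ |Ch| * (2 ^ m * (1 + ‖y‖ ^ 2) ^ m) * (1 + ‖z‖ ^ 2) ^ m := by
    calc _ ≤ Ch * (1 + ‖y + z.2‖ ^ 2) ^ m := hCh () _
      _ ≤ |Ch| * (2 ^ m * ((1 + ‖y‖ ^ 2) ^ m * (1 + ‖z‖ ^ 2) ^ m)) := by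
        refine mul_le_mul (le_abs_self _) ((peetre_pow _ _ m).trans ?_) (by positivity)
          (abs_nonneg _)
        have := norm_snd_le z
        gcongr
      _ = _ := by ring
  have b4 := hCκ ξ
  have b5 : ‖κ ξ‖ * ‖g (y + z.1 - waveShift c ħ ξ)‖ ≤
      |Cg| * 2 ^ k * (1 + ‖z‖ ^ 2) ^ k * (Cκ * intWeight ξ) := by
    calc _ ≤ ‖κ ξ‖ * (|Cg| * 2 ^ k * (1 + ‖z‖ ^ 2) ^ k *
          (1 + ‖y - waveShift c ħ ξ‖ ^ 2) ^ k) :=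
          mul_le_mul_of_nonneg_left b2 (norm_nonneg _)
      _ = |Cg| * 2 ^ k * (1 + ‖z‖ ^ 2) ^ k *
          (‖κ ξ‖ * (1 + ‖y - waveShift c ħ ξ‖ ^ 2) ^ k) := by ring
      _ ≤ _ := mul_le_mul_of_nonneg_left b4 (by positivity)
  have hw : ((1 + ‖z‖ ^ 2) ^ (k + m + 3))⁻¹ * ((1 + ‖z‖ ^ 2) ^ k * (1 + ‖z‖ ^ 2) ^ m) =
      intWeight z := by
    have h0 : (0 : ℝ) < 1 + ‖z‖ ^ 2 := by positivity
    rw [intWeight, pow_add, pow_add]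
    field_simp
  have hpos : 0 ≤ |Cg| * 2 ^ k * (1 + ‖z‖ ^ 2) ^ k * (Cκ * intWeight ξ) :=
    le_trans (by positivity) b5
  calc _ ≤ (|Cχ| * ((1 + ‖z‖ ^ 2) ^ (k + m + 3))⁻¹) * (‖K‖ *
        (|Cg| * 2 ^ k * (1 + ‖z‖ ^ 2) ^ k * (Cκ * intWeight ξ)) *
          (|Ch| * (2 ^ m * (1 + ‖y‖ ^ 2) ^ m) * (1 + ‖z‖ ^ 2) ^ m)) := by
        gcongr
    _ = _ := by rw [← hw]; ring

variable {c ħ : ℝ} (hc : c ≠ 0) (hħ : ħ ≠ 0)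

include hc hħ

/-- Star multiplication commutes with superpositions of translated and modulated copies of a
function: translating the variable `v` turns the modulation of the first factor into a translation
of the second one. -/
theorem planeStar_superposition (κ : 𝓢(Plane, ℂ)) {b g h : Plane → ℂ} (hb : IsOC b) (hg : IsOC g)
    (hh : IsOC h)
    (hbg : ∀ y, b y = ∫ ξ, κ ξ * planeWave ξ y * g (y - waveShift c ħ ξ)) (y : Plane) :
    planeStar c ħ b h y =
      ∫ ξ, κ ξ * planeWave ξ y * planeStar c ħ g h (y - waveShift c ħ ξ) := by
  obtain ⟨χ, hχ, -⟩ := exists_schwartz_one (V := Plane × Plane)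
  obtain ⟨-, hlim⟩ := hasStarValue_planeStar hc hħ hb hh y χ hχ
  obtain ⟨k, hg⟩ := hg
  obtain ⟨m, hh⟩ := hh
  set K : ℂ := (((|c| / (Real.pi * ħ)) ^ 2 : ℝ) : ℂ) with hK
  let Φ : ℝ → Plane × Plane → Plane → ℂ := superposAmplitude c ħ χ K κ g h y
  have hΦ : ∀ ε : ℝ, 0 < ε → Integrable (Function.uncurry (Φ ε))
      ((volume : Measure (Plane × Plane)).prod (volume : Measure Plane)) := fun ε hε =>
    integrable_superposAmplitude c ħ χ K κ hg hh y hε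
  -- the regularized amplitudes, normalized so as to be bounded uniformly in `ε` and `ξ`
  let W : Plane → ℝ := fun ξ => (1 + ‖y - waveShift c ħ ξ‖ ^ 2) ^ (k + m)
  have hW : ∀ ξ, 0 < W ξ := fun ξ => by positivity
  let r : ℝ → ℝ := fun ε => max 0 (min ε 1)
  have hr1 : ∀ ε, |r ε| ≤ 1 := fun ε => by
    rw [abs_of_nonneg (le_max_left _ _)]
    exact max_le zero_le_one (min_le_right _ _)
  have hr0 : Tendsto r (𝓝[>] 0) (𝓝 0) := by
    have : Continuous r := by fun_prop
    have h := this.tendsto 0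
    have h0 : r 0 = 0 := by simp [r]
    rw [h0] at h
    exact h.mono_left nhdsWithin_le_nhds
  let B : ℝ × Plane → Plane × Plane → ℂ := fun q z =>
    χ (r q.1 • z + r q.1 • (0, -waveShift c ħ q.2)) *
      (((W q.2)⁻¹ : ℝ) * starIntegrand c ħ g h (y - waveShift c ħ q.2) z)
  have hSt : UnifSymbol (fun z : Plane × Plane => (1 + ‖z‖ ^ 2) ^ (k + m)) (fun (q : ℝ × Plane) z =>
      (((W q.2)⁻¹ : ℝ) : ℂ) * starIntegrand c ħ g h (y - waveShift c ħ q.2) z) :=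
    (starIntegrand_unifSymbol c ħ hg hh).reindex
      (fun q : ℝ × Plane => ((), y - waveShift c ħ q.2))
  have hχ1 : UnifSymbol (fun _ : Plane × Plane => (1 : ℝ)) (fun (q : ℝ × Plane) z =>
      χ (r q.1 • z + r q.1 • ((0 : Plane), -waveShift c ħ q.2))) := by
    have := (χ.unifSymbol (ι := Unit) 0).comp_affine (W := fun _ : Plane × Plane => (1 : ℝ))
      (fun z => by positivity) (fun _ : ℝ × Plane => ()) (fun _ => 1) (fun q => r q.1)
      (ContinuousLinearMap.id ℝ _) (fun q => r q.1 • ((0 : Plane), -waveShift c ħ q.2))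
      (fun q => hr1 q.1) (fun _ _ => by simp)
    simpa using this
  have hB : UnifSymbol (fun z : Plane × Plane => (1 + ‖z‖ ^ 2) ^ (k + m)) B := by
    have := hχ1.mul hSt
    simpa only [one_mul] using this
  obtain ⟨C, hC⟩ := oscInt_bound hc hħ hB
  have hinner : ∀ ε : ℝ, 0 < ε → ε < 1 → ∀ ξ, ∫ z, Φ ε z ξ =
      κ ξ * planeWave ξ y * (W ξ * oscInt c ħ (B (ε, ξ))) := by
    intro ε hε hε1 ξ
    have hre : r ε = ε := by
      simp only [r, min_eq_left hε1.le]
      exact max_eq_right hε.le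
    have hBint : UnifSymbol intWeight (fun _ : Unit => B (ε, ξ)) := by
      obtain ⟨χ', hχ'⟩ := exists_schwartz_rescale χ hε (r ε • ((0 : Plane), -waveShift c ħ ξ))
      have := (hSt.reindex (fun _ : Unit => (ε, ξ))).schwartz_mul χ'
      simpa only [B, hχ', hre] using this
    rw [oscInt_eq_integral hc hħ hBint, ← integral_const_mul, ← integral_const_mul,
      ← integral_sub_right_eq_self (fun z => Φ ε z ξ) ((0 : Plane), waveShift c ħ ξ)]
    refine integral_congr_ae (Eventually.of_forall fun z => ?_)
    have hW' : ((W ξ : ℝ) : ℂ) ≠ 0 := by exact_mod_cast (hW ξ).ne'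
    have e1 : ε • (z.1, z.2 - waveShift c ħ ξ) =
        ε • z + ε • ((0 : Plane), -waveShift c ħ ξ) := by
      rw [← smul_add]
      congr 1
      refine Prod.ext ?_ ?_ <;> simp [sub_eq_add_neg]
    have e2 : y + (z.2 - waveShift c ħ ξ) = y - waveShift c ħ ξ + z.2 := by abel
    have e3 : y + z.1 - waveShift c ħ ξ = y - waveShift c ħ ξ + z.1 := by abel
    have e4 : z - ((0 : Plane), waveShift c ħ ξ) = (z.1, z.2 - waveShift c ħ ξ) := by
      refine Prod.ext ?_ ?_ <;> simp
    have e5 := planeWave_mul_oscExp hc hħ ξ z.1 z.2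
    simp only [Φ, superposAmplitude, B, starIntegrand, hre, e1, e4, planeWave_add, e2, e3,
      ← hK, ← e5,
      Complex.ofReal_inv]
    field_simp
  have hB_lim : ∀ ξ, Tendsto (fun ε => oscInt c ħ (B (ε, ξ))) (𝓝[>] 0)
      (𝓝 (((W ξ)⁻¹ : ℝ) * planeStar c ħ g h (y - waveShift c ħ ξ))) := by
    intro ξ
    have hval : oscInt c ħ (fun z => (((W ξ)⁻¹ : ℝ) : ℂ) *
        starIntegrand c ħ g h (y - waveShift c ħ ξ) z) =
        ((W ξ)⁻¹ : ℝ) * planeStar c ħ g h (y - waveShift c ħ ξ) :=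
      ((hasOscIntegral_oscInt hc hħ
        (starIntegrand_unifSymbol_at c ħ hg hh (y - waveShift c ħ ξ)) ()).const_mul _).oscInt_eq
    rw [← hval]
    refine oscInt_tendsto hc hħ (hB.reindex fun ε : ℝ => (ε, ξ))
      (hSt.reindex fun _ : Unit => ((0 : ℝ), ξ)) ?_
    have ha : Tendsto (fun ε => r ε • ((0 : Plane), -waveShift c ħ ξ)) (𝓝[>] 0)
        (𝓝 (0 : Plane × Plane)) := by
      simpa using hr0.smul_const ((0 : Plane), -waveShift c ħ ξ)
    have h1 := symTendsto_rescale χ.smooth_infty hr0 ha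
    have h2 := h1.mul (symTendsto_const (𝓝[>] 0) (fun z => (((W ξ)⁻¹ : ℝ) : ℂ) *
        starIntegrand c ħ g h (y - waveShift c ħ ξ) z)) (fun ε => hχ1.smooth (ε, ξ))
      (fun _ => hSt.smooth ((0 : ℝ), ξ)) contDiff_const (hSt.smooth ((0 : ℝ), ξ))
    simpa only [hχ, one_mul] using h2
  obtain ⟨Cκ, hCκ⟩ := exists_bound_mul_waveShift c ħ κ y (k + m)
  have hlim2 : Tendsto (fun ε => ∫ ξ, ∫ z, Φ ε z ξ) (𝓝[>] 0)
      (𝓝 (∫ ξ, κ ξ * planeWave ξ y * planeStar c ħ g h (y - waveShift c ħ ξ))) := by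
    have hev : ∀ᶠ ε : ℝ in 𝓝[>] 0, ε < 1 := nhdsWithin_le_nhds (gt_mem_nhds zero_lt_one)
    refine tendsto_integral_filter_of_dominated_convergence
      (fun ξ => (Cκ * C) * intWeight ξ) ?_ ?_ ?_ ?_
    · filter_upwards [self_mem_nhdsWithin] with ε hε
      exact (hΦ ε hε).integral_prod_right.aestronglyMeasurable
    · filter_upwards [self_mem_nhdsWithin, hev] with ε hε hε1
      refine Eventually.of_forall fun ξ => ?_
      rw [hinner ε hε hε1 ξ, norm_mul, norm_mul, norm_mul, norm_planeWave, mul_one,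
        Complex.norm_real, Real.norm_of_nonneg (hW ξ).le]
      have hC0 : 0 ≤ C := (norm_nonneg _).trans (hC (ε, ξ))
      calc ‖κ ξ‖ * (W ξ * ‖oscInt c ħ (B (ε, ξ))‖) = ‖κ ξ‖ * W ξ * ‖oscInt c ħ (B (ε, ξ))‖ := by
            ring
        _ ≤ Cκ * intWeight ξ * C := mul_le_mul (hCκ ξ) (hC _) (norm_nonneg _)
            (le_trans (by have := (hW ξ).le; positivity) (hCκ ξ))
        _ = _ := by ring
    · exact (integrable_intWeight volume (by rw [finrank_plane_eq]; norm_num)).const_mul _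
    · refine Eventually.of_forall fun ξ => ?_
      have h1 := ((hB_lim ξ).const_mul ((W ξ : ℝ) : ℂ)).const_mul (κ ξ * planeWave ξ y)
      have hW' : ((W ξ : ℝ) : ℂ) ≠ 0 := by exact_mod_cast (hW ξ).ne'
      rw [Complex.ofReal_inv, mul_inv_cancel_left₀ hW'] at h1
      refine h1.congr' ?_
      filter_upwards [self_mem_nhdsWithin, hev] with ε hε hε1
      exact (hinner ε hε hε1 ξ).symm
  refine tendsto_nhds_unique (hlim.congr' ?_) hlim2
  filter_upwards [self_mem_nhdsWithin] with ε hε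
  rw [← integral_integral_swap (hΦ ε hε)]
  refine integral_congr_ae (Eventually.of_forall fun z => ?_)
  simp only [Φ, superposAmplitude]
  rw [integral_mul_const, integral_const_mul, integral_mul_const, integral_const_mul, hbg]
  rfl

omit hc hħ in
theorem SchwartzMap.isOC (f : 𝓢(Plane, ℂ)) : IsOC f :=
  ⟨0, by simpa using f.unifSymbol (ι := Unit) 0⟩

/-- The star product with a Schwartz function is a superposition of star products with plane waves.
It is the case `g = 1` of `planeStar_superposition`. -/
theorem planeStar_schwartz (f : 𝓢(Plane, ℂ)) {g : Plane → ℂ} (hg : IsOC g) (y : Plane) :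
    planeStar c ħ f g y = ∫ ξ, 𝓕 f ξ * planeWave ξ y * g (y - waveShift c ħ ξ) := by
  have h := planeStar_superposition hc hħ (𝓕 f) f.isOC (isOC_const 1) hg (fun y => ?_) y
  · simpa only [planeStar_one_left hc hħ hg] using h
  · have h : 𝓕⁻ (𝓕 f) = f := by simp
    have h0 := congrArg (fun f : 𝓢(Plane, ℂ) => f y) h
    simp only [SchwartzMap.fourierInv_coe] at h0
    rw [Real.fourierInv_eq'] at h0
    rw [← h0]
    refine integral_congr_ae (Eventually.of_forall fun ξ => ?_)
    simp only [planeWave, smul_eq_mul, mul_one]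
    ring

theorem planeStar_assoc_schwartz (f : 𝓢(Plane, ℂ)) {g h : Plane → ℂ} (hg : IsOC g) (hh : IsOC h)
    (y : Plane) :
    planeStar c ħ (planeStar c ħ f g) h y = planeStar c ħ f (planeStar c ħ g h) y := by
  rw [planeStar_schwartz hc hħ f (hg.planeStar hc hħ hh)]
  exact planeStar_superposition hc hħ (𝓕 f) (f.isOC.planeStar hc hħ hg) hg hh
    (planeStar_schwartz hc hħ f hg) y

/-- Both sides are continuous in the first factor, which is a limit of compactly supported cutoffs
of itself that are bounded in one step of the inductive limit. -/
theorem planeStar_assoc {f g h : Plane → ℂ} (hf : IsOC f) (hg : IsOC g) (hh : IsOC h)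
    (y : Plane) :
    planeStar c ħ (planeStar c ħ f g) h y = planeStar c ħ f (planeStar c ħ g h) y := by
  obtain ⟨ρ, hρ, hρc⟩ := exists_schwartz_one (V := Plane)
  have hgh := hg.planeStar hc hħ hh
  obtain ⟨k, hf⟩ := hf
  obtain ⟨m, hg'⟩ := id hg
  obtain ⟨n, hh'⟩ := id hh
  obtain ⟨l, hgh⟩ := hgh
  let r : ℕ → ℝ := fun j => 1 / ((j : ℝ) + 1)
  have hr : ∀ j, 0 < r j := fun j => by positivity
  have hr1 : ∀ j, |r j| ≤ 1 := fun j => by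
    rw [abs_of_pos (hr j)]
    exact (div_le_one (by positivity)).2 (by linarith [Nat.cast_nonneg (α := ℝ) j])
  have hr0 : Tendsto r atTop (𝓝 0) := tendsto_one_div_add_atTop_nhds_zero_nat
  let F : ℕ → Plane → ℂ := fun j y => ρ (r j • y) * f y
  have hρ1 : UnifSymbol (fun _ : Plane => (1 : ℝ)) (fun (j : ℕ) y => ρ (r j • y)) := by
    have := (ρ.unifSymbol (ι := Unit) 0).comp_affine (W := fun _ : Plane => (1 : ℝ))
      (fun z => by positivity) (fun _ : ℕ => ()) (fun _ => 1) r
      (ContinuousLinearMap.id ℝ _) (fun _ => 0) hr1 (fun _ _ => by simp)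
    simpa using this
  have hF : UnifSymbol (fun y : Plane => (1 + ‖y‖ ^ 2) ^ k) F := by
    simpa only [one_mul] using hρ1.mul (hf.reindex fun _ : ℕ => ())
  have hFT : SymTendsto atTop F f := by
    have h1 := symTendsto_rescale ρ.smooth_infty hr0 (tendsto_const_nhds (x := (0 : Plane)))
    simp only [add_zero] at h1
    have h2 := h1.mul (symTendsto_const atTop f) hρ1.smooth (fun _ => hf.smooth ())
      contDiff_const (hf.smooth ())
    simpa only [hρ, one_mul] using h2
  have hFs : ∀ j, ∃ s : 𝓢(Plane, ℂ), ⇑s = F j := fun j =>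
    ⟨((hρc.comp_smul (hr j).ne').mul_right).toSchwartzMap (hF.smooth j), rfl⟩
  have hL : Tendsto (fun j => planeStar c ħ (planeStar c ħ (F j) g) h y) atTop
      (𝓝 (planeStar c ħ (planeStar c ħ f g) h y)) := by
    have hg1 := hg'.reindex fun _ : ℕ => ()
    exact planeStar_tendsto hc hħ (planeStar_unifSymbol hc hħ hF hg1)
      (hh'.reindex fun _ : ℕ => ()) (planeStar_unifSymbol hc hħ hf hg') hh'
      (planeStar_symTendsto hc hħ hF hg1 hf hg' hFT (symTendsto_const _ g))
      (symTendsto_const _ h) y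
  have hR : Tendsto (fun j => planeStar c ħ (F j) (planeStar c ħ g h) y) atTop
      (𝓝 (planeStar c ħ f (planeStar c ħ g h) y)) :=
    planeStar_tendsto hc hħ hF (hgh.reindex fun _ : ℕ => ()) hf hgh hFT
      (symTendsto_const _ _) y
  refine tendsto_nhds_unique hL (hR.congr fun j => ?_)
  obtain ⟨s, hs⟩ := hFs j
  rw [← hs]
  exact (planeStar_assoc_schwartz hc hħ s hg hh y).symm

end Assoc

/-! ### The algebra of sections -/

section Sections

theorem IsWeylSection.dirDeriv (v : Plane × Plane) {F : Plane × Plane → ℂ}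
    (hF : IsWeylSection F) : IsWeylSection (dirDeriv v F) := by
  rw [dirDeriv_expand v F]
  exact (((hF.pdX 0).smul _).add ((hF.pdX 1).smul _)).add
    (((hF.pdY 0).smul _).add ((hF.pdY 1).smul _))

theorem IsWeylSection.dirDerivs (L : List (Plane × Plane)) {F : Plane × Plane → ℂ}
    (hF : IsWeylSection F) : IsWeylSection (dirDerivs L F) := by
  induction L generalizing F with
  | nil => exact hF
  | cons v L ih => exact ih (hF.dirDeriv v)

/-- Bounds on the partial derivatives `∂_y^α` give bounds on all iterated directional derivatives
along the fibres. -/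
theorem exists_bound_dirDerivs_fibre {k : ℕ} (L : List Plane) {F : Plane × Plane → ℂ}
    (hF : ContDiff ℝ ∞ F) (h : ∀ α : Fin 2 → ℕ, ∃ C : ℝ, ∀ x y : Plane,
      ‖pdYs α F (x, y)‖ ≤ C * (1 + ‖y‖ ^ 2) ^ k) :
    ∃ C : ℝ, ∀ x y : Plane, ‖dirDerivs (L.map fun w => ((0, w) : Plane × Plane)) F (x, y)‖ ≤
      C * (1 + ‖y‖ ^ 2) ^ k := by
  induction L generalizing F with
  | nil => exact h 0
  | cons w L ih =>
    refine ih (dirDeriv_smooth _ hF) fun α => ?_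
    obtain ⟨C₀, h₀⟩ := h (α + Pi.single 0 1)
    obtain ⟨C₁, h₁⟩ := h (α + Pi.single 1 1)
    have e : dirDeriv (0, w) F = (w 0 : ℂ) • pdY 0 F + (w 1 : ℂ) • pdY 1 F := by
      rw [dirDeriv_expand]
      funext q
      simp [dirDeriv, pdY]
    have s : ∀ i, ContDiff ℝ ∞ (pdY i F) := fun i => dirD_smooth _ hF
    have s' : ∀ (z : ℂ) i, ContDiff ℝ ∞ (z • pdY i F) := fun z i => (s i).const_smul z
    refine ⟨|w 0| * C₀ + |w 1| * C₁, fun x y => ?_⟩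
    rw [e, pdYs_add α (s' _ 0) (s' _ 1),
      pdYs_smul α _ (s 0), pdYs_smul α _ (s 1), pdYs_pdY α 0 hF, pdYs_pdY α 1 hF]
    refine (norm_add_le _ _).trans ?_
    simp only [Pi.smul_apply, norm_smul, Complex.norm_real, Real.norm_eq_abs]
    rw [_root_.add_mul, _root_.mul_assoc, _root_.mul_assoc]
    exact add_le_add (mul_le_mul_of_nonneg_left (h₀ x y) (abs_nonneg _))
      (mul_le_mul_of_nonneg_left (h₁ x y) (abs_nonneg _))

theorem IsWeylSection.isFibreOC {F : Plane × Plane → ℂ} (hF : IsWeylSection F) :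
    IsFibreOC F := by
  refine ⟨hF.smooth, fun L => ?_⟩
  have hG := hF.dirDerivs L
  obtain ⟨k, hk⟩ := hG.bounded 0
  refine ⟨k, fun x => hG.smooth.comp (contDiff_const.prodMk contDiff_id), fun M => ?_⟩
  obtain ⟨C, hC⟩ := exists_bound_dirDerivs_fibre M hG.smooth hk
  refine ⟨C, fun x y => ?_⟩
  rw [dirDerivs_fibre M hG.smooth]
  exact hC x y

theorem dirDeriv_iterate (v : Plane × Plane) (n : ℕ) (F : Plane × Plane → ℂ) :
    (dirD v)^[n] F = dirDerivs (List.replicate n v) F := by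
  induction n generalizing F with
  | zero => rfl
  | succ n ih => exact ih _

theorem IsFibreOC.dirDerivs {F : Plane × Plane → ℂ} (hF : IsFibreOC F)
    (L : List (Plane × Plane)) : IsFibreOC (dirDerivs L F) := by
  induction L generalizing F with
  | nil => exact hF
  | cons v L ih => exact ih (hF.dirDeriv v)

/-- The coordinate description of sections agrees with the one by directional derivatives. -/
theorem IsFibreOC.isWeylSection {F : Plane × Plane → ℂ} (hF : IsFibreOC F)
    (hp : ∀ (i : Fin 2) (x y : Plane), F (x + basisVec i, y) = F (x, y)) : IsWeylSection F := by
  refine ⟨hF.smooth, hp, fun β => ?_⟩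
  have hG : IsFibreOC (pdXs β F) := by
    simp only [pdXs, pdX_eq, dirDeriv_iterate]
    exact (hF.dirDerivs _).dirDerivs _
  obtain ⟨k, hk⟩ := hG.bound []
  refine ⟨k, fun α => ?_⟩
  obtain ⟨C, hC⟩ := hk.bound (List.replicate (α 1) (basisVec 1) ++
    List.replicate (α 0) (basisVec 0))
  refine ⟨C, fun x y => ?_⟩
  have h := hC x y
  simp only [_root_.dirDerivs] at h
  rw [dirDerivs_fibre _ hG.smooth] at h
  simpa only [pdYs, pdY_eq, dirDeriv_iterate, ← dirDerivs_append, List.map_append,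
    List.map_replicate] using h

theorem weylD_coe (i : Fin 2) (F : WeylSection) :
    (weylD i F).1 = dirDeriv (basisVec i, -basisVec i) F.1 := by
  have e : ((basisVec i, -basisVec i) : Plane × Plane) =
      (basisVec i, 0) + (-1 : ℝ) • (0, basisVec i) := by
    refine Prod.ext ?_ ?_ <;> simp
  rw [e, dirDeriv_add_dir]
  funext p
  rw [dirDeriv_smul_dir]
  change _ + (-1 : ℂ) * _ = _
  push_cast
  rfl

theorem weylD_comm (i j : Fin 2) (F : WeylSection) : weylD i (weylD j F) = weylD j (weylD i F) := by
  apply Subtype.ext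
  rw [weylD_coe, weylD_coe, weylD_coe, weylD_coe, dirDeriv_comm _ _ F.2.smooth]

variable {c ħ : ℝ} (hc : c ≠ 0) (hħ : ħ ≠ 0)

include hc hħ

theorem isStarProduct_weylStar (F G : WeylSection) : IsStarProduct c ħ F G (weylStar c ħ F G) := by
  have h : ∃ H, IsStarProduct c ħ F G H := by
    refine ⟨⟨fibStar c ħ F.1 G.1, (F.2.isFibreOC.fibStar hc hħ G.2.isFibreOC).isWeylSection
      fun i x y => ?_⟩, fun x y =>
        hasStarValue_planeStar hc hħ (F.2.isFibreOC.isOC x) (G.2.isFibreOC.isOC x) y⟩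
    simp only [fibStar, F.2.periodic i x, G.2.periodic i x]
  rw [weylStar, dif_pos h]
  exact h.choose_spec

theorem weylStar_coe (F G : WeylSection) : (weylStar c ħ F G).1 = fibStar c ħ F.1 G.1 := by
  funext p
  exact (isStarProduct_weylStar hc hħ F G p.1 p.2).planeStar_eq.symm

theorem weylStar_add_left (F F' G : WeylSection) :
    weylStar c ħ (F + F') G = weylStar c ħ F G + weylStar c ħ F' G := by
  apply Subtype.ext
  funext p
  have h := fibStar_add_left hc hħ F.2.isFibreOC F'.2.isFibreOC G.2.isFibreOC p
  rw [← weylStar_coe hc hħ, ← weylStar_coe hc hħ] at h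
  rw [weylStar_coe hc hħ]
  exact h

theorem weylStar_add_right (F G G' : WeylSection) :
    weylStar c ħ F (G + G') = weylStar c ħ F G + weylStar c ħ F G' := by
  apply Subtype.ext
  funext p
  have h := fibStar_add_right hc hħ F.2.isFibreOC G.2.isFibreOC G'.2.isFibreOC p
  rw [← weylStar_coe hc hħ, ← weylStar_coe hc hħ] at h
  rw [weylStar_coe hc hħ]
  exact h

theorem weylStar_smul_left (z : ℂ) (F G : WeylSection) :
    weylStar c ħ (z • F) G = z • weylStar c ħ F G := by
  apply Subtype.ext
  funext p
  have h := fibStar_mul_left hc hħ z F.2.isFibreOC G.2.isFibreOC p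
  rw [← weylStar_coe hc hħ] at h
  rw [weylStar_coe hc hħ]
  exact h

theorem weylStar_smul_right (z : ℂ) (F G : WeylSection) :
    weylStar c ħ F (z • G) = z • weylStar c ħ F G := by
  apply Subtype.ext
  funext p
  have h := fibStar_mul_right hc hħ z F.2.isFibreOC G.2.isFibreOC p
  rw [← weylStar_coe hc hħ] at h
  rw [weylStar_coe hc hħ]
  exact h

theorem weylStar_assoc (F G H : WeylSection) :
    weylStar c ħ (weylStar c ħ F G) H = weylStar c ħ F (weylStar c ħ G H) := by
  apply Subtype.ext
  funext p
  rw [weylStar_coe hc hħ, weylStar_coe hc hħ, weylStar_coe hc hħ, weylStar_coe hc hħ]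
  exact planeStar_assoc hc hħ (F.2.isFibreOC.isOC _) (G.2.isFibreOC.isOC _) (H.2.isFibreOC.isOC _) _

theorem weylStar_one_left (F : WeylSection) : weylStar c ħ (quant torusOne) F = F := by
  apply Subtype.ext
  funext p
  rw [weylStar_coe hc hħ]
  exact planeStar_one_left hc hħ (F.2.isFibreOC.isOC _) _

theorem weylStar_one_right (F : WeylSection) : weylStar c ħ F (quant torusOne) = F := by
  apply Subtype.ext
  funext p
  rw [weylStar_coe hc hħ]
  exact planeStar_one_right hc hħ (F.2.isFibreOC.isOC _) _

theorem weylD_weylStar (i : Fin 2) (F G : WeylSection) :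
    weylD i (weylStar c ħ F G) = weylStar c ħ (weylD i F) G + weylStar c ħ F (weylD i G) := by
  apply Subtype.ext
  rw [weylD_coe, weylStar_coe hc hħ, dirDeriv_fibStar hc hħ F.2.isFibreOC G.2.isFibreOC]
  change _ = (weylStar c ħ (weylD i F) G).1 + (weylStar c ħ F (weylD i G)).1
  rw [weylStar_coe hc hħ, weylStar_coe hc hħ, weylD_coe, weylD_coe]
  rfl

/-- The star product of `f(x + y)` and `g(x + y)` at `(x, y)` depends on `x + y` only. -/
theorem quant_torusStar (f g : TorusFun) :
    quant (torusStar c ħ f g) = weylStar c ħ (quant f) (quant g) := by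
  apply Subtype.ext
  funext p
  change (weylStar c ħ (quant f) (quant g)).1 (p.1 + p.2, 0) = _
  rw [weylStar_coe hc hħ]
  simp only [fibStar, planeStar]
  congr 1
  funext z
  simp [starIntegrand, quant, add_assoc]

end Sections

theorem sigmaMap_quant (f : TorusFun) : sigmaMap (quant f) = f := by
  apply Subtype.ext
  funext x
  simp [sigmaMap, quant]

theorem quant_injective : Function.Injective quant :=
  Function.LeftInverse.injective sigmaMap_quant

theorem weylD_quant (i : Fin 2) (f : TorusFun) : weylD i (quant f) = 0 := by
  apply Subtype.ext
  rw [weylD_coe]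
  have h := dirD_comp_add (basisVec i, -basisVec i) f.2
  refine h.trans ?_
  funext p
  simp


/-! ### The differential graded algebras -/

section DGA

variable {c ħ : ℝ}

/-- Forms on the two-dimensional torus have the four coefficients of `1`, `dx⁰`, `dx¹` and `dx⁰ ∧
dx¹`. -/
theorem weylForm_ext {a b : WeylForm} (h : a ∅ = b ∅) (h0 : a {0} = b {0}) (h1 : a {1} = b {1})
    (h2 : a {0, 1} = b {0, 1}) : a = b := by
  have key : ∀ r : Finset (Fin 2), r = ∅ ∨ r = {0} ∨ r = {1} ∨ r = {0, 1} := by decide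
  funext r
  rcases key r with rfl | rfl | rfl | rfl <;> assumption

theorem neg_one_smul_weylSection (F : WeylSection) : (-1 : ℂ) • F = -F := neg_one_smul ℂ F

theorem wedgeSign_eq {s t : Finset (Fin 2)} {n : ℕ}
    (h : ((s ×ˢ t).filter (fun q => q.2 < q.1)).card = n) : wedgeSign s t = (-1) ^ n := by
  rw [wedgeSign, h]

theorem weylMul_empty (a b : WeylForm) :
    weylMul c ħ a b ∅ = weylStar c ħ (a ∅) (b ∅) := by
  have h : wedgeSign ∅ ∅ = 1 := by simpa using wedgeSign_eq (n := 0) (by decide)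
  simp [weylMul, h]

theorem weylMul_singleton (i : Fin 2) (a b : WeylForm) : weylMul c ħ a b {i} =
    weylStar c ħ (a ∅) (b {i}) + weylStar c ħ (a {i}) (b ∅) := by
  have h1 : wedgeSign ∅ {i} = 1 := by simp [wedgeSign]
  have h2 : wedgeSign {i} ∅ = 1 := by simp [wedgeSign]
  have hp : ({i} : Finset (Fin 2)).powerset = {∅, {i}} :=
    (by decide : ∀ i : Fin 2, ({i} : Finset (Fin 2)).powerset = {∅, {i}}) i
  rw [weylMul, hp, Finset.sum_pair (Finset.singleton_ne_empty i).symm]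
  simp [h1, h2]

theorem weylMul_pair (a b : WeylForm) : weylMul c ħ a b {0, 1} =
    weylStar c ħ (a ∅) (b {0, 1}) + (weylStar c ħ (a {0}) (b {1}) -
      weylStar c ħ (a {1}) (b {0}) + weylStar c ħ (a {0, 1}) (b ∅)) := by
  have hp : ({0, 1} : Finset (Fin 2)).powerset = {∅, {0}, {1}, {0, 1}} := by decide
  have d1 : ({0, 1} \ {0} : Finset (Fin 2)) = {1} := by decide
  have d2 : ({0, 1} \ {1} : Finset (Fin 2)) = {0} := by decide
  have w1 : wedgeSign ∅ {0, 1} = 1 := by simpa using wedgeSign_eq (n := 0) (by decide)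
  have w2 : wedgeSign {0} {1} = 1 := by simpa using wedgeSign_eq (n := 0) (by decide)
  have w3 : wedgeSign {1} {0} = -1 := by simpa using wedgeSign_eq (n := 1) (by decide)
  have w4 : wedgeSign {0, 1} ∅ = 1 := by simpa using wedgeSign_eq (n := 0) (by decide)
  rw [weylMul, hp, Finset.sum_insert (by decide), Finset.sum_insert (by decide),
    Finset.sum_insert (by decide), Finset.sum_singleton, Finset.sdiff_empty, Finset.sdiff_self,
    d1, d2, w1, w2, w3, w4]
  simp only [one_smul, neg_one_smul_weylSection]
  abel

theorem weylQ_empty (a : WeylForm) : weylQ a ∅ = 0 := rfl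

theorem weylQ_singleton (i : Fin 2) (a : WeylForm) : weylQ a {i} = weylD i (a ∅) := by
  change ∑ j ∈ {i}, wedgeSign {j} (({i} : Finset (Fin 2)).erase j) •
    weylD j (a (({i} : Finset (Fin 2)).erase j)) = _
  simp [wedgeSign]

theorem weylQ_pair (a : WeylForm) :
    weylQ a {0, 1} = weylD 0 (a {1}) - weylD 1 (a {0}) := by
  change ∑ j ∈ {0, 1}, wedgeSign {j} (({0, 1} : Finset (Fin 2)).erase j) •
    weylD j (a (({0, 1} : Finset (Fin 2)).erase j)) = _
  have d1 : ({0, 1} : Finset (Fin 2)).erase 0 = {1} := by decide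
  have d2 : ({0, 1} : Finset (Fin 2)).erase 1 = {0} := by decide
  have w2 : wedgeSign {0} {1} = 1 := by simpa using wedgeSign_eq (n := 0) (by decide)
  have w3 : wedgeSign {1} {0} = -1 := by simpa using wedgeSign_eq (n := 1) (by decide)
  rw [Finset.sum_pair (by decide), d1, d2, w2, w3, one_smul,
    neg_one_smul_weylSection, sub_eq_add_neg]

theorem weylQ_weylQ (a : WeylForm) : weylQ (weylQ a) = 0 := by
  refine weylForm_ext ?_ ?_ ?_ ?_
  · exact weylQ_empty _
  · rw [weylQ_singleton, weylQ_empty, map_zero]; rfl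
  · rw [weylQ_singleton, weylQ_empty, map_zero]; rfl
  · rw [weylQ_pair, weylQ_singleton, weylQ_singleton, weylD_comm, sub_self]; rfl

theorem quantForm_empty (f : TorusFun) : quantForm f ∅ = quant f := by
  simp [quantForm]

theorem quantForm_of_ne (f : TorusFun) {s : Finset (Fin 2)} (hs : s ≠ ∅) : quantForm f s = 0 := by
  simp [quantForm, hs]

theorem quantForm_mem (f : TorusFun) : quantForm f ∈ weylDeg 0 := fun s hs =>
  quantForm_of_ne f fun h => hs (by simp [h])

theorem isInternal_weylDeg : DirectSum.IsInternal weylDeg := by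
  refine DirectSum.isInternal_submodule_of_iSupIndep_of_iSup_eq_top ?_ ?_
  · intro i
    rw [Submodule.disjoint_def]
    intro a ha ha'
    let N : Submodule ℂ WeylForm :=
      { carrier := {a | ∀ s, s.card = i → a s = 0}
        add_mem' := fun ha hb s hs => by simp [ha s hs, hb s hs]
        zero_mem' := fun _ _ => rfl
        smul_mem' := fun z a ha s hs => by simp [ha s hs] }
    have hN : ⨆ j, ⨆ (_ : j ≠ i), weylDeg j ≤ N :=
      iSup₂_le fun j hj b hb s hs => hb s (hs.trans_ne hj.symm)
    funext s
    by_cases hs : s.card = i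
    · exact hN ha' s hs
    · exact ha s hs
  · rw [eq_top_iff]
    intro a _
    rw [← Finset.univ_sum_single a]
    refine Submodule.sum_mem _ fun s _ => Submodule.mem_iSup_of_mem s.card fun t ht => ?_
    rw [Pi.single_eq_of_ne (fun h => ht (congrArg Finset.card h))]

theorem isInternal_torusDeg : DirectSum.IsInternal torusDeg := by
  refine DirectSum.isInternal_submodule_of_iSupIndep_of_iSup_eq_top ?_ ?_
  · intro i
    by_cases hi : i = 0
    · have h : ⨆ j, ⨆ (_ : j ≠ i), torusDeg j = ⊥ := by
        rw [eq_bot_iff]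
        exact iSup₂_le fun j hj => by simp [torusDeg, hi ▸ hj]
      rw [h]
      exact disjoint_bot_right
    · simp [torusDeg, hi]
  · rw [eq_top_iff]
    exact le_iSup_of_le 0 (by simp [torusDeg])

theorem torusDeg_of_ne {i : ℕ} (hi : i ≠ 0) {f : TorusFun} (hf : f ∈ torusDeg i) : f = 0 := by
  simpa [torusDeg, hi] using hf

variable (hc : c ≠ 0) (hħ : ħ ≠ 0)

include hc hħ

theorem weylStar_zero_left (F : WeylSection) : weylStar c ħ 0 F = 0 := by
  simpa using weylStar_smul_left hc hħ 0 0 F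

theorem weylStar_zero_right (F : WeylSection) : weylStar c ħ F 0 = 0 := by
  simpa using weylStar_smul_right hc hħ 0 F 0

theorem weylStar_sub_left (F F' G : WeylSection) :
    weylStar c ħ (F - F') G = weylStar c ħ F G - weylStar c ħ F' G := by
  rw [eq_sub_iff_add_eq, ← weylStar_add_left hc hħ, sub_add_cancel]

theorem weylStar_sub_right (F G G' : WeylSection) :
    weylStar c ħ F (G - G') = weylStar c ħ F G - weylStar c ħ F G' := by
  rw [eq_sub_iff_add_eq, ← weylStar_add_right hc hħ, sub_add_cancel]

theorem weylMul_assoc (a b d : WeylForm) :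
    weylMul c ħ (weylMul c ħ a b) d = weylMul c ħ a (weylMul c ħ b d) := by
  refine weylForm_ext ?_ ?_ ?_ ?_ <;>
  · simp only [weylMul_empty, weylMul_singleton, weylMul_pair, weylStar_add_left hc hħ,
      weylStar_add_right hc hħ, weylStar_sub_left hc hħ, weylStar_sub_right hc hħ,
      weylStar_assoc hc hħ]
    try abel

theorem weylMul_leibniz (i : ℕ) (a b : WeylForm) (ha : a ∈ weylDeg i) :
    weylQ (weylMul c ħ a b) =
      weylMul c ħ (weylQ a) b + (-1 : ℂ) ^ i • weylMul c ħ a (weylQ b) := by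
  have h0 : i ≠ 0 → a ∅ = 0 := fun h => ha ∅ (by simpa using h.symm)
  have h1 : i ≠ 1 → ∀ j, a {j} = 0 := fun h j => ha {j} (by simpa using h.symm)
  have key : i = 0 ∨ i = 1 ∨ i ≠ 0 ∧ i ≠ 1 := by omega
  rcases key with rfl | rfl | ⟨hi, hi'⟩
  · refine weylForm_ext ?_ ?_ ?_ ?_ <;>
    · simp only [Pi.add_apply, weylMul_empty, weylMul_singleton, weylMul_pair,
        weylQ_empty, weylQ_singleton,
        weylQ_pair, h1 zero_ne_one, weylStar_zero_left hc hħ, weylStar_zero_right hc hħ,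
        weylD_weylStar hc hħ, weylStar_sub_left hc hħ, weylStar_sub_right hc hħ, map_add,
        map_zero, pow_zero, one_smul]
      abel
  · refine weylForm_ext ?_ ?_ ?_ ?_ <;>
    · simp only [Pi.add_apply, Pi.smul_apply, weylMul_empty, weylMul_singleton, weylMul_pair,
        weylQ_empty, weylQ_singleton,
        weylQ_pair, h0 one_ne_zero, weylStar_zero_left hc hħ, weylStar_zero_right hc hħ,
        weylD_weylStar hc hħ, weylStar_sub_left hc hħ, map_add,
        map_zero, pow_one, neg_one_smul_weylSection]
      abel
  · refine weylForm_ext ?_ ?_ ?_ ?_ <;>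
    · simp only [Pi.add_apply, Pi.smul_apply, weylMul_empty, weylMul_singleton, weylMul_pair,
        weylQ_empty, weylQ_singleton,
        weylQ_pair, h0 hi, h1 hi', weylStar_zero_left hc hħ, weylStar_zero_right hc hħ,
        map_zero, smul_zero, add_zero, sub_zero]

theorem isDGA_weyl : IsDGA weylDeg (weylMul c ħ) weylOne weylQ where
  internal := isInternal_weylDeg
  add_mul a b d := by
    funext r
    simp [weylMul, weylStar_add_left hc hħ, Finset.sum_add_distrib]
  mul_add a b d := by
    funext r
    simp [weylMul, weylStar_add_right hc hħ, Finset.sum_add_distrib]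
  smul_mul z a b := by
    funext r
    simp only [weylMul, Pi.smul_apply, weylStar_smul_left hc hħ, Finset.smul_sum]
    exact Finset.sum_congr rfl fun s _ => smul_comm _ _ _
  mul_smul z a b := by
    funext r
    simp only [weylMul, Pi.smul_apply, weylStar_smul_right hc hħ, Finset.smul_sum]
    exact Finset.sum_congr rfl fun s _ => smul_comm _ _ _
  mul_assoc := weylMul_assoc hc hħ
  one_mul a := by
    have h : ∀ {s : Finset (Fin 2)}, s ≠ ∅ → weylOne s = 0 := fun hs => quantForm_of_ne _ hs
    have h0 : weylOne ∅ = quant torusOne := quantForm_empty _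
    refine weylForm_ext ?_ ?_ ?_ ?_ <;>
    simp [weylMul_empty, weylMul_singleton, weylMul_pair, h, h0, weylStar_zero_left hc hħ,
      weylStar_one_left hc hħ]
  mul_one a := by
    have h : ∀ {s : Finset (Fin 2)}, s ≠ ∅ → weylOne s = 0 := fun hs => quantForm_of_ne _ hs
    have h0 : weylOne ∅ = quant torusOne := quantForm_empty _
    refine weylForm_ext ?_ ?_ ?_ ?_ <;>
    simp [weylMul_empty, weylMul_singleton, weylMul_pair, h, h0, weylStar_zero_right hc hħ,
      weylStar_one_right hc hħ]
  one_mem := quantForm_mem _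
  mul_mem i j a b ha hb r hr := by
    refine Finset.sum_eq_zero fun s hs => ?_
    have hcard := Finset.card_sdiff_add_card_eq_card (Finset.mem_powerset.1 hs)
    by_cases h : s.card = i
    · rw [hb _ (by omega), weylStar_zero_right hc hħ, smul_zero]
    · rw [ha _ h, weylStar_zero_left hc hħ, smul_zero]
  d_mem i a ha r hr := by
    refine Finset.sum_eq_zero fun j hj => ?_
    have hcard := Finset.card_erase_add_one hj
    rw [ha _ (by omega), map_zero, smul_zero]
  d_d := weylQ_weylQ
  leibniz := weylMul_leibniz hc hħ

theorem torusStar_zero_left (f : TorusFun) : torusStar c ħ 0 f = 0 := by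
  rw [torusStar, map_zero, weylStar_zero_left hc hħ, map_zero]

theorem torusStar_zero_right (f : TorusFun) : torusStar c ħ f 0 = 0 := by
  rw [torusStar, map_zero, weylStar_zero_right hc hħ, map_zero]

theorem isDGA_torus : IsDGA torusDeg (torusStar c ħ) torusOne 0 where
  internal := isInternal_torusDeg
  add_mul f g h := by simp only [torusStar, map_add, weylStar_add_left hc hħ]
  mul_add f g h := by simp only [torusStar, map_add, weylStar_add_right hc hħ]
  smul_mul z f g := by simp only [torusStar, map_smul, weylStar_smul_left hc hħ]
  mul_smul z f g := by simp only [torusStar, map_smul, weylStar_smul_right hc hħ]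
  mul_assoc f g h := quant_injective (by
    simp only [quant_torusStar hc hħ, weylStar_assoc hc hħ])
  one_mul f := quant_injective (by rw [quant_torusStar hc hħ, weylStar_one_left hc hħ])
  mul_one f := quant_injective (by rw [quant_torusStar hc hħ, weylStar_one_right hc hħ])
  one_mem := by simp [torusDeg]
  mul_mem i j f g hf hg := by
    by_cases hi : i = 0
    · by_cases hj : j = 0
      · simp [torusDeg, hi, hj]
      · rw [torusDeg_of_ne hj hg, torusStar_zero_right hc hħ]
        exact zero_mem _
    · rw [torusDeg_of_ne hi hf, torusStar_zero_left hc hħ]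
      exact zero_mem _
  d_mem i f _ := zero_mem _
  d_d f := rfl
  leibniz i f g _ := by
    simp [torusStar_zero_left hc hħ, torusStar_zero_right hc hħ]

theorem quantForm_torusStar (f g : TorusFun) :
    quantForm (torusStar c ħ f g) = weylMul c ħ (quantForm f) (quantForm g) := by
  refine weylForm_ext ?_ ?_ ?_ ?_ <;>
  simp [weylMul_empty, weylMul_singleton, weylMul_pair, quantForm_empty, quantForm_of_ne,
    weylStar_zero_right hc hħ, weylStar_zero_left hc hħ, quant_torusStar hc hħ]

end DGA

theorem isCochainMap_quantForm : IsCochainMap torusDeg 0 weylDeg weylQ quantForm where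
  map_deg k f hf := by
    by_cases hk : k = 0
    · exact hk ▸ quantForm_mem f
    · rw [torusDeg_of_ne hk hf, map_zero]
      exact zero_mem _
  map_d f := by
    rw [LinearMap.zero_apply, map_zero]
    refine weylForm_ext ?_ ?_ ?_ ?_ <;>
    simp [weylQ_empty, weylQ_singleton, weylQ_pair, quantForm_empty, quantForm_of_ne, weylD_quant]


/-! ### Differentiation of parametric integrals -/

section ParametricIntegral

variable {V : Type*} [NormedAddCommGroup V] [NormedSpace ℝ V]

theorem contDiff_slice {g : ℝ → V → ℂ} (hg : ContDiff ℝ ∞ fun q : ℝ × V => g q.1 q.2) (t : ℝ) :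
    ContDiff ℝ ∞ (g t) :=
  hg.comp (contDiff_const.prodMk contDiff_id)

theorem fderiv_slice {g : ℝ → V → ℂ} (hg : ContDiff ℝ ∞ fun q : ℝ × V => g q.1 q.2) (t : ℝ)
    (p : V) : fderiv ℝ (g t) p =
      (fderiv ℝ (fun q : ℝ × V => g q.1 q.2) (t, p)).comp (ContinuousLinearMap.inr ℝ ℝ V) := by
  have h1 : HasFDerivAt (fun p : V => (t, p)) (ContinuousLinearMap.inr ℝ ℝ V) p :=
    hasFDerivAt_prodMk_right t p
  exact ((hg.differentiableAt_infty (t, p)).hasFDerivAt.comp p h1).fderiv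

theorem contDiff_dirDeriv_slice {g : ℝ → V → ℂ} (hg : ContDiff ℝ ∞ fun q : ℝ × V => g q.1 q.2)
    (v : V) : ContDiff ℝ ∞ fun q : ℝ × V => dirDeriv v (g q.1) q.2 := by
  have h : (fun q : ℝ × V => dirDeriv v (g q.1) q.2) =
      dirDeriv (0, v) (fun q : ℝ × V => g q.1 q.2) := by
    funext q
    simp only [dirDeriv, fderiv_slice hg]
    simp
  rw [h]
  exact dirDeriv_smooth _ hg

variable [FiniteDimensional ℝ V]

theorem hasFDerivAt_intervalIntegral {g : ℝ → V → ℂ}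
    (hg : ContDiff ℝ ∞ fun q : ℝ × V => g q.1 q.2) (p : V) :
    HasFDerivAt (fun p => ∫ t in (0 : ℝ)..1, g t p) (∫ t in (0 : ℝ)..1, fderiv ℝ (g t) p) p := by
  have := FiniteDimensional.proper ℝ V
  have hc : ∀ p, Continuous fun t => g t p := fun p =>
    hg.continuous.comp (continuous_id.prodMk continuous_const)
  have hc' : Continuous fun q : ℝ × V => fderiv ℝ (g q.1) q.2 := by
    simp only [fderiv_slice hg]
    exact ((hg.continuous_fderiv (by simp)).clm_comp continuous_const)
  obtain ⟨C, hC⟩ := ((isCompact_Icc (a := (0 : ℝ)) (b := 1)).prod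
    (isCompact_closedBall p 1)).exists_bound_of_continuousOn hc'.continuousOn
  refine intervalIntegral.hasFDerivAt_integral_of_dominated_of_fderiv_le (bound := fun _ => C)
    (F' := fun p t => fderiv ℝ (g t) p)
    (Metric.closedBall_mem_nhds p one_pos) (Eventually.of_forall fun p =>
      (hc p).aestronglyMeasurable) ?_ ?_ ?_ ?_ ?_
  · exact (hc p).intervalIntegrable _ _
  · exact (hc'.comp (continuous_id.prodMk continuous_const)).aestronglyMeasurable
  · refine Eventually.of_forall fun t ht q hq => hC (t, q) ⟨?_, hq⟩
    rw [Set.uIoc_of_le zero_le_one] at ht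
    exact ⟨ht.1.le, ht.2⟩
  · exact intervalIntegrable_const
  · exact Eventually.of_forall fun t _ q _ =>
      ((contDiff_slice hg t).differentiableAt_infty q).hasFDerivAt

theorem dirDeriv_intervalIntegral {g : ℝ → V → ℂ}
    (hg : ContDiff ℝ ∞ fun q : ℝ × V => g q.1 q.2) (v : V) :
    dirDeriv v (fun p => ∫ t in (0 : ℝ)..1, g t p) =
      fun p => ∫ t in (0 : ℝ)..1, dirDeriv v (g t) p := by
  funext p
  rw [dirDeriv, (hasFDerivAt_intervalIntegral hg p).fderiv,
    ContinuousLinearMap.intervalIntegral_apply]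
  · rfl
  · refine Continuous.intervalIntegrable ?_ _ _
    simp only [fderiv_slice hg]
    exact (((hg.continuous_fderiv (by simp)).comp
      (continuous_id.prodMk continuous_const)).clm_comp continuous_const)

/-- The induction on the order of differentiability works for all integrands at once, since
differentiation under the integral sign yields an integral of the same kind. -/
theorem contDiff_intervalIntegral {g : ℝ → V → ℂ}
    (hg : ContDiff ℝ ∞ fun q : ℝ × V => g q.1 q.2) :
    ContDiff ℝ ∞ fun p => ∫ t in (0 : ℝ)..1, g t p := by
  rw [contDiff_infty]
  intro n
  have hdiff : ∀ {g : ℝ → V → ℂ}, ContDiff ℝ ∞ (fun q : ℝ × V => g q.1 q.2) →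
      Differentiable ℝ fun p => ∫ t in (0 : ℝ)..1, g t p := fun hg p =>
    (hasFDerivAt_intervalIntegral hg p).differentiableAt
  induction n generalizing g with
  | zero => exact contDiff_zero.2 (hdiff hg).continuous
  | succ n ih =>
    push_cast
    rw [contDiff_succ_iff_fderiv]
    refine ⟨hdiff hg, by simp, contDiff_clm_apply_iff.2 fun v => ?_⟩
    have h := dirDeriv_intervalIntegral hg v
    unfold dirDeriv at h
    rw [h]
    exact ih (contDiff_dirDeriv_slice hg v)

end ParametricIntegral


/-! ### Integration along the fibres -/

section FibreIntegration

/-- The direction of `∂/∂xⁱ - ∂/∂yⁱ`. -/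
def antidiag (i : Fin 2) : Plane × Plane := (basisVec i, -basisVec i)

/-- The `i`-th coordinate of the fibre variable. -/
def fibreCoord (i : Fin 2) : Plane × Plane →L[ℝ] ℝ :=
  (EuclideanSpace.proj i).comp (ContinuousLinearMap.snd ℝ Plane Plane)

/-- The linear map that moves a point along `antidiag i` so as to multiply the `i`-th coordinate of
the fibre variable by `1 - r`. -/
def slideMap (i : Fin 2) (r : ℝ) : Plane × Plane →L[ℝ] Plane × Plane :=
  ContinuousLinearMap.id ℝ _ + (r • fibreCoord i).smulRight (antidiag i)

theorem slideMap_apply (i : Fin 2) (r : ℝ) (p : Plane × Plane) :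
    slideMap i r p = p + (r * p.2 i) • antidiag i := rfl

theorem slideMap_zero (i : Fin 2) (p : Plane × Plane) : slideMap i 0 p = p := by
  simp [slideMap_apply]

variable (i : Fin 2)

/-- The integral of `a` along `antidiag i` from the hyperplane `yⁱ = 0` to `p`, up to sign. -/
def pathInt (a : Plane × Plane → ℂ) (p : Plane × Plane) : ℂ :=
  ∫ t in (0 : ℝ)..1, (p.2 i : ℂ) * a (slideMap i (1 - t) p)

/-- The average, with density `φ`, of `a` over the points on the line through `p` in the direction
`antidiag i` with `0 ≤ yⁱ ≤ 1`. -/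
def slideInt (φ : ℝ → ℝ) (a : Plane × Plane → ℂ) (p : Plane × Plane) : ℂ :=
  ∫ s in (0 : ℝ)..1, (φ s : ℂ) * a (slideMap i 1 p + (-s) • antidiag i)

variable {i} {a : Plane × Plane → ℂ} {φ : ℝ → ℝ}

theorem dirDeriv_comp_slideMap (ha : ContDiff ℝ ∞ a) (r : ℝ) (c v : Plane × Plane) :
    dirDeriv v (fun p => a (slideMap i r p + c)) = fun p => dirDeriv v a (slideMap i r p + c) +
      (r * v.2 i : ℝ) * dirDeriv (antidiag i) a (slideMap i r p + c) := by
  rw [dirDeriv_comp_add_const v _ _ ha, slideMap_apply, dirDeriv_add_dir, dirDeriv_smul_dir]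

theorem hasDerivAt_along (ha : ContDiff ℝ ∞ a) (q d : Plane × Plane) {τ : ℝ → ℝ} {τ' s : ℝ}
    (hτ : HasDerivAt τ τ' s) :
    HasDerivAt (fun s => a (q + τ s • d)) (τ' * dirDeriv d a (q + τ s • d)) s := by
  have h1 : HasDerivAt (fun s => q + τ s • d) (τ' • d) s := (hτ.smul_const d).const_add q
  have h2 := (ha.differentiableAt_infty (q + τ s • d)).hasFDerivAt.comp_hasDerivAt s h1
  refine h2.congr_deriv ?_
  simp [dirDeriv]

theorem contDiff_pathInt_integrand (ha : ContDiff ℝ ∞ a) : ContDiff ℝ ∞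
    fun q : ℝ × (Plane × Plane) => ((q.2.2 i : ℝ) : ℂ) * a (slideMap i (1 - q.1) q.2) := by
  have h1 : ContDiff ℝ ∞ fun q : ℝ × (Plane × Plane) => fibreCoord i q.2 :=
    (fibreCoord i).contDiff.comp contDiff_snd
  have h2 : ContDiff ℝ ∞ fun q : ℝ × (Plane × Plane) => q.2 + ((1 - q.1) * fibreCoord i q.2) •
      antidiag i :=
    contDiff_snd.add (((contDiff_const.sub contDiff_fst).mul h1).smul contDiff_const)
  exact (Complex.ofRealCLM.contDiff.comp h1).mul (ha.comp h2)

theorem contDiff_slideInt_integrand (ha : ContDiff ℝ ∞ a) (hφ : ContDiff ℝ ∞ φ) : ContDiff ℝ ∞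
    fun q : ℝ × (Plane × Plane) => (φ q.1 : ℂ) * a (slideMap i 1 q.2 + (-q.1) • antidiag i) := by
  have h2 : ContDiff ℝ ∞ fun q : ℝ × (Plane × Plane) => slideMap i 1 q.2 + (-q.1) • antidiag i :=
    ((slideMap i 1).contDiff.comp contDiff_snd).add (contDiff_fst.neg.smul contDiff_const)
  exact (Complex.ofRealCLM.contDiff.comp (hφ.comp contDiff_fst)).mul (ha.comp h2)

theorem pathInt_smooth (ha : ContDiff ℝ ∞ a) : ContDiff ℝ ∞ (pathInt i a) :=
  contDiff_intervalIntegral (contDiff_pathInt_integrand ha)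

theorem slideInt_smooth (ha : ContDiff ℝ ∞ a) (hφ : ContDiff ℝ ∞ φ) :
    ContDiff ℝ ∞ (slideInt i φ a) :=
  contDiff_intervalIntegral (contDiff_slideInt_integrand ha hφ)

theorem continuous_comp_slideMap (ha : ContDiff ℝ ∞ a) (p : Plane × Plane) :
    Continuous fun t : ℝ => a (slideMap i (1 - t) p) := by
  refine ha.continuous.comp ?_
  simp only [slideMap_apply]
  fun_prop

theorem continuous_slideInt_integrand (ha : ContDiff ℝ ∞ a) (hφ : ContDiff ℝ ∞ φ)
    (p : Plane × Plane) :
    Continuous fun s : ℝ => (φ s : ℂ) * a (slideMap i 1 p + (-s) • antidiag i) :=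
  (contDiff_slideInt_integrand ha hφ).continuous.comp (continuous_id.prodMk continuous_const)

/-- The derivative of the shrinking slide in its parameter is a derivative along `antidiag i`. -/
theorem pathInt_dirDeriv_antidiag (ha : ContDiff ℝ ∞ a) (p : Plane × Plane) :
    pathInt i (dirDeriv (antidiag i) a) p = a (slideMap i 1 p) - a p := by
  have hd : ∀ t : ℝ, HasDerivAt (fun t => -a (slideMap i (1 - t) p))
      ((p.2 i : ℂ) * dirDeriv (antidiag i) a (slideMap i (1 - t) p)) t := fun t => by
    have hτ : HasDerivAt (fun t : ℝ => (1 - t) * p.2 i) (-p.2 i) t := by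
      simpa using ((hasDerivAt_id t).const_sub 1).mul_const (p.2 i)
    refine (hasDerivAt_along ha p (antidiag i) hτ).neg.congr_deriv ?_
    simp [slideMap_apply]
  rw [pathInt, intervalIntegral.integral_eq_sub_of_hasDerivAt (fun t _ => hd t)
    ((continuous_const.mul (continuous_comp_slideMap (dirDeriv_smooth _ ha) p)).intervalIntegrable
      _ _), sub_self, slideMap_zero, sub_zero]
  ring

/-- The term with the derivative along `antidiag i` that the moving end point produces is integrated
by parts; only a boundary value at the hyperplane `yⁱ = 0` remains. -/
theorem dirDeriv_pathInt (ha : ContDiff ℝ ∞ a) (v : Plane × Plane) :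
    dirDeriv v (pathInt i a) = fun p =>
      pathInt i (dirDeriv v a) p + v.2 i * a (slideMap i 1 p) := by
  have hcoord : ∀ p, dirDeriv v (fun p : Plane × Plane => ((p.2 i : ℝ) : ℂ)) p = v.2 i :=
      fun p => by
    change fderiv ℝ (Complex.ofRealCLM.comp (fibreCoord i)) p v = _
    rw [ContinuousLinearMap.fderiv]
    rfl
  have hcs : ContDiff ℝ ∞ (fun p : Plane × Plane => ((p.2 i : ℝ) : ℂ)) :=
    (Complex.ofRealCLM.comp (fibreCoord i)).contDiff
  have ha' := dirDeriv_smooth (antidiag i) ha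
  unfold pathInt
  rw [dirDeriv_intervalIntegral (contDiff_pathInt_integrand ha)]
  funext p
  have hd : ∀ t : ℝ, HasDerivAt (fun t => (-(1 - t) : ℝ) * a (slideMap i (1 - t) p))
      (a (slideMap i (1 - t) p) +
        (p.2 i : ℂ) * ((1 - t : ℝ) * dirDeriv (antidiag i) a (slideMap i (1 - t) p))) t :=
      fun t => by
    have hτ : HasDerivAt (fun t : ℝ => (1 - t) * p.2 i) (-p.2 i) t := by
      simpa using ((hasDerivAt_id t).const_sub 1).mul_const (p.2 i)
    have h1 : HasDerivAt (fun t : ℝ => ((-(1 - t) : ℝ) : ℂ)) ((1 : ℝ) : ℂ) t :=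
      HasDerivAt.ofReal_comp ((((hasDerivAt_id t).const_sub 1).neg).congr_deriv (neg_neg 1))
    have h := h1.mul (hasDerivAt_along ha p (antidiag i) hτ)
    refine h.congr_deriv ?_
    simp only [slideMap_apply]
    push_cast
    ring
  have hc : Continuous fun t : ℝ => a (slideMap i (1 - t) p) +
      (p.2 i : ℂ) * ((1 - t : ℝ) * dirDeriv (antidiag i) a (slideMap i (1 - t) p)) :=
    (continuous_comp_slideMap ha p).add (continuous_const.mul
      ((Complex.continuous_ofReal.comp (by fun_prop)).mul (continuous_comp_slideMap ha' p)))
  have hint := intervalIntegral.integral_eq_sub_of_hasDerivAt (fun t _ => hd t)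
    (hc.intervalIntegrable 0 1)
  have hsplit : ∀ t : ℝ,
      dirDeriv v (fun p : Plane × Plane => ((p.2 i : ℝ) : ℂ) * a (slideMap i (1 - t) p)) p =
      (p.2 i : ℂ) * dirDeriv v a (slideMap i (1 - t) p) + v.2 i * (a (slideMap i (1 - t) p) +
        (p.2 i : ℂ) * ((1 - t : ℝ) * dirDeriv (antidiag i) a (slideMap i (1 - t) p))) := fun t => by
    have h := dirDeriv_comp_slideMap (i := i) ha (1 - t) 0 v
    simp only [add_zero] at h
    have hs : ContDiff ℝ ∞ fun p => a (slideMap i (1 - t) p) := ha.comp (slideMap i _).contDiff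
    rw [dirDeriv_mul v hcs hs, h]
    simp only [hcoord]
    push_cast
    ring
  simp only [hsplit]
  rw [intervalIntegral.integral_add, intervalIntegral.integral_const_mul (v.2 i : ℂ), hint]
  · simp
  · exact (continuous_const.mul
      (continuous_comp_slideMap (dirDeriv_smooth v ha) p)).intervalIntegrable _ _
  · exact (continuous_const.mul hc).intervalIntegrable _ _

theorem dirDeriv_slideInt (ha : ContDiff ℝ ∞ a) (hφ : ContDiff ℝ ∞ φ) (v : Plane × Plane) :
    dirDeriv v (slideInt i φ a) = fun p => slideInt i φ (dirDeriv v a) p +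
      v.2 i * slideInt i φ (dirDeriv (antidiag i) a) p := by
  unfold slideInt
  rw [dirDeriv_intervalIntegral (contDiff_slideInt_integrand ha hφ)]
  funext p
  have hs : ∀ s : ℝ, ContDiff ℝ ∞ fun p => a (slideMap i 1 p + (-s) • antidiag i) := fun s =>
    ha.comp ((slideMap i 1).contDiff.add contDiff_const)
  rw [← intervalIntegral.integral_const_mul, ← intervalIntegral.integral_add]
  · refine intervalIntegral.integral_congr fun s _ => ?_
    simp only [dirDeriv_const_mul v _ (hs s), dirDeriv_comp_slideMap ha, one_mul]
    ring
  · exact (continuous_slideInt_integrand (dirDeriv_smooth v ha) hφ p).intervalIntegrable _ _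
  · exact (continuous_const.mul (continuous_slideInt_integrand
      (dirDeriv_smooth _ ha) hφ p)).intervalIntegrable _ _

/-- Integration by parts in the averaging parameter moves the derivative along `antidiag i` onto the
density. -/
theorem slideInt_dirDeriv_antidiag (ha : ContDiff ℝ ∞ a) (hφ : ContDiff ℝ ∞ φ)
    (p : Plane × Plane) : slideInt i φ (dirDeriv (antidiag i) a) p =
      φ 0 * a (slideMap i 1 p) - φ 1 * a (slideMap i 1 p + (-1 : ℝ) • antidiag i) +
        slideInt i (deriv φ) a p := by
  have hd : ∀ s : ℝ, HasDerivAt (fun s => a (slideMap i 1 p + (-s) • antidiag i))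
      (-dirDeriv (antidiag i) a (slideMap i 1 p + (-s) • antidiag i)) s := fun s => by
    simpa using hasDerivAt_along ha (slideMap i 1 p) (antidiag i) (hasDerivAt_neg s)
  have hd' : ∀ s : ℝ, HasDerivAt (fun s => (φ s : ℂ)) ((deriv φ s : ℝ) : ℂ) s := fun s =>
    HasDerivAt.ofReal_comp (hφ.differentiable (by simp) s).hasDerivAt
  have hφ' : Continuous (deriv φ) := hφ.continuous_deriv (by simp)
  have hc : Continuous fun s : ℝ =>
      -dirDeriv (antidiag i) a (slideMap i 1 p + (-s) • antidiag i) :=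
    ((dirDeriv_smooth _ ha).continuous.comp (by fun_prop)).neg
  have h := intervalIntegral.integral_mul_deriv_eq_deriv_mul (a := 0) (b := 1)
    (fun s _ => hd' s) (fun s _ => hd s)
    ((Complex.continuous_ofReal.comp hφ').intervalIntegrable _ _) (hc.intervalIntegrable _ _)
  simp only [mul_neg, intervalIntegral.integral_neg, neg_zero, zero_smul, add_zero] at h
  simp only [slideInt]
  linear_combination -h

end FibreIntegration


/-! ### A right inverse of `∂/∂xⁱ - ∂/∂yⁱ` -/

section FibrePrimitive

/-- A family that belongs to a class of families of `O(W)` functions which is stable under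
differentiation, up to linear combinations, is a bounded family of symbols. -/
theorem unifSymbol_of_class {V ι : Type*} [NormedAddCommGroup V] [NormedSpace ℝ V] {W : V → ℝ}
    (K : (ι → V → ℂ) → Prop) (hs : ∀ A, K A → ∀ i, ContDiff ℝ ∞ (A i))
    (h0 : ∀ A, K A → ∃ C : ℝ, ∀ i z, ‖A i z‖ ≤ C * W z)
    (hd : ∀ A, K A → ∀ v, ∃ B B' : ι → V → ℂ, ∃ c : ℂ, K B ∧ K B' ∧
      ∀ i, dirDeriv v (A i) = fun z => B i z + c * B' i z) {A : ι → V → ℂ} (hA : K A) :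
    UnifSymbol W A := by
  refine ⟨hs A hA, fun L => ?_⟩
  induction L generalizing A with
  | nil => exact h0 A hA
  | cons v L ih =>
    obtain ⟨B, B', c, hB, hB', h⟩ := hd A hA v
    obtain ⟨C, hC⟩ := ih hB
    obtain ⟨C', hC'⟩ := ih hB'
    refine ⟨C + ‖c‖ * C', fun i z => ?_⟩
    simp only [_root_.dirDerivs]
    rw [h i, dirDerivs_add L (hs B hB i) (contDiff_const.mul (hs B' hB' i)),
      dirDerivs_const_mul L c (hs B' hB' i), _root_.add_mul, _root_.mul_assoc]
    refine (norm_add_le _ _).trans (add_le_add (hC i z) ?_)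
    rw [norm_mul]
    exact mul_le_mul_of_nonneg_left (hC' i z) (norm_nonneg c)

/-- The analogue of `unifSymbol_of_class` for `IsFibreOC`. -/
theorem isFibreOC_of_class (K : (Plane × Plane → ℂ) → Prop) (hs : ∀ F, K F → ContDiff ℝ ∞ F)
    (h0 : ∀ F, K F → ∃ k : ℕ, UnifSymbol (fun y : Plane => (1 + ‖y‖ ^ 2) ^ k)
      (fun x y => F (x, y)))
    (hd : ∀ F, K F → ∀ v, ∃ G G' : Plane × Plane → ℂ, ∃ c : ℂ, K G ∧ K G' ∧
      dirDeriv v F = fun p => G p + c * G' p) {F : Plane × Plane → ℂ} (hF : K F) :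
    IsFibreOC F := by
  refine ⟨hs F hF, fun L => ?_⟩
  induction L generalizing F with
  | nil => exact h0 F hF
  | cons v L ih =>
    obtain ⟨G, G', c, hG, hG', h⟩ := hd F hF v
    obtain ⟨k, hk⟩ := ih hG
    obtain ⟨k', hk'⟩ := ih hG'
    refine ⟨max k k', ?_⟩
    simp only [_root_.dirDerivs]
    rw [h, dirDerivs_add L (hs G hG) (contDiff_const.mul (hs G' hG')),
      dirDerivs_const_mul L c (hs G' hG')]
    exact (hk.mono_pow (le_max_left _ _)).add ((hk'.mono_pow (le_max_right _ _)).const_mul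
      (fun y => by positivity) (c := fun _ => c) fun _ => le_rfl)

/-- The smooth functions on the line that vanish near `0` and near `1`. -/
structure IsInnerKernel (φ : ℝ → ℝ) : Prop where
  smooth : ContDiff ℝ ∞ φ
  zero : φ =ᶠ[𝓝 0] fun _ => 0
  one : φ =ᶠ[𝓝 1] fun _ => 0

theorem IsInnerKernel.deriv {φ : ℝ → ℝ} (h : IsInnerKernel φ) : IsInnerKernel (deriv φ) := by
  refine ⟨(contDiff_infty_iff_deriv.1 h.smooth).2, ?_, ?_⟩
  · simpa using h.zero.deriv
  · simpa using h.one.deriv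

/-- A smooth function that is `1` near `0` and `0` near `1`. -/
def stepDown (s : ℝ) : ℝ := 1 - Real.smoothTransition (3 * s - 1)

theorem stepDown_smooth : ContDiff ℝ ∞ stepDown :=
  contDiff_const.sub (Real.smoothTransition.contDiff.comp
    ((contDiff_const.mul contDiff_id).sub contDiff_const))

theorem stepDown_eventually_zero : stepDown =ᶠ[𝓝 0] fun _ => 1 := by
  filter_upwards [gt_mem_nhds (show (0 : ℝ) < 1 / 3 by norm_num)] with s hs
  rw [stepDown, Real.smoothTransition.zero_of_nonpos (by linarith), sub_zero]

theorem stepDown_eventually_one : stepDown =ᶠ[𝓝 1] fun _ => 0 := by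
  filter_upwards [lt_mem_nhds (show (2 / 3 : ℝ) < 1 by norm_num)] with s hs
  rw [stepDown, Real.smoothTransition.one_of_one_le (by linarith), sub_self]

theorem isInnerKernel_deriv_stepDown : IsInnerKernel (deriv stepDown) := by
  refine ⟨(contDiff_infty_iff_deriv.1 stepDown_smooth).2, ?_, ?_⟩
  · simpa using stepDown_eventually_zero.deriv
  · simpa using stepDown_eventually_one.deriv

variable {i : Fin 2} {a : Plane × Plane → ℂ} {φ : ℝ → ℝ} {k : ℕ}

theorem sq_norm_sub_single (i : Fin 2) (r : ℝ) (y : Plane) :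
    ‖y - r • basisVec i‖ ^ 2 = ‖y‖ ^ 2 - y i ^ 2 + (y i - r) ^ 2 := by
  rw [EuclideanSpace.norm_sq_eq, EuclideanSpace.norm_sq_eq]
  fin_cases i
  · simp [Fin.sum_univ_two]
    ring
  · simp [Fin.sum_univ_two]

theorem weight_slideMap_le (k : ℕ) {t : ℝ} (ht : t ∈ Set.Icc (0 : ℝ) 1) (p : Plane × Plane) :
    (1 + ‖(slideMap i (1 - t) p).2‖ ^ 2) ^ k ≤ (1 + ‖p.2‖ ^ 2) ^ k := by
  have e : (slideMap i (1 - t) p).2 = p.2 - ((1 - t) * p.2 i) • basisVec i := by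
    simp [slideMap_apply, antidiag, sub_eq_add_neg]
  rw [e, sq_norm_sub_single]
  have h1 : p.2 i - (1 - t) * p.2 i = t * p.2 i := by ring
  have h2 : (t * p.2 i) ^ 2 ≤ p.2 i ^ 2 := by
    rw [mul_pow]
    exact mul_le_of_le_one_left (sq_nonneg _) (pow_le_one₀ ht.1 ht.2)
  rw [h1]
  refine pow_le_pow_left₀ ?_ (by linarith) k
  have h3 : p.2 i ^ 2 ≤ ‖p.2‖ ^ 2 := by
    rw [← sq_abs]
    exact pow_le_pow_left₀ (abs_nonneg _) (abs_coord_le _ _) 2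
  nlinarith [sq_nonneg (t * p.2 i)]

theorem weight_slide_le (k : ℕ) {s : ℝ} (hs : s ∈ Set.Icc (0 : ℝ) 1) (p : Plane × Plane) :
    (1 + ‖(slideMap i 1 p + (-s) • antidiag i).2‖ ^ 2) ^ k ≤ 2 ^ k * (1 + ‖p.2‖ ^ 2) ^ k := by
  have e : (slideMap i 1 p + (-s) • antidiag i).2 = p.2 - (p.2 i - s) • basisVec i := by
    simp [slideMap_apply, antidiag, sub_eq_add_neg, add_smul]
    abel
  have h2 : s ^ 2 ≤ 1 := pow_le_one₀ hs.1 hs.2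
  rw [e, sq_norm_sub_single, sub_sub_cancel, ← mul_pow]
  have h3 : p.2 i ^ 2 ≤ ‖p.2‖ ^ 2 := by
    rw [← sq_abs]
    exact pow_le_pow_left₀ (abs_nonneg _) (abs_coord_le _ _) 2
  refine pow_le_pow_left₀ ?_ ?_ k <;> nlinarith [sq_nonneg s, sq_nonneg (p.2 i)]

theorem exists_bound_slideInt (hφ : Continuous φ)
    (ha : UnifSymbol (fun y : Plane => (1 + ‖y‖ ^ 2) ^ k) (fun x y => a (x, y))) :
    ∃ C : ℝ, ∀ x y, ‖slideInt i φ a (x, y)‖ ≤ C * (1 + ‖y‖ ^ 2) ^ k := by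
  obtain ⟨C, hC⟩ := ha.bound []
  obtain ⟨D, hD⟩ := (isCompact_Icc (a := (0 : ℝ)) (b := 1)).exists_bound_of_continuousOn
    hφ.continuousOn
  refine ⟨|D| * (|C| * 2 ^ k), fun x y => ?_⟩
  have h := intervalIntegral.norm_integral_le_of_norm_le_const (a := (0 : ℝ)) (b := 1)
    (f := fun s : ℝ => (φ s : ℂ) * a (slideMap i 1 (x, y) + (-s) • antidiag i))
    (C := |D| * (|C| * 2 ^ k) * (1 + ‖y‖ ^ 2) ^ k) fun s hs => ?_
  · simpa [slideInt] using h
  · rw [Set.uIoc_of_le zero_le_one] at hs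
    have hs' : s ∈ Set.Icc (0 : ℝ) 1 := ⟨hs.1.le, hs.2⟩
    rw [norm_mul, Complex.norm_real, _root_.mul_assoc, _root_.mul_assoc]
    refine mul_le_mul ((hD s hs').trans (le_abs_self D)) ?_ (norm_nonneg _) (abs_nonneg _)
    refine (hC _ _).trans (mul_le_mul (le_abs_self C) ?_ (by positivity) (abs_nonneg _))
    exact weight_slide_le k hs' (x, y)

theorem exists_bound_pathInt
    (ha : UnifSymbol (fun y : Plane => (1 + ‖y‖ ^ 2) ^ k) (fun x y => a (x, y))) :
    ∃ C : ℝ, ∀ x y, ‖pathInt i a (x, y)‖ ≤ C * (1 + ‖y‖ ^ 2) ^ (k + 1) := by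
  obtain ⟨C, hC⟩ := ha.bound []
  refine ⟨|C|, fun x y => ?_⟩
  have h := intervalIntegral.norm_integral_le_of_norm_le_const (a := (0 : ℝ)) (b := 1)
    (f := fun t : ℝ => ((y i : ℝ) : ℂ) * a (slideMap i (1 - t) (x, y)))
    (C := |C| * (1 + ‖y‖ ^ 2) ^ (k + 1)) fun t ht => ?_
  · simpa [pathInt] using h
  · rw [Set.uIoc_of_le zero_le_one] at ht
    have ht' : t ∈ Set.Icc (0 : ℝ) 1 := ⟨ht.1.le, ht.2⟩
    have h1 : |y i| ≤ 1 + ‖y‖ ^ 2 := by nlinarith [abs_coord_le y i, sq_nonneg (‖y‖ - 1)]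
    have h2 : ‖a (slideMap i (1 - t) (x, y))‖ ≤ |C| * (1 + ‖y‖ ^ 2) ^ k :=
      (hC _ _).trans (mul_le_mul (le_abs_self C) (weight_slideMap_le k ht' (x, y)) (by positivity)
        (abs_nonneg _))
    rw [norm_mul, Complex.norm_real]
    calc _ ≤ (1 + ‖y‖ ^ 2) * (|C| * (1 + ‖y‖ ^ 2) ^ k) :=
          mul_le_mul h1 h2 (norm_nonneg _) (by positivity)
      _ = _ := by ring

/-- For densities that vanish near the end points there are no boundary terms, so that averages are
closed under differentiation, without derivatives of `a` being lost. -/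
theorem dirDeriv_slideInt_of_isInnerKernel (ha : ContDiff ℝ ∞ a) (hφ : IsInnerKernel φ)
    (v : Plane × Plane) : dirDeriv v (slideInt i φ a) = fun p =>
      slideInt i φ (dirDeriv v a) p + v.2 i * slideInt i (deriv φ) a p := by
  rw [dirDeriv_slideInt ha hφ.smooth]
  funext p
  rw [slideInt_dirDeriv_antidiag ha hφ.smooth, hφ.zero.eq_of_nhds, hφ.one.eq_of_nhds]
  simp

theorem smooth_fibre {F : Plane × Plane → ℂ} (hF : ContDiff ℝ ∞ F) (x : Plane) :
    ContDiff ℝ ∞ fun y => F (x, y) := hF.comp (contDiff_const.prodMk contDiff_id)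

/-- Derivatives along the fibre of averages involve only fibre derivatives of `a`, so that the order
of growth is preserved. -/
theorem slideInt_unifSymbol (ha : ContDiff ℝ ∞ a) (hφ : IsInnerKernel φ)
    (h : UnifSymbol (fun y : Plane => (1 + ‖y‖ ^ 2) ^ k) (fun x y => a (x, y))) :
    UnifSymbol (fun y : Plane => (1 + ‖y‖ ^ 2) ^ k) (fun x y => slideInt i φ a (x, y)) := by
  refine unifSymbol_of_class (fun A => ∃ φ a, IsInnerKernel φ ∧ ContDiff ℝ ∞ a ∧
    UnifSymbol (fun y : Plane => (1 + ‖y‖ ^ 2) ^ k) (fun x y => a (x, y)) ∧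
      A = fun x y => slideInt i φ a (x, y)) ?_ ?_ ?_ ⟨φ, a, hφ, ha, h, rfl⟩
  · rintro _ ⟨φ, a, hφ, ha, -, rfl⟩ x
    exact smooth_fibre (slideInt_smooth ha hφ.smooth) x
  · rintro _ ⟨φ, a, hφ, -, h, rfl⟩
    exact exists_bound_slideInt hφ.smooth.continuous h
  · rintro _ ⟨φ, a, hφ, ha, h, rfl⟩ w
    have h' := h.dirDeriv w
    simp only [dirDeriv_fibre w ha] at h'
    refine ⟨_, _, (w i : ℂ), ⟨φ, _, hφ, dirDeriv_smooth _ ha, h', rfl⟩,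
      ⟨_, a, hφ.deriv, ha, h, rfl⟩, fun x => ?_⟩
    rw [dirDeriv_fibre w (slideInt_smooth ha hφ.smooth), dirDeriv_slideInt_of_isInnerKernel ha hφ]

theorem IsFibreOC.slideInt (ha : IsFibreOC a) (hφ : IsInnerKernel φ) :
    IsFibreOC (slideInt i φ a) := by
  refine isFibreOC_of_class (fun F => ∃ φ a, IsInnerKernel φ ∧ IsFibreOC a ∧
    F = _root_.slideInt i φ a) ?_ ?_ ?_ ⟨φ, a, hφ, ha, rfl⟩
  · rintro _ ⟨φ, a, hφ, ha, rfl⟩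
    exact slideInt_smooth ha.smooth hφ.smooth
  · rintro _ ⟨φ, a, hφ, ha, rfl⟩
    obtain ⟨k, hk⟩ := ha.bound []
    exact ⟨k, slideInt_unifSymbol ha.smooth hφ hk⟩
  · rintro _ ⟨φ, a, hφ, ha, rfl⟩ v
    exact ⟨_, _, _, ⟨φ, _, hφ, ha.dirDeriv v, rfl⟩, ⟨_, a, hφ.deriv, ha, rfl⟩,
      dirDeriv_slideInt_of_isInnerKernel ha.smooth hφ v⟩

/-- A primitive of `a` along `antidiag i`. Integrating from the hyperplane `yⁱ = 0` would lead out
of the space of sections: derivatives in `yⁱ` would produce derivatives of `a` in `xⁱ`, whose order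
of growth in `y` may increase with the number of derivatives. Averaging over the hyperplanes
`yⁱ = s`, `0 ≤ s ≤ 1`, makes up for this. -/
def fibrePrimitive (i : Fin 2) (a : Plane × Plane → ℂ) (p : Plane × Plane) : ℂ :=
  slideInt i stepDown a p + (-1) * pathInt i a p

theorem fibrePrimitive_smooth (ha : ContDiff ℝ ∞ a) : ContDiff ℝ ∞ (fibrePrimitive i a) :=
  (slideInt_smooth ha stepDown_smooth).add (contDiff_const.mul (pathInt_smooth ha))

/-- The boundary terms of `slideInt` and `pathInt` at `yⁱ = 0` cancel. The remaining correction
contains no derivative of `a`. -/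
theorem dirDeriv_fibrePrimitive (ha : ContDiff ℝ ∞ a) (v : Plane × Plane) :
    dirDeriv v (fibrePrimitive i a) = fun p =>
      fibrePrimitive i (dirDeriv v a) p + v.2 i * slideInt i (deriv stepDown) a p := by
  unfold fibrePrimitive
  rw [dirDeriv_add v (slideInt_smooth ha stepDown_smooth) (contDiff_const.mul (pathInt_smooth ha)),
    dirDeriv_const_mul v _ (pathInt_smooth ha), dirDeriv_slideInt ha stepDown_smooth,
    dirDeriv_pathInt ha]
  funext p
  beta_reduce
  rw [slideInt_dirDeriv_antidiag ha stepDown_smooth, stepDown_eventually_zero.eq_of_nhds,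
    stepDown_eventually_one.eq_of_nhds]
  push_cast
  ring

theorem dirDeriv_antidiag_fibrePrimitive (ha : ContDiff ℝ ∞ a) :
    dirDeriv (antidiag i) (fibrePrimitive i a) = a := by
  unfold fibrePrimitive
  rw [dirDeriv_add _ (slideInt_smooth ha stepDown_smooth) (contDiff_const.mul (pathInt_smooth ha)),
    dirDeriv_const_mul _ _ (pathInt_smooth ha), dirDeriv_slideInt ha stepDown_smooth,
    dirDeriv_pathInt ha]
  funext p
  beta_reduce
  rw [pathInt_dirDeriv_antidiag ha]
  have h : (antidiag i).2 i = -1 := by simp [antidiag]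
  rw [h]
  push_cast
  ring

theorem fibrePrimitive_unifSymbol (ha : ContDiff ℝ ∞ a)
    (h : UnifSymbol (fun y : Plane => (1 + ‖y‖ ^ 2) ^ k) (fun x y => a (x, y))) :
    UnifSymbol (fun y : Plane => (1 + ‖y‖ ^ 2) ^ (k + 1))
      (fun x y => fibrePrimitive i a (x, y)) := by
  refine unifSymbol_of_class (fun A => (∃ a, ContDiff ℝ ∞ a ∧
    UnifSymbol (fun y : Plane => (1 + ‖y‖ ^ 2) ^ k) (fun x y => a (x, y)) ∧
      A = fun x y => fibrePrimitive i a (x, y)) ∨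
    UnifSymbol (fun y : Plane => (1 + ‖y‖ ^ 2) ^ (k + 1)) A) ?_ ?_ ?_ (Or.inl ⟨a, ha, h, rfl⟩)
  · rintro _ (⟨a, ha, -, rfl⟩ | h) x
    · exact smooth_fibre (fibrePrimitive_smooth ha) x
    · exact h.smooth x
  · rintro _ (⟨a, ha, h, rfl⟩ | h)
    · obtain ⟨C, hC⟩ := exists_bound_slideInt (i := i) stepDown_smooth.continuous
        (h.mono_pow k.le_succ)
      obtain ⟨D, hD⟩ := exists_bound_pathInt (i := i) h
      refine ⟨C + D, fun x y => ?_⟩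
      rw [_root_.add_mul]
      refine (norm_add_le _ _).trans (add_le_add (hC x y) ?_)
      rw [neg_one_mul, norm_neg]
      exact hD x y
    · exact h.bound []
  · rintro A (⟨a, ha, h, rfl⟩ | h) w
    · have h' := h.dirDeriv w
      simp only [dirDeriv_fibre w ha] at h'
      refine ⟨_, _, (w i : ℂ), Or.inl ⟨_, dirDeriv_smooth _ ha, h', rfl⟩,
        Or.inr (slideInt_unifSymbol (i := i) ha isInnerKernel_deriv_stepDown
          (h.mono_pow k.le_succ)), fun x => ?_⟩
      rw [dirDeriv_fibre w (fibrePrimitive_smooth ha), dirDeriv_fibrePrimitive ha]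
    · exact ⟨_, A, 0, Or.inr (h.dirDeriv w), Or.inr h, fun x => by simp⟩

theorem IsFibreOC.fibrePrimitive (ha : IsFibreOC a) : IsFibreOC (fibrePrimitive i a) := by
  refine isFibreOC_of_class (fun F => (∃ a, IsFibreOC a ∧ F = _root_.fibrePrimitive i a) ∨
    IsFibreOC F) ?_ ?_ ?_ (Or.inl ⟨a, ha, rfl⟩)
  · rintro _ (⟨a, ha, rfl⟩ | h)
    · exact fibrePrimitive_smooth ha.smooth
    · exact h.smooth
  · rintro _ (⟨a, ha, rfl⟩ | h)
    · obtain ⟨k, hk⟩ := ha.bound []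
      exact ⟨k + 1, fibrePrimitive_unifSymbol ha.smooth hk⟩
    · exact h.bound []
  · rintro F (⟨a, ha, rfl⟩ | h) v
    · exact ⟨_, _, _, Or.inl ⟨_, ha.dirDeriv v, rfl⟩,
        Or.inr (ha.slideInt isInnerKernel_deriv_stepDown), dirDeriv_fibrePrimitive ha.smooth v⟩
    · exact ⟨_, F, 0, Or.inr (h.dirDeriv v), Or.inr h, by simp⟩

theorem fibrePrimitive_periodic (h : ∀ (j : Fin 2) (x y : Plane), a (x + basisVec j, y) = a (x, y))
    (j : Fin 2) (x y : Plane) :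
    fibrePrimitive i a (x + basisVec j, y) = fibrePrimitive i a (x, y) := by
  have h' : ∀ q : Plane × Plane, a (q + (basisVec j, 0)) = a q := fun q => by
    simpa [Prod.add_def] using h j q.1 q.2
  have e1 : ∀ r : ℝ, slideMap i r (x + basisVec j, y) = slideMap i r (x, y) + (basisVec j, 0) :=
    fun r => by
      rw [slideMap_apply, slideMap_apply, add_right_comm]
      simp [Prod.add_def]
  simp only [fibrePrimitive, slideInt, pathInt, e1, add_right_comm _ (basisVec j, (0 : Plane)), h']

end FibrePrimitive

/-- `fibrePrimitive` as an operator on sections. -/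
def weylPrimitive (i : Fin 2) (F : WeylSection) : WeylSection :=
  ⟨fibrePrimitive i F.1, (IsWeylSection.isFibreOC F.2).fibrePrimitive.isWeylSection
    (fibrePrimitive_periodic F.2.periodic)⟩

theorem weylD_weylPrimitive (i : Fin 2) (F : WeylSection) : weylD i (weylPrimitive i F) = F := by
  apply Subtype.ext
  rw [weylD_coe]
  exact dirDeriv_antidiag_fibrePrimitive F.2.smooth

theorem weylD_weylPrimitive_of_ne {i j : Fin 2} (hij : i ≠ j) (F : WeylSection) :
    weylD j (weylPrimitive i F) = weylPrimitive i (weylD j F) := by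
  apply Subtype.ext
  rw [weylD_coe]
  refine (dirDeriv_fibrePrimitive F.2.smooth _).trans ?_
  have h : (-basisVec j : Plane) i = 0 := by simp [hij]
  funext p
  rw [h]
  simp only [weylPrimitive, weylD_coe, Complex.ofReal_zero, zero_mul, add_zero]

theorem weylPrimitive_zero (i : Fin 2) : weylPrimitive i 0 = 0 := by
  apply Subtype.ext
  funext p
  simp [weylPrimitive, fibrePrimitive, slideInt, pathInt]


/-! ### Cohomology -/

section Cohomology

/-- A section that is annihilated by all `∂/∂xⁱ - ∂/∂yⁱ` is constant along the lines
`t ↦ (x + t y, y - t y)`. -/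
theorem quant_sigmaMap {F : WeylSection} (hF : ∀ i, weylD i F = 0) : quant (sigmaMap F) = F := by
  have h0 : ∀ i p, dirDeriv (antidiag i) F.1 p = 0 := fun i p => by
    have h := congrArg (fun G : WeylSection => G.1 p) (hF i)
    rw [weylD_coe] at h
    exact h
  apply Subtype.ext
  funext p
  have hd : ∀ t : ℝ, HasDerivAt (fun t : ℝ => F.1 (p + t • (p.2, -p.2))) 0 t := fun t => by
    refine (hasDerivAt_along F.2.smooth p (p.2, -p.2) (hasDerivAt_id t)).congr_deriv ?_
    have e : ((p.2, -p.2) : Plane × Plane) = p.2 0 • antidiag 0 + p.2 1 • antidiag 1 := by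
      refine Prod.ext ?_ ?_ <;> ext i <;> fin_cases i <;> simp [antidiag]
    rw [e, dirDeriv_smul_add]
    simp [h0]
  have h := is_const_of_deriv_eq_zero (fun t => (hd t).differentiableAt) (fun t => (hd t).deriv) 1 0
  simpa [quant, sigmaMap, Prod.add_def] using h

/-- The closed one-forms `F dx⁰ + G dx¹` are exact. -/
theorem exists_weylD_eq {F G : WeylSection} (h : weylD 0 G = weylD 1 F) :
    ∃ H, weylD 0 H = F ∧ weylD 1 H = G := by
  refine ⟨weylPrimitive 0 F + weylPrimitive 1 (G - weylD 1 (weylPrimitive 0 F)), ?_, ?_⟩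
  · rw [map_add, weylD_weylPrimitive, weylD_weylPrimitive_of_ne one_ne_zero, map_sub, weylD_comm,
      weylD_weylPrimitive, h, sub_self, weylPrimitive_zero, add_zero]
  · rw [map_add, weylD_weylPrimitive, add_sub_cancel]

theorem weylForm_eq_zero {k : ℕ} (hk : 3 ≤ k) {a : WeylForm} (ha : a ∈ weylDeg k) : a = 0 := by
  funext s
  have h := s.card_le_univ
  rw [Fintype.card_fin] at h
  exact ha s (by omega)

/-- The cocycles of degree `0` are the quantized functions. -/
theorem cocycle_zero {a : WeylForm} (ha : a ∈ cocycles weylDeg weylQ 0) :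
    ∃ f : TorusFun, quantForm f = a := by
  obtain ⟨h0, h1⟩ := ha
  have h1' : weylQ a = 0 := h1
  refine ⟨sigmaMap (a ∅), ?_⟩
  have hD : ∀ i, weylD i (a ∅) = 0 := fun i => by
    rw [← weylQ_singleton, h1']
    rfl
  have hq := quant_sigmaMap hD
  refine weylForm_ext ?_ ?_ ?_ ?_
  · rw [quantForm_empty, hq]
  all_goals rw [quantForm_of_ne _ (by decide), h0 _ (by decide)]

/-- The cohomology in positive degrees vanishes. -/
theorem cocycle_succ {k : ℕ} {a : WeylForm} (ha : a ∈ cocycles weylDeg weylQ (k + 1)) :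
    a ∈ coboundaries weylDeg weylQ (k + 1) := by
  obtain ⟨h0, h1⟩ := ha
  have h1' : weylQ a = 0 := h1
  match k with
  | 0 =>
    have h : weylD 0 (a {1}) - weylD 1 (a {0}) = 0 := by
      rw [← weylQ_pair, h1']
      rfl
    obtain ⟨H, hH0, hH1⟩ := exists_weylD_eq (sub_eq_zero.1 h)
    refine ⟨Pi.single ∅ H, fun s hs => ?_, ?_⟩
    · exact Pi.single_eq_of_ne (fun h => hs (by simp [h])) _
    · refine weylForm_ext ?_ ?_ ?_ ?_
      · rw [weylQ_empty, h0 _ (by decide)]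
      · rw [weylQ_singleton, Pi.single_eq_same, hH0]
      · rw [weylQ_singleton, Pi.single_eq_same, hH1]
      · rw [weylQ_pair, h0 _ (by decide), Pi.single_eq_of_ne (by decide),
          Pi.single_eq_of_ne (by decide), map_zero, map_zero, sub_zero]
  | 1 =>
    refine ⟨Pi.single {1} (weylPrimitive 0 (a {0, 1})), fun s hs => ?_, ?_⟩
    · exact Pi.single_eq_of_ne (fun h => hs (by simp [h])) _
    · refine weylForm_ext ?_ ?_ ?_ ?_
      · rw [weylQ_empty, h0 _ (by decide)]
      · rw [weylQ_singleton, Pi.single_eq_of_ne (by decide), map_zero, h0 _ (by decide)]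
      · rw [weylQ_singleton, Pi.single_eq_of_ne (by decide), map_zero, h0 _ (by decide)]
      · rw [weylQ_pair, Pi.single_eq_same, Pi.single_eq_of_ne (by decide), map_zero, sub_zero,
          weylD_weylPrimitive]
  | k + 2 =>
    rw [weylForm_eq_zero (by omega) h0]
    exact zero_mem _

/-- A criterion for a cochain map to induce an isomorphism in cohomology. -/
theorem cohomologyMap_bijective {A B : Type*} [AddCommGroup A] [Module ℂ A] [AddCommGroup B]
    [Module ℂ B] {degA : ℕ → Submodule ℂ A} {dA : A →ₗ[ℂ] A} {degB : ℕ → Submodule ℂ B}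
    {dB : B →ₗ[ℂ] B} {φ : A →ₗ[ℂ] B} (h : IsCochainMap degA dA degB dB φ) (k : ℕ)
    (hinj : ∀ a ∈ cocycles degA dA k, φ a ∈ coboundaries degB dB k → a ∈ coboundaries degA dA k)
    (hsurj : ∀ b ∈ cocycles degB dB k, ∃ a ∈ cocycles degA dA k,
      φ a - b ∈ coboundaries degB dB k) : Function.Bijective (cohomologyMap h k) := by
  constructor
  · rw [injective_iff_map_eq_zero]
    intro x hx
    obtain ⟨a, rfl⟩ := Submodule.Quotient.mk_surjective _ x
    rw [Submodule.Quotient.mk_eq_zero]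
    have hx' : (Submodule.Quotient.mk (φ.restrict (h.map_cocycles k) a) :
      Cohomology degB dB k) = 0 := hx
    rw [Submodule.Quotient.mk_eq_zero] at hx'
    exact hinj a.1 a.2 hx'
  · intro x
    obtain ⟨b, rfl⟩ := Submodule.Quotient.mk_surjective _ x
    obtain ⟨a, ha, hab⟩ := hsurj b.1 b.2
    refine ⟨Submodule.Quotient.mk ⟨a, ha⟩, ?_⟩
    exact (Submodule.Quotient.eq _).2 hab

theorem cohomologyMap_quantForm_bijective (k : ℕ) :
    Function.Bijective (cohomologyMap isCochainMap_quantForm k) := by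
  cases k with
  | zero =>
    refine cohomologyMap_bijective _ _ (fun f _ hf => ?_) fun b hb => ?_
    · have h0 : quantForm f = 0 := hf
      have h1 : quant f = 0 := by rw [← quantForm_empty, h0]; rfl
      exact quant_injective (h1.trans (map_zero quant).symm)
    · obtain ⟨f, rfl⟩ := cocycle_zero hb
      refine ⟨f, ⟨by simp [torusDeg], rfl⟩, ?_⟩
      rw [sub_self]
      exact zero_mem _
  | succ k =>
    refine cohomologyMap_bijective _ _ (fun f hf _ => ?_) fun b hb => ⟨0, zero_mem _, ?_⟩
    · rw [torusDeg_of_ne k.succ_ne_zero hf.1]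
      exact zero_mem _
    · rw [map_zero, zero_sub]
      exact neg_mem (cocycle_succ hb)

end Cohomology


end

theorem proposition3 (c ħ : ℝ) (hc : c ≠ 0) (hħ : ħ ≠ 0) :
    (∀ F G : WeylSection, IsStarProduct c ħ F G (weylStar c ħ F G)) ∧
    IsDGA torusDeg (torusStar c ħ) torusOne 0 ∧
    IsDGA weylDeg (weylMul c ħ) weylOne weylQ ∧
    IsDGAQuasiIso torusDeg (torusStar c ħ) torusOne 0
      weylDeg (weylMul c ħ) weylOne weylQ quantForm :=
  ⟨isStarProduct_weylStar hc hħ, isDGA_torus hc hħ, isDGA_weyl hc hħ,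
    quantForm_torusStar hc hħ, rfl, isCochainMap_quantForm, cohomologyMap_quantForm_bijective⟩
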